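/- **Setting.** Let $(\mathbb X,d)$ be a complete, locally compact metric space in which any two points have a midpoint. A set $A\subseteq\mathbb X$ is *strongly convex* if any two points of $A$ are joined by a unique shortest path of $\mathbb X$, this path lies in $A$, and it depends continuously on its end points. Assume that $\mathbb X$ is locally strongly convex: all sufficiently small open balls around any point are strongly convex. Let $\mathrm{conv}(x)\in[0,\infty]$ be the supremum of the $\delta\ge 0$ such that all open balls $B_{\delta'}(x)$ with $\delta'\le\delta$ are strongly convex, and $\mathrm{conv}(P)=\inf_{q\in P}\mathrm{conv}(q)$. Write $B_b(x)$ and $D_b(x)$ for open and closed balls, and $D_a(K)=\{y: d(y,K)\le a\}$. Homology (singular, or simplicial for simplicial complexes) has coefficients in $\mathbb Z$, and is taken in each degree: maps below are graded maps, and "isomorphism" means isomorphism in every degree. Let $K\subseteq\mathbb X$ be compact, $x\in K$, and put $F(a,b)=H(D_a(K),D_a(K)-B_b(x))$ for $a>0$ or $b>0$, $F(0,0)=H(K,K-\{x\})$. Let $T\subseteq\mathbb R$ be an arbitrary set of radii (one takes $T=\mathbb R$ in general, and $T=\{\rho: S_\rho(x)=\{y:d(x,y)=\rho\}$ is transverse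 to all strata of $K\}$ when $K$ is Whitney stratified). For $\varepsilon\ge0$ let $A_x(\varepsilon)$ be the set of all triples $(R,r,\alpha)$ with $R\ge r>\alpha\ge\varepsilon$ such that, all maps being induced by inclusions, 1. for every $\rho\in(0,R]$, $D_\rho(x)$ is homeomorphic to a closed Euclidean ball (of some dimension) and $\rho\in T$; 2. for every $\rho\in(0,R]$, $F(0,R)\to F(0,\rho)$ and $F(0,\rho)\to F(0,0)$ are isomorphisms; and, for $i_*:F(0,R)\to F(\varepsilon,R)$, $j_*:F(\varepsilon,R)\to F(\alpha,r)$, the map $j_*i_*$ is an isomorphism of $F(0,R)$ onto $\mathrm{im}\,j_*$. Let $A_x(\varepsilon\,|\,\alpha=\alpha')=\{(R,r):(R,r,\alpha')\in A_x(\varepsilon)\}$. $K$ is *weakly homologically seemly at $x$* if there are $\varepsilon_x>0$ and functions $\alpha^l,\alpha^u:[0,\varepsilon_x]\to[0,\infty)$ with $\alpha^l\le\alpha^u$, $\alpha^l$ non-decreasing, $\alpha^u$ non-increasing, such that $\alpha^l(0)=0$, $\alpha^l(\varepsilon)\to 0$ and $\alpha^u(\varepsilon)\to\alpha^u(0)$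 as $\varepsilon\to0^+$; $A_x(\varepsilon\,|\,\alpha=\alpha')\ne\emptyset$ for all $\varepsilon\in[0,\varepsilon_x]$, $\alpha'\in[\alpha^l(\varepsilon),\alpha^u(\varepsilon)]$; and, with $d_H$ the Hausdorff distance, $$\sup_{\alpha'\in[\alpha^l(\varepsilon),\alpha^u(\varepsilon)]}d_H\big(A_x(0\,|\,\alpha=\alpha'),A_x(\varepsilon\,|\,\alpha=\alpha')\big)\to0\quad\text{as }\varepsilon\to0^+ .$$ Fix any such $\varepsilon_x,\alpha^l,\alpha^u$. For $\varepsilon\in[0,\varepsilon_x]$ and $\beta\in[\alpha^l(\varepsilon),\alpha^u(\varepsilon)]$ let $$A_x([0,\varepsilon]\,|\,\alpha\le\beta)=\bigcap_{\tilde\varepsilon\in[0,\varepsilon]}\ \bigcap_{\alpha'\in[\alpha^l(\tilde\varepsilon),\beta]}A_x(\tilde\varepsilon\,|\,\alpha=\alpha'),$$ let $\bar R(\varepsilon,\beta)$ be the supremum of the first coordinates and $\bar r(\varepsilon,\beta)$ the infimum of the second coordinates of its points $(R,r)$ (in $[-\infty,\infty]$, with $\sup\emptyset=-\infty$, $\inf\emptyset=\infty$),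 and $$\Delta_x(\varepsilon,\beta,\delta)=\{(R,r)\in\mathbb R^2:\ r>\bar r(\varepsilon,\beta),\ R<\bar R(\varepsilon,\beta),\ r+\delta<R\},$$ the interior of the triangle with vertices $(\bar r+\delta,\bar r)$, $(\bar R,\bar r)$, $(\bar R,\bar R-\delta)$. Put $\bar\delta(\varepsilon,\beta)=\inf\{\delta>0:\Delta_x(\varepsilon,\beta,\delta)\subseteq A_x([0,\varepsilon]\,|\,\alpha\le\beta)\}$ and $\tau(\varepsilon,\beta)=\bar R(\varepsilon,\beta)-\bar r(\varepsilon,\beta)-\bar\delta(\varepsilon,\beta)$, with the convention $\infty-\infty=-\infty$. For functions $f,g$ of two variables, $E_x(f,g)$ is the set of $\varepsilon\ge0$ such that $\tau(\varepsilon',\beta)>\gamma$, where $\varepsilon'=\alpha^l(g(0,\varepsilon))$, $\beta=g(\varepsilon',\varepsilon)$, $\gamma=f(0,\varepsilon)+f(\varepsilon',\varepsilon)$, and these quantities are required to be defined: $g(0,\varepsilon),\varepsilon'\in[0,\varepsilon_x]$ and $\beta\in[\alpha^l(\varepsilon'),\alpha^u(\varepsilon')]$. Let $P\subset\mathbb X$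 be an $\varepsilon$-sample of $K$: a finite set with $d_H(K,P)<\varepsilon$. Let $t=0$ if $P\subseteq K$ and $t=1$ otherwise; let $s=\sqrt2$ if $\mathbb X$ is isometric to a Euclidean space and $s=2$ otherwise. For $c\in\{1,s\}$ put $$g_c(a,b)=ca+(c+t)b,\qquad f_c(a,b)=g_c(a,b)+g_1(a,b).$$ Let $p\in P$; if $P\subseteq K$, let $x$ be the point of $K$ closest to $p$ (that is, $x=p$), and otherwise let $d(x,p)<\varepsilon$. For $Q\subseteq P$ let $\mathcal C_a(Q)$ be the Čech complex, whose simplices are the nonempty finite $\sigma\subseteq Q$ with $\bigcap_{q\in\sigma}D_a(q)\neq\emptyset$ in $\mathbb X$, and let $\mathcal R_a(Q)$ be the Vietoris–Rips complex, whose simplices are the nonempty finite $\sigma\subseteq Q$ all of whose edges belong to $\mathcal C_a(Q)$. Let $$C(a,b)=H(\mathcal C_a(P),\mathcal C_a(P-B_b(p))),\qquad V(a,b)=H(\mathcal R_a(P),\mathcal R_a(P-B_b(p))).$$ **Theorem.** Let $K$ be weakly homologically seemly at $x$, let $c\in\{1,s\}$, $\varepsilon\in E_x(f_c,g_c)$,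 $\varepsilon'=\alpha^l(g_c(0,\varepsilon))$, and suppose $c(\varepsilon'+\varepsilon)<\mathrm{conv}(P)$. Let $\beta=g_c(\varepsilon',\varepsilon)$ and $\gamma=f_c(0,\varepsilon)+f_c(\varepsilon',\varepsilon)$. Then for all $(R',r')\in\Delta_x(\varepsilon',\beta,\bar\delta(\varepsilon',\beta)+\gamma)$ and $R=R'-g_1(0,\varepsilon)$, $r=r'+g_c(\varepsilon',\varepsilon)$, the inclusions of pairs of complexes below exist and, in every degree, $$\mathrm{im}\big(C(\varepsilon,R)\to C(\varepsilon'+\varepsilon,r)\big)\cong H(K,K-\{x\})\quad\text{if }c=1,$$ $$\mathrm{im}\big(V(\varepsilon,R)\to V(\varepsilon'+\varepsilon,r)\big)\cong H(K,K-\{x\})\quad\text{if }c=s.$$ -/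

import Mathlib

universe u

open CategoryTheory Limits Set Filter Topology
open scoped ENNReal

noncomputable section

namespace LocalHomology

/-! ### Relative homology with integer coefficients -/

/-- Relative homology in degree `n`, with coefficients in `ℤ`, of a map of simplicial sets
`B ⟶ A` (an inclusion in all uses below): the homology of the cokernel of the map that it induces
between the simplicial chain complexes, that is, of `C(A) / C(B)`.
(`ULift ℤ` is `ℤ`, placed in the universe of the spaces.) -/
def relHomology (n : ℕ) : Arrow SSet.{u} ⥤ ModuleCat.{u} ℤ :=
  ((SSet.chainComplexFunctor (ModuleCat.{u} ℤ)).obj (ModuleCat.of ℤ (ULift.{u} ℤ))).mapArrow ⋙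
    coker _ ⋙ HomologicalComplex.homologyFunctor (ModuleCat.{u} ℤ) (ComplexShape.down ℕ) n

/-! #### Pairs of subspaces and singular homology -/

/-- A pair of subsets `sub ⊆ total` of `X`. -/
structure SetPair (X : Type u) where
  total : Set X
  sub : Set X
  sub_subset : sub ⊆ total

instance {X : Type u} : LE (SetPair X) where
  le A B := A.total ⊆ B.total ∧ A.sub ⊆ B.sub

section Singular

variable {X : Type u} [TopologicalSpace X]

/-- The inclusion of the subspace `s` into the subspace `t`. -/
def subspaceInclusion {s t : Set X} (h : s ⊆ t) : TopCat.of s ⟶ TopCat.of t :=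
  TopCat.ofHom ⟨Set.inclusion h, continuous_inclusion h⟩

/-- The inclusion `sub ⟶ total`, as an arrow of topological spaces. -/
def SetPair.arrow (A : SetPair X) : Arrow TopCat.{u} :=
  Arrow.mk (subspaceInclusion A.sub_subset)

/-- The inclusion of one pair into another. -/
def SetPair.incl {A B : SetPair X} (h : A ≤ B) : A.arrow ⟶ B.arrow :=
  Arrow.homMk (subspaceInclusion h.2) (subspaceInclusion h.1) rfl

/-- Relative singular homology `H_n(total, sub)`. -/
def SetPair.H (n : ℕ) (A : SetPair X) : ModuleCat.{u} ℤ :=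
  (relHomology n).obj (TopCat.toSSet.mapArrow.obj A.arrow)

/-- The homomorphism of relative singular homology induced by an inclusion of pairs. -/
def SetPair.mapH (n : ℕ) {A B : SetPair X} (h : A ≤ B) : A.H n →ₗ[ℤ] B.H n :=
  ((relHomology n).map (TopCat.toSSet.mapArrow.map (SetPair.incl h))).hom

end Singular

/-! #### Pairs of abstract simplicial complexes and simplicial homology -/

section Simplicial

variable {V : Type u}

/-- The simplicial set of ordered simplices of an abstract simplicial complex: its `n`-simplices
are the tuples `(v₀, …, vₙ)` (repetitions allowed) of vertices of a common face. Its chain complex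
is the ordered chain complex of the simplicial complex. -/
def orderedSSet (S : PreAbstractSimplicialComplex V) : SSet.{u} where
  obj Δ := {f : Fin (Δ.unop.len + 1) → V // ∃ σ ∈ S.faces, ∀ i, f i ∈ σ}
  map φ := TypeCat.ofHom fun f ↦
    ⟨fun i ↦ f.1 (φ.unop.toOrderHom i), by
      obtain ⟨σ, hσ, hf⟩ := f.2
      exact ⟨σ, hσ, fun i ↦ hf _⟩⟩

/-- The map of ordered simplices induced by an inclusion of simplicial complexes. -/
def orderedInclusion {S S' : PreAbstractSimplicialComplex V} (h : S ≤ S') :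
    orderedSSet S ⟶ orderedSSet S' where
  app Δ := TypeCat.ofHom fun f ↦
    ⟨f.1, by
      obtain ⟨σ, hσ, hf⟩ := f.2
      exact ⟨σ, h hσ, hf⟩⟩

/-- A simplicial complex with a subcomplex. -/
structure ComplexPair (V : Type u) where
  total : PreAbstractSimplicialComplex V
  sub : PreAbstractSimplicialComplex V
  sub_le : sub ≤ total

instance : LE (ComplexPair V) where
  le A B := A.total ≤ B.total ∧ A.sub ≤ B.sub

/-- The inclusion of the subcomplex, as an arrow of simplicial sets. -/
def ComplexPair.arrow (A : ComplexPair V) : Arrow SSet.{u} :=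
  Arrow.mk (orderedInclusion A.sub_le)

/-- The inclusion of one pair into another. -/
def ComplexPair.incl {A B : ComplexPair V} (h : A ≤ B) : A.arrow ⟶ B.arrow :=
  Arrow.homMk (orderedInclusion h.2) (orderedInclusion h.1) rfl

/-- Relative simplicial homology `H_n(total, sub)`. -/
def ComplexPair.H (n : ℕ) (A : ComplexPair V) : ModuleCat.{u} ℤ :=
  (relHomology n).obj A.arrow

/-- The homomorphism of relative simplicial homology induced by an inclusion of pairs. -/
def ComplexPair.mapH (n : ℕ) {A B : ComplexPair V} (h : A ≤ B) : A.H n →ₗ[ℤ] B.H n :=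
  ((relHomology n).map (ComplexPair.incl h)).hom

end Simplicial

/-! ### Čech and Vietoris–Rips complexes -/

section Complexes

variable {X : Type u} [MetricSpace X]

/-- The Čech complex over `Q` at scale `a`: nonempty finite `σ ⊆ Q` such that the closed balls of
radius `a` around the points of `σ` have a common point in `X`. -/
def cech (a : ℝ) (Q : Set X) : PreAbstractSimplicialComplex X where
  faces := {σ | σ.Nonempty ∧ (σ : Set X) ⊆ Q ∧ (⋂ q ∈ σ, Metric.closedBall q a).Nonempty}
  isRelLowerSet_faces := by
    rintro σ ⟨h1, h2, y, hy⟩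
    refine ⟨h1, fun τ hτ hne ↦ ⟨hne, fun z hz ↦ h2 (hτ hz), y, ?_⟩⟩
    simp only [mem_iInter] at hy ⊢
    exact fun q hq ↦ hy q (hτ hq)

open Classical in
/-- The Vietoris–Rips complex over `Q` at scale `a`: nonempty finite `σ ⊆ Q` all of whose edges
belong to the Čech complex at scale `a`. -/
def rips (a : ℝ) (Q : Set X) : PreAbstractSimplicialComplex X where
  faces := {σ | σ.Nonempty ∧ (σ : Set X) ⊆ Q ∧
    ∀ u ∈ σ, ∀ v ∈ σ, u ≠ v → ({u, v} : Finset X) ∈ (cech a Q).faces}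
  isRelLowerSet_faces := by
    rintro σ ⟨h1, h2, h3⟩
    exact ⟨h1, fun τ hτ hne ↦ ⟨hne, fun z hz ↦ h2 (hτ hz),
      fun u hu v hv huv ↦ h3 u (hτ hu) v (hτ hv) huv⟩⟩

/-- The pair `(𝒞_a(P), 𝒞_a(P - B_b(p)))`. -/
def cechPair (P : Set X) (p : X) (a b : ℝ) : ComplexPair X where
  total := cech a P
  sub := cech a (P \ Metric.ball p b)
  sub_le := fun _ ⟨h1, h2, h3⟩ ↦ ⟨h1, h2.trans sdiff_subset, h3⟩

/-- The pair `(ℛ_a(P), ℛ_a(P - B_b(p)))`. -/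
def ripsPair (P : Set X) (p : X) (a b : ℝ) : ComplexPair X where
  total := rips a P
  sub := rips a (P \ Metric.ball p b)
  sub_le := fun _ ⟨h1, h2, h3⟩ ↦ ⟨h1, h2.trans sdiff_subset, fun u hu v hv huv ↦
    ⟨(h3 u hu v hv huv).1, (h3 u hu v hv huv).2.1.trans sdiff_subset, (h3 u hu v hv huv).2.2⟩⟩

/-! ### Convexity -/

/-- `γ`, restricted to `[0,1]`, is a shortest path from `x` to `y` (parametrized proportionally to
arc length). -/
def IsShortestPath (γ : ℝ → X) (x y : X) : Prop :=
  γ 0 = x ∧ γ 1 = y ∧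
    ∀ s ∈ Icc (0 : ℝ) 1, ∀ t ∈ Icc (0 : ℝ) 1, dist (γ s) (γ t) = |s - t| * dist x y

/-- Any two points of `A` are connected by a unique shortest path, this path lies in `A`, and it
depends continuously on the end points. -/
def StronglyConvex (A : Set X) : Prop :=
  ∃ Γ : X → X → ℝ → X,
    (∀ x ∈ A, ∀ y ∈ A, IsShortestPath (Γ x y) x y ∧ (∀ t ∈ Icc (0 : ℝ) 1, Γ x y t ∈ A) ∧
      ∀ γ : ℝ → X, IsShortestPath γ x y → EqOn γ (Γ x y) (Icc 0 1)) ∧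
    ContinuousOn (fun q : X × X × ℝ ↦ Γ q.1 q.2.1 q.2.2) (A ×ˢ A ×ˢ Icc (0 : ℝ) 1)

/-- All sufficiently small balls around any point are strongly convex. -/
def LocallyStronglyConvex (X : Type u) [MetricSpace X] : Prop :=
  ∀ x : X, ∃ r₀ > 0, ∀ r, 0 < r → r < r₀ → StronglyConvex (Metric.ball x r)

/-- The convexity radius at `x`: the supremum of all `δ` such that the open balls around `x` of
radius at most `δ` are strongly convex. -/
def convRadius (x : X) : EReal :=
  sSup ((fun δ : ℝ ↦ (δ : EReal)) ''
    {δ | 0 ≤ δ ∧ ∀ r ≤ δ, StronglyConvex (Metric.ball x r)})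

/-- The convexity radius of a set. -/
def setConvRadius (P : Set X) : EReal := ⨅ q ∈ P, convRadius q

/-! ### Samples and constants -/

/-- `P` is an `ε`-sample of `K`: a finite set at Hausdorff distance less than `ε` from `K`. -/
def IsSample (K P : Set X) (ε : ℝ) : Prop :=
  P.Finite ∧ Metric.hausdorffEDist K P < ENNReal.ofReal ε

open Classical in
/-- The constant `t`: `0` if the sample is noise free (`P ⊆ K`), and `1` otherwise. -/
def noiseConst (K P : Set X) : ℝ := if P ⊆ K then 0 else 1

open Classical in
/-- The constant `s`: `√2` if `X` is a Euclidean space, and `2` otherwise. -/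
def ripsConst (X : Type u) [MetricSpace X] : ℝ :=
  if ∃ n : ℕ, Nonempty (X ≃ᵢ EuclideanSpace ℝ (Fin n)) then √2 else 2

/-- `g_c(a, b) = c a + (c + t) b`. -/
def gFun (t c a b : ℝ) : ℝ := c * a + (c + t) * b

/-- `f_c(a, b) = g_c(a, b) + g_1(a, b)`. -/
def fFun (t c a b : ℝ) : ℝ := gFun t c a b + gFun t 1 a b

/-! ### The sets `A_x(ε)` -/

section Admissible

variable (K : TopologicalSpace.Compacts X) (x : X)

/-- The pair `(D_a(K), D_a(K) - B_b(x))`, where `D_a(K)` is the closed `a`-neighborhood of `K`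
(so that `D_0(K) = K`). Its homology is `F(a, b)`, for `a > 0` or `b > 0`. -/
def nbhdPair (a b : ℝ) : SetPair X where
  total := Metric.cthickening a K
  sub := Metric.cthickening a K \ Metric.ball x b
  sub_subset := sdiff_subset

/-- The pair `(K, K - {x})`. Its homology is the local homology of `K` at `x`, `F(0, 0)`. -/
def localPair : SetPair X where
  total := K
  sub := (K : Set X) \ {x}
  sub_subset := sdiff_subset

variable {K x}

lemma nbhdPair_le {a a' b b' : ℝ} (ha : a ≤ a') (hb : b' ≤ b) :
    nbhdPair K x a b ≤ nbhdPair K x a' b' :=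
  ⟨Metric.cthickening_mono ha _, sdiff_subset_sdiff (Metric.cthickening_mono ha _)
    (Metric.ball_subset_ball hb)⟩

lemma nbhdPair_le_localPair {b : ℝ} (hb : 0 < b) : nbhdPair K x 0 b ≤ localPair K x := by
  have h : Metric.cthickening 0 (K : Set X) = K := by
    rw [Metric.cthickening_zero, K.isCompact.isClosed.closure_eq]
  exact ⟨h.le, sdiff_subset_sdiff h.le (singleton_subset_iff.2 (Metric.mem_ball_self hb))⟩

variable (K x)

/-- `S` is homeomorphic to a closed Euclidean ball. -/
def IsTopologicalBall (S : Set X) : Prop :=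
  ∃ n : ℕ, Nonempty (S ≃ₜ Metric.closedBall (0 : EuclideanSpace ℝ (Fin n)) 1)

/-- `(R, r, α)` belongs to `A_x(ε)`. The set `T` consists of the radii `ρ` that satisfy whatever
supplementary condition is imposed on the spheres `S_ρ(x)`: `T` is everything in general, and
`T = {ρ | S_ρ(x) is transverse to all the strata of K}` if `K` is Whitney stratified. -/
structure IsAdmissible (T : Set ℝ) (ε R r α : ℝ) : Prop where
  zero_le : 0 ≤ ε
  le_alpha : ε ≤ α
  alpha_lt : α < r
  le_R : r ≤ R
  isBall : ∀ ρ ∈ Ioc 0 R, IsTopologicalBall (Metric.closedBall x ρ) ∧ ρ ∈ T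
  /-- `F(0,R) → F(0,ρ)` is an isomorphism -/
  iso_radius : ∀ ρ, 0 < ρ → ∀ h : ρ ≤ R, ∀ n,
    Function.Bijective (SetPair.mapH n (nbhdPair_le (K := K) (x := x) (le_refl 0) h))
  /-- `F(0,ρ) → F(0,0)` is an isomorphism -/
  iso_local : ∀ ρ, ∀ h : 0 < ρ, ρ ≤ R → ∀ n,
    Function.Bijective (SetPair.mapH n (nbhdPair_le_localPair (K := K) (x := x) h))
  /-- `F(0,R) → F(ε,R) → F(α,r)` is injective, and its image is that of `F(ε,R) → F(α,r)`:
  it is an isomorphism onto the image of `F(ε,R) → F(α,r)` -/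
  iso_image : ∀ n,
    Function.Injective (SetPair.mapH n (nbhdPair_le (K := K) (x := x) le_alpha le_R) ∘ₗ
      SetPair.mapH n (nbhdPair_le (K := K) (x := x) zero_le (le_refl R))) ∧
    LinearMap.range (SetPair.mapH n (nbhdPair_le (K := K) (x := x) le_alpha le_R) ∘ₗ
      SetPair.mapH n (nbhdPair_le (K := K) (x := x) zero_le (le_refl R))) =
    LinearMap.range (SetPair.mapH n (nbhdPair_le (K := K) (x := x) le_alpha le_R))

/-- The `α`-section `A_x(ε | α = α')`, a set of pairs `(R, r)`. -/
def alphaSection (T : Set ℝ) (ε α' : ℝ) : Set (ℝ × ℝ) :=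
  {q | IsAdmissible K x T ε q.1 q.2 α'}

/-- The collection `A_x(ε)`, `ε ≥ 0`, is weakly seemly (`K` is weakly homologically seemly at `x`),
with witnesses `ε_x` and `α^l_x, α^u_x : [0, ε_x] → ℝ₊`. -/
structure IsWeaklySeemly (T : Set ℝ) (εx : ℝ) (αl αu : ℝ → ℝ) : Prop where
  pos : 0 < εx
  l_nonneg : ∀ ε ∈ Icc 0 εx, 0 ≤ αl ε
  l_le_u : ∀ ε ∈ Icc 0 εx, αl ε ≤ αu ε
  l_mono : MonotoneOn αl (Icc 0 εx)
  u_anti : AntitoneOn αu (Icc 0 εx)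
  l_zero : αl 0 = 0
  l_tendsto : Tendsto αl (𝓝[>] 0) (𝓝 0)
  u_tendsto : Tendsto αu (𝓝[>] 0) (𝓝 (αu 0))
  nonempty : ∀ ε ∈ Icc 0 εx, ∀ α' ∈ Icc (αl ε) (αu ε), (alphaSection K x T ε α').Nonempty
  hausdorff : Tendsto
    (fun ε ↦ ⨆ α' ∈ Icc (αl ε) (αu ε),
      Metric.hausdorffEDist (alphaSection K x T 0 α') (alphaSection K x T ε α'))
    (𝓝[>] 0) (𝓝 0)

variable (T : Set ℝ) (αl : ℝ → ℝ)

/-- `A_x([0,ε] | α ≤ β)`. -/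
def slab (ε β : ℝ) : Set (ℝ × ℝ) :=
  ⋂ ε' ∈ Icc 0 ε, ⋂ α' ∈ Icc (αl ε') β, alphaSection K x T ε' α'

/-- `R̄_x(ε, β)`, in the extended reals. -/
def Rbar (ε β : ℝ) : EReal := sSup ((fun q : ℝ × ℝ ↦ (q.1 : EReal)) '' slab K x T αl ε β)

/-- `r̄_x(ε, β)`, in the extended reals. -/
def rbar (ε β : ℝ) : EReal := sInf ((fun q : ℝ × ℝ ↦ (q.2 : EReal)) '' slab K x T αl ε β)

/-- `Δ_x(ε, β, δ)`: the interior of the triangle with vertices `(r̄ + δ, r̄)`, `(R̄, r̄)`,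
`(R̄, R̄ - δ)`. -/
def triangle (ε β : ℝ) (δ : EReal) : Set (ℝ × ℝ) :=
  {q | rbar K x T αl ε β < q.2 ∧ (q.1 : EReal) < Rbar K x T αl ε β ∧ (q.2 : EReal) + δ < q.1}

/-- `δ̄_x(ε, β)`. -/
def deltaBar (ε β : ℝ) : EReal :=
  sInf ((fun δ : ℝ ↦ (δ : EReal)) ''
    {δ | 0 < δ ∧ triangle K x T αl ε β δ ⊆ slab K x T αl ε β})

/-- `τ_x(ε, β) = R̄_x(ε, β) - r̄_x(ε, β) - δ̄_x(ε, β)`. -/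
def tau (ε β : ℝ) : EReal := Rbar K x T αl ε β - rbar K x T αl ε β - deltaBar K x T αl ε β

/-- `E_x(f, g)`: the `ε ≥ 0` with `τ_x(ε', β) > γ`, where `ε' = α^l_x(g(0,ε))`, `β = g(ε',ε)`,
`γ = f(0,ε) + f(ε',ε)`, all of these being evaluated inside the domains where they are defined:
`α^l_x` on `[0, ε_x]`, and `τ_x(ε', β)` for `ε' ∈ [0, ε_x]` and `β ∈ [α^l_x(ε'), α^u_x(ε')]`. -/
def goodSet (εx : ℝ) (αu : ℝ → ℝ) (f g : ℝ → ℝ → ℝ) : Set ℝ :=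
  {ε | 0 ≤ ε ∧ g 0 ε ∈ Icc 0 εx ∧ αl (g 0 ε) ∈ Icc 0 εx ∧
    g (αl (g 0 ε)) ε ∈ Icc (αl (αl (g 0 ε))) (αu (αl (g 0 ε))) ∧
    ((f 0 ε + f (αl (g 0 ε)) ε : ℝ) : EReal) <
      tau K x T αl (αl (g 0 ε)) (g (αl (g 0 ε)) ε)}

end Admissible

end Complexes

end LocalHomology

end

noncomputable section

namespace LocalHomology

/-! ### Systems of simplices with face maps, and their chains -/

/-! The homology of the complexes is interleaved with that of neighborhoods of `K`. Put g =
g_c(0,ε), R₁ = R' - f_c(0,ε), r₁ = r' + f_c(ε',ε), and consider the inclusion maps F(0,R') → F(g,R₁)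
→ F(ε',r₁) → F(β,r'). Let B → B' be the map of homology of the Čech or Rips pairs. There are maps
F(0,R') → B → F(g,R₁) and F(ε',r₁) → B' → F(β,r') whose composites are the inclusion maps, and B →
F(g,R₁) → F(ε',r₁) → B' is the given map B → B'. If the image of F(g,R₁) → F(ε',r₁) already comes
from F(0,R'), and F(0,R') → F(β,r') is injective, then a diagram chase
(`nonempty_range_equiv_of_interleaving`) identifies the image of B → B' with F(0,R').

Both properties come from membership in the sets A_x. The number γ is the total loss of radius, (R'
- R₁) + (r₁ - r'), so that (R',r'), (R₁,r₁) and (R₁,r') all lie in a triangle contained in the slab.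
Admissibility at the parameters 0, g and ε' then gives F(0,R') ≅ F(0,R₁) and F(0,R') ≅ H(K,K-{x}),
the equality of images, and the injectivity (`nonempty_range_equiv_localPair`).

The chain maps are built by acyclic carriers. From a neighborhood to a complex: subdivide singular
simplices until they are small, then send each vertex to a nearest sample point (`spaceToComplex`).
From a Čech complex to a neighborhood: subdivide into flags and carry a flag by the intersection of
the balls around its smallest member, which contracts by strong convexity (`cechToSpace`). The
composites are compared with inclusions by `PairMap.mapH_eq_of_carrier`. For space → complex → space
the carrier is a union of balls with a common point, which is star-shaped (`acyclic_biUnion`); for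
complex → space → complex it consists of tuples near a common point, which form a cone. A Rips
complex is squeezed between Čech complexes at scales a and s·a (`rips_le_cech`), so both cases of
the theorem are one argument.

All of this takes place with explicit relative cycles and boundaries, inside one system of singular
simplices and one of tuples. `ArrowEmbedding` transports the result, with its naturality, to the
categorical homology of the statement. -/

/-- A semisimplicial set. -/
structure FaceSystem where
  obj : ℕ → Type*
  δ : ∀ {n : ℕ}, Fin (n + 2) → obj (n + 1) → obj n
  δ_δ : ∀ {n : ℕ} (i j : Fin (n + 2)) (x : obj (n + 2)), i ≤ j →
    δ i (δ j.succ x) = δ j (δ i.castSucc x)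

namespace FaceSystem

/-- Simplicial chains with integer coefficients. -/
abbrev Chain (Y : FaceSystem) (n : ℕ) : Type _ := Y.obj n →₀ ℤ

/-- The chain that consists of one simplex. -/
abbrev sx (Y : FaceSystem) {n : ℕ} (x : Y.obj n) : Y.Chain n := Finsupp.single x 1

/-- The boundary of a chain. -/
def bd (Y : FaceSystem) (n : ℕ) : Y.Chain (n + 1) →ₗ[ℤ] Y.Chain n :=
  ∑ i : Fin (n + 2), (-1 : ℤ) ^ (i : ℕ) • Finsupp.lmapDomain ℤ ℤ (Y.δ i)

/-- The sum of the coefficients of a chain of vertices. -/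
def aug (Y : FaceSystem) : Y.Chain 0 →ₗ[ℤ] ℤ := Finsupp.linearCombination ℤ fun _ ↦ 1

variable {Y Z W : FaceSystem}

@[simp] lemma aug_sx (x : Y.obj 0) : Y.aug (Y.sx x) = 1 := by simp [aug]

lemma bd_sx {n : ℕ} (x : Y.obj (n + 1)) :
    Y.bd n (Y.sx x) = ∑ i : Fin (n + 2), (-1 : ℤ) ^ (i : ℕ) • Y.sx (Y.δ i x) := by
  simp [bd, sx]

lemma hom_ext {n : ℕ} {M : Type*} [AddCommGroup M] [Module ℤ M] {f g : Y.Chain n →ₗ[ℤ] M}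
    (h : ∀ x, f (Y.sx x) = g (Y.sx x)) : f = g := by
  ext x
  simpa using h x

lemma bd_bd {n : ℕ} (z : Y.Chain (n + 2)) : Y.bd n (Y.bd (n + 1) z) = 0 := by
  suffices h : Y.bd n ∘ₗ Y.bd (n + 1) = 0 from LinearMap.congr_fun h z
  refine hom_ext fun x ↦ ?_
  rw [LinearMap.comp_apply, bd_sx, map_sum, LinearMap.zero_apply]
  simp only [map_zsmul, bd_sx, Finset.smul_sum, smul_smul]
  rw [Finset.sum_comm, ← Finset.sum_product']
  let Q := Fin (n + 2) × Fin (n + 3)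
  let S : Finset Q := {ij : Q | (ij.2 : ℕ) ≤ (ij.1 : ℕ)}
  rw [Finset.univ_product_univ, ← Finset.sum_add_sum_compl S, ← eq_neg_iff_add_eq_zero,
    ← Finset.sum_neg_distrib]
  -- The terms cancel in pairs: (i, j) with j ≤ i is matched with (j, i + 1), the simplicial
  -- identity equates the double faces, and the signs are opposite.
  let φ : ∀ ij : Q, ij ∈ S → Q := fun ij hij ↦
    (Fin.castLT ij.2 (lt_of_le_of_lt (Finset.mem_filter.mp hij).right (Fin.is_lt ij.1)), ij.1.succ)
  apply Finset.sum_bij φ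
  · intro ij hij
    simp_rw [S, φ, Finset.compl_filter, Finset.mem_filter_univ, Fin.val_succ,
      Fin.val_castLT] at hij ⊢
    lia
  · rintro ⟨i, j⟩ hij ⟨i', j'⟩ hij' h
    rw [Prod.mk_inj]
    exact ⟨by simpa [φ] using! congr_arg Prod.snd h,
      by simpa [φ, Fin.castSucc_castLT] using! congr_arg Fin.castSucc (congr_arg Prod.fst h)⟩
  · rintro ⟨i', j'⟩ hij'
    simp_rw [S, Finset.compl_filter, Finset.mem_filter_univ, not_le] at hij'
    refine ⟨(j'.pred <| ?_, Fin.castSucc i'), ?_, ?_⟩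
    · rintro rfl
      simp only [Fin.val_zero, not_lt_zero] at hij'
    · simpa [S] using! Nat.le_sub_one_of_lt hij'
    · simp only [φ, Fin.castLT_castSucc, Fin.succ_pred]
  · rintro ⟨i, j⟩ hij
    have hle : (j : ℕ) ≤ (i : ℕ) := (Finset.mem_filter.mp hij).2
    have hji : Fin.castLT j (lt_of_le_of_lt hle i.is_lt) ≤ i := by
      rw [Fin.le_def]; exact hle
    simp only [φ, ← neg_smul]
    rw [Y.δ_δ _ _ x hji, Fin.castSucc_castLT]
    congr 1
    simp only [Fin.val_succ, Fin.val_castLT, pow_succ]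
    ring

lemma aug_bd (z : Y.Chain 1) : Y.aug (Y.bd 0 z) = 0 := by
  suffices h : Y.aug ∘ₗ Y.bd 0 = 0 from LinearMap.congr_fun h z
  refine hom_ext fun x ↦ ?_
  rw [LinearMap.comp_apply, bd_sx]
  simp [Fin.sum_univ_two, aug]

/-- A family of simplices that is closed under passage to faces. -/
structure Sub (Y : FaceSystem) where
  carrier : ∀ n, Set (Y.obj n)
  δ_mem : ∀ {n} (i : Fin (n + 2)) {x : Y.obj (n + 1)}, x ∈ carrier (n + 1) → Y.δ i x ∈ carrier n

instance : LE (Sub Y) where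
  le A B := ∀ n, A.carrier n ⊆ B.carrier n

/-- The chains supported in a family of simplices. -/
def Sub.chains (A : Sub Y) (n : ℕ) : Submodule ℤ (Y.Chain n) :=
  Finsupp.supported ℤ ℤ (A.carrier n)

lemma Sub.sx_mem {A : Sub Y} {n : ℕ} {x : Y.obj n} (hx : x ∈ A.carrier n) :
    Y.sx x ∈ A.chains n :=
  Finsupp.single_mem_supported ℤ 1 hx

lemma Sub.chains_mono {A B : Sub Y} (h : A ≤ B) (n : ℕ) : A.chains n ≤ B.chains n :=
  Finsupp.supported_mono (h n)

lemma Sub.chains_eq_span (A : Sub Y) (n : ℕ) :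
    A.chains n = Submodule.span ℤ ((fun x ↦ Y.sx x) '' A.carrier n) :=
  Finsupp.supported_eq_span_single ℤ _

lemma Sub.map_mem {A : Sub Y} {n : ℕ} {M : Type*} [AddCommGroup M] [Module ℤ M]
    {f : Y.Chain n →ₗ[ℤ] M} {N : Submodule ℤ M} (h : ∀ x ∈ A.carrier n, f (Y.sx x) ∈ N) {z : Y.Chain n}
    (hz : z ∈ A.chains n) : f z ∈ N := by
  rw [A.chains_eq_span] at hz
  have : Submodule.span ℤ ((fun x ↦ Y.sx x) '' A.carrier n) ≤ N.comap f := by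
    rw [Submodule.span_le]
    rintro _ ⟨x, hx, rfl⟩
    exact h x hx
  exact this hz

lemma Sub.map_eq {A : Sub Y} {n : ℕ} {M : Type*} [AddCommGroup M] [Module ℤ M]
    {f g : Y.Chain n →ₗ[ℤ] M} (h : ∀ x ∈ A.carrier n, f (Y.sx x) = g (Y.sx x)) {z : Y.Chain n}
    (hz : z ∈ A.chains n) : f z = g z := by
  have := A.map_mem (f := f - g) (N := ⊥) (fun x hx ↦ by simp [h x hx]) hz
  simpa [sub_eq_zero] using this

lemma Sub.bd_mem {A : Sub Y} {n : ℕ} {z : Y.Chain (n + 1)} (hz : z ∈ A.chains (n + 1)) :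
    Y.bd n z ∈ A.chains n := by
  refine A.map_mem (fun x hx ↦ ?_) hz
  rw [bd_sx]
  exact sum_mem fun i _ ↦ Submodule.smul_mem _ _ (sx_mem (A.δ_mem i hx))

/-! ### Acyclic families -/

/-- A nonempty family of simplices with trivial reduced homology. -/
structure Sub.Acyclic (A : Sub Y) : Prop where
  nonempty : (A.carrier 0).Nonempty
  zero : ∀ z ∈ A.chains 0, Y.aug z = 0 → ∃ w ∈ A.chains 1, Y.bd 0 w = z
  succ : ∀ n, ∀ z ∈ A.chains (n + 1), Y.bd n z = 0 → ∃ w ∈ A.chains (n + 2), Y.bd (n + 1) w = z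

/-- A family of simplices on which there is a cone construction is acyclic. -/
lemma Sub.acyclic_of_cone {A : Sub Y} (apex : Y.obj 0) (cone : ∀ n, Y.obj n → Y.obj (n + 1))
    (hapex : apex ∈ A.carrier 0) (hcone : ∀ n, ∀ x ∈ A.carrier n, cone n x ∈ A.carrier (n + 1))
    (h0 : ∀ n, ∀ x ∈ A.carrier n, Y.δ 0 (cone n x) = x)
    (h1 : ∀ x ∈ A.carrier 0, Y.δ 1 (cone 0 x) = apex)
    (hs : ∀ n, ∀ x ∈ A.carrier (n + 1), ∀ i : Fin (n + 2),
      Y.δ i.succ (cone (n + 1) x) = cone n (Y.δ i x)) : A.Acyclic := by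
  have hmem : ∀ n, ∀ z ∈ A.chains n, Finsupp.lmapDomain ℤ ℤ (cone n) z ∈ A.chains (n + 1) := by
    intro n z hz
    refine A.map_mem (fun x hx ↦ ?_) hz
    simpa using sx_mem (hcone n x hx)
  refine ⟨⟨apex, hapex⟩, fun z hz hz0 ↦ ⟨_, hmem _ _ hz, ?_⟩, fun n z hz hzb ↦
    ⟨_, hmem _ _ hz, ?_⟩⟩
  · have : (Y.bd 0 ∘ₗ Finsupp.lmapDomain ℤ ℤ (cone 0)) z =
        (LinearMap.id - LinearMap.toSpanSingleton ℤ _ (Y.sx apex) ∘ₗ Y.aug :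
          Y.Chain 0 →ₗ[ℤ] Y.Chain 0) z := by
      refine A.map_eq (fun x hx ↦ ?_) hz
      simp [bd_sx, Fin.sum_univ_two, h0 0 x hx, h1 x hx, sub_eq_add_neg, aug]
    simpa [hz0] using this
  · have : (Y.bd (n + 1) ∘ₗ Finsupp.lmapDomain ℤ ℤ (cone (n + 1))) z =
        (LinearMap.id - Finsupp.lmapDomain ℤ ℤ (cone n) ∘ₗ Y.bd n :
          Y.Chain (n + 1) →ₗ[ℤ] Y.Chain (n + 1)) z := by
      refine A.map_eq (fun x hx ↦ ?_) hz
      have e : (Finsupp.lmapDomain ℤ ℤ (cone (n + 1))) (Y.sx x) = Y.sx (cone (n + 1) x) := by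
        simp
      rw [LinearMap.comp_apply, e, bd_sx, Fin.sum_univ_succ]
      simp only [LinearMap.sub_apply, LinearMap.comp_apply, LinearMap.id_apply, bd_sx, map_sum,
        map_zsmul, h0 _ x hx, hs _ x hx]
      simp [pow_succ, sub_eq_add_neg]
    simpa [hzb] using this

/-! ### The method of acyclic carriers -/

/-- A family of linear maps commutes with the boundary on the chains of `A`. -/
def IsChainMapOn (A : Sub Y) (f : ∀ n, Y.Chain n →ₗ[ℤ] Z.Chain n) : Prop :=
  ∀ n, ∀ z ∈ A.chains (n + 1), Z.bd n (f (n + 1) z) = f n (Y.bd n z)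

/-- The carrier `Φ` assigns acyclic families to the simplices of `A`, increasing along faces. -/
structure IsCarrier (A : Sub Y) (Φ : ∀ n, Y.obj n → Sub Z) : Prop where
  acyclic : ∀ n, ∀ x ∈ A.carrier n, (Φ n x).Acyclic
  mono : ∀ n, ∀ x ∈ A.carrier (n + 1), ∀ i, Φ n (Y.δ i x) ≤ Φ (n + 1) x

/-- `f` is carried by `Φ`, on `A`. -/
def CarriedBy (A : Sub Y) (Φ : ∀ n, Y.obj n → Sub Z) (f : ∀ n, Y.Chain n →ₗ[ℤ] Z.Chain n) : Prop :=
  ∀ n, ∀ x ∈ A.carrier n, f n (Y.sx x) ∈ (Φ n x).chains n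

/-- `f` maps vertices to chains of total weight one. -/
def IsAugmented (A : Sub Y) (f : ∀ n, Y.Chain n →ₗ[ℤ] Z.Chain n) : Prop :=
  ∀ z ∈ A.chains 0, Z.aug (f 0 z) = Y.aug z

lemma IsChainMapOn.of_sx {A : Sub Y} {f : ∀ n, Y.Chain n →ₗ[ℤ] Z.Chain n}
    (h : ∀ n, ∀ x ∈ A.carrier (n + 1), Z.bd n (f (n + 1) (Y.sx x)) = f n (Y.bd n (Y.sx x))) :
    IsChainMapOn A f := fun n _ hz ↦
  A.map_eq (f := Z.bd n ∘ₗ f (n + 1)) (g := f n ∘ₗ Y.bd n) (h n) hz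

lemma IsAugmented.of_sx {A : Sub Y} {f : ∀ n, Y.Chain n →ₗ[ℤ] Z.Chain n}
    (h : ∀ x ∈ A.carrier 0, Z.aug (f 0 (Y.sx x)) = 1) : IsAugmented A f := fun _ hz ↦
  A.map_eq (f := Z.aug ∘ₗ f 0) (g := Y.aug) (fun x hx ↦ by simpa using h x hx) hz

/-- This is where monotonicity of the carrier enters: each face of x is mapped into a family
contained in the one assigned to x. -/
lemma CarriedBy.bd_mem {A : Sub Y} {Φ : ∀ n, Y.obj n → Sub Z} (hΦ : IsCarrier A Φ) {n k : ℕ}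
    {f : Y.Chain n →ₗ[ℤ] Z.Chain k} (hf : ∀ x ∈ A.carrier n, f (Y.sx x) ∈ (Φ n x).chains k)
    {x : Y.obj (n + 1)} (hx : x ∈ A.carrier (n + 1)) :
    f (Y.bd n (Y.sx x)) ∈ (Φ (n + 1) x).chains k := by
  rw [bd_sx, map_sum]
  refine sum_mem fun i _ ↦ ?_
  rw [map_zsmul]
  exact Submodule.smul_mem _ _
    (Sub.chains_mono (hΦ.mono n x hx i) _ (hf _ (A.δ_mem i hx)))

open Classical in
/-- Lift, simplex by simplex, a prescribed boundary into the carrier. -/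
def liftBd {n k : ℕ} (Φ : Y.obj n → Sub Z) (b : Y.Chain n →ₗ[ℤ] Z.Chain k) :
    Y.Chain n →ₗ[ℤ] Z.Chain (k + 1) :=
  Finsupp.linearCombination ℤ fun x ↦
    if h : ∃ w ∈ (Φ x).chains (k + 1), Z.bd k w = b (Y.sx x) then h.choose else 0

lemma liftBd_spec {n k : ℕ} {Φ : Y.obj n → Sub Z} {b : Y.Chain n →ₗ[ℤ] Z.Chain k} {x : Y.obj n}
    (h : ∃ w ∈ (Φ x).chains (k + 1), Z.bd k w = b (Y.sx x)) :
    liftBd Φ b (Y.sx x) ∈ (Φ x).chains (k + 1) ∧ Z.bd k (liftBd Φ b (Y.sx x)) = b (Y.sx x) := by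
  have : liftBd Φ b (Y.sx x) = h.choose := by simp [liftBd, dif_pos h]
  rw [this]
  exact h.choose_spec

open Classical in
/-- The chain map carried by an acyclic carrier. -/
def carrierMap (Φ : ∀ n, Y.obj n → Sub Z) : ∀ n, Y.Chain n →ₗ[ℤ] Z.Chain n
  | 0 => Finsupp.linearCombination ℤ fun x ↦
      if h : ((Φ 0 x).carrier 0).Nonempty then Z.sx h.choose else 0
  | n + 1 => liftBd (Φ (n + 1)) (carrierMap Φ n ∘ₗ Y.bd n)

section

variable {A : Sub Y} {Φ : ∀ n, Y.obj n → Sub Z}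

lemma carrierMap_zero (hΦ : IsCarrier A Φ) {x : Y.obj 0} (hx : x ∈ A.carrier 0) :
    ∃ y ∈ (Φ 0 x).carrier 0, carrierMap Φ 0 (Y.sx x) = Z.sx y := by
  have h := (hΦ.acyclic 0 x hx).nonempty
  exact ⟨h.choose, h.choose_spec, by simp [carrierMap, dif_pos h]⟩

lemma carrierMap_aug (hΦ : IsCarrier A Φ) : IsAugmented A (carrierMap Φ) :=
  .of_sx fun x hx ↦ by
    obtain ⟨y, -, h⟩ := carrierMap_zero hΦ hx
    rw [h, aug_sx]

/-- The prescribed boundary of the image of x is a chain of the carrier of x. To fill it, one needs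
that it is a cycle (of weight 0 in degree 0), which is the chain map identity one degree below.
Hence the induction treats two consecutive degrees together. -/
lemma carrierMap_aux (hΦ : IsCarrier A Φ) (n : ℕ) :
    (∀ x ∈ A.carrier n, carrierMap Φ n (Y.sx x) ∈ (Φ n x).chains n) ∧
    ∀ x ∈ A.carrier (n + 1), carrierMap Φ (n + 1) (Y.sx x) ∈ (Φ (n + 1) x).chains (n + 1) ∧
      Z.bd n (carrierMap Φ (n + 1) (Y.sx x)) = carrierMap Φ n (Y.bd n (Y.sx x)) := by
  induction n with
  | zero =>
    have h0 : ∀ x ∈ A.carrier 0, carrierMap Φ 0 (Y.sx x) ∈ (Φ 0 x).chains 0 := fun x hx ↦ by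
      obtain ⟨y, hy, h⟩ := carrierMap_zero hΦ hx
      exact h ▸ Sub.sx_mem hy
    refine ⟨h0, fun x hx ↦ liftBd_spec ((hΦ.acyclic 1 x hx).zero _
      (CarriedBy.bd_mem hΦ h0 hx) ?_)⟩
    rw [LinearMap.comp_apply, carrierMap_aug hΦ _ (Sub.bd_mem (Sub.sx_mem hx)), aug_bd]
  | succ n ih =>
    refine ⟨fun x hx ↦ (ih.2 x hx).1, fun x hx ↦ liftBd_spec ((hΦ.acyclic (n + 2) x hx).succ _ _
      (CarriedBy.bd_mem hΦ (fun x hx ↦ (ih.2 x hx).1) hx) ?_)⟩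
    have := A.map_eq (f := Z.bd n ∘ₗ carrierMap Φ (n + 1)) (g := carrierMap Φ n ∘ₗ Y.bd n)
      (fun x hx ↦ (ih.2 x hx).2) (Sub.bd_mem (Sub.sx_mem hx))
    simp only [LinearMap.comp_apply] at this ⊢
    rw [this, bd_bd, map_zero]

lemma carrierMap_carried (hΦ : IsCarrier A Φ) : CarriedBy A Φ (carrierMap Φ) :=
  fun n ↦ (carrierMap_aux hΦ n).1

lemma carrierMap_chain (hΦ : IsCarrier A Φ) : IsChainMapOn A (carrierMap Φ) :=
  .of_sx fun n x hx ↦ ((carrierMap_aux hΦ n).2 x hx).2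

/-- The chain homotopy between two chain maps with the same acyclic carrier. -/
def carrierHomotopy (Φ : ∀ n, Y.obj n → Sub Z) (f g : ∀ n, Y.Chain n →ₗ[ℤ] Z.Chain n) :
    ∀ n, Y.Chain n →ₗ[ℤ] Z.Chain (n + 1)
  | 0 => liftBd (Φ 0) (f 0 - g 0)
  | n + 1 => liftBd (Φ (n + 1)) (f (n + 1) - g (n + 1) - carrierHomotopy Φ f g n ∘ₗ Y.bd n)

variable {f g : ∀ n, Y.Chain n →ₗ[ℤ] Z.Chain n}

lemma carrierHomotopy_zero (hΦ : IsCarrier A Φ) (hf : CarriedBy A Φ f) (hg : CarriedBy A Φ g)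
    (hfa : IsAugmented A f) (hga : IsAugmented A g) {x : Y.obj 0} (hx : x ∈ A.carrier 0) :
    carrierHomotopy Φ f g 0 (Y.sx x) ∈ (Φ 0 x).chains 1 ∧
      Z.bd 0 (carrierHomotopy Φ f g 0 (Y.sx x)) = f 0 (Y.sx x) - g 0 (Y.sx x) := by
  refine liftBd_spec ((hΦ.acyclic 0 x hx).zero _ (sub_mem (hf 0 x hx) (hg 0 x hx)) ?_)
  rw [LinearMap.sub_apply, map_sub, hfa _ (Sub.sx_mem hx), hga _ (Sub.sx_mem hx), sub_self]

/-- With h the homotopy constructed so far, f - g - h∂ takes x to a cycle of its carrier, because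
∂h∂ = (f - g)∂ - h∂∂ = (f - g)∂; acyclicity provides the next value of h. -/
lemma carrierHomotopy_aux (hΦ : IsCarrier A Φ) (hf : CarriedBy A Φ f) (hg : CarriedBy A Φ g)
    (hfa : IsAugmented A f) (hga : IsAugmented A g) (hfc : IsChainMapOn A f)
    (hgc : IsChainMapOn A g) (n : ℕ) :
    (∀ x ∈ A.carrier n, carrierHomotopy Φ f g n (Y.sx x) ∈ (Φ n x).chains (n + 1)) ∧
    ∀ x ∈ A.carrier (n + 1),
      carrierHomotopy Φ f g (n + 1) (Y.sx x) ∈ (Φ (n + 1) x).chains (n + 2) ∧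
      Z.bd (n + 1) (carrierHomotopy Φ f g (n + 1) (Y.sx x)) =
        f (n + 1) (Y.sx x) - g (n + 1) (Y.sx x) - carrierHomotopy Φ f g n (Y.bd n (Y.sx x)) := by
  induction n with
  | zero =>
    have h0 : ∀ x ∈ A.carrier 0, carrierHomotopy Φ f g 0 (Y.sx x) ∈ (Φ 0 x).chains 1 :=
      fun x hx ↦ (carrierHomotopy_zero hΦ hf hg hfa hga hx).1
    refine ⟨h0, fun x hx ↦ liftBd_spec ((hΦ.acyclic 1 x hx).succ _ _ (sub_mem
      (sub_mem (hf 1 x hx) (hg 1 x hx)) (CarriedBy.bd_mem hΦ h0 hx)) ?_)⟩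
    have := A.map_eq (f := Z.bd 0 ∘ₗ carrierHomotopy Φ f g 0) (g := f 0 - g 0)
      (fun x hx ↦ (carrierHomotopy_zero hΦ hf hg hfa hga hx).2) (Sub.bd_mem (Sub.sx_mem hx))
    simp only [LinearMap.comp_apply, LinearMap.sub_apply, map_sub] at this ⊢
    rw [this, hfc _ _ (Sub.sx_mem hx), hgc _ _ (Sub.sx_mem hx), sub_self]
  | succ n ih =>
    refine ⟨fun x hx ↦ (ih.2 x hx).1, fun x hx ↦ liftBd_spec ((hΦ.acyclic (n + 2) x hx).succ _ _
      (sub_mem (sub_mem (hf _ x hx) (hg _ x hx))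
        (CarriedBy.bd_mem hΦ (fun x hx ↦ (ih.2 x hx).1) hx)) ?_)⟩
    have := A.map_eq (f := Z.bd (n + 1) ∘ₗ carrierHomotopy Φ f g (n + 1))
      (g := f (n + 1) - g (n + 1) - carrierHomotopy Φ f g n ∘ₗ Y.bd n)
      (fun x hx ↦ (ih.2 x hx).2) (Sub.bd_mem (Sub.sx_mem hx))
    simp only [LinearMap.comp_apply, LinearMap.sub_apply, map_sub] at this ⊢
    rw [this, hfc _ _ (Sub.sx_mem hx), hgc _ _ (Sub.sx_mem hx), bd_bd]
    simp

end

/-! ### Relative homology -/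

/-- Chains of `A` whose boundary is a chain of `A'`. -/
def relCycles (A A' : Sub Y) : ∀ n, Submodule ℤ (Y.Chain n)
  | 0 => A.chains 0
  | n + 1 => A.chains (n + 1) ⊓ (A'.chains n).comap (Y.bd n)

/-- Sums of boundaries of chains of `A` and of chains of `A'`. -/
def relBoundaries (A A' : Sub Y) (n : ℕ) : Submodule ℤ (Y.Chain n) :=
  (A.chains (n + 1)).map (Y.bd n) ⊔ A'.chains n

lemma relCycles_le (A A' : Sub Y) : ∀ n, relCycles A A' n ≤ A.chains n
  | 0 => _root_.le_refl _
  | _ + 1 => inf_le_left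

/-- The relative homology of two families of simplices. -/
abbrev RelH (A A' : Sub Y) (n : ℕ) : Type _ :=
  relCycles A A' n ⧸ (relBoundaries A A' n).submoduleOf (relCycles A A' n)

/-- A chain map of pairs. -/
structure PairMap (A A' : Sub Y) (D D' : Sub Z) where
  f : ∀ n, Y.Chain n →ₗ[ℤ] Z.Chain n
  chain : IsChainMapOn A f
  total : ∀ n, ∀ x ∈ A.carrier n, f n (Y.sx x) ∈ D.chains n
  sub : ∀ n, ∀ x ∈ A'.carrier n, f n (Y.sx x) ∈ D'.chains n

namespace PairMap

variable {A A' : Sub Y} {D D' : Sub Z} {G G' : Sub W}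

lemma map_total (φ : PairMap A A' D D') {n : ℕ} {z : Y.Chain n} (hz : z ∈ A.chains n) :
    φ.f n z ∈ D.chains n := A.map_mem (φ.total n) hz

lemma map_sub (φ : PairMap A A' D D') {n : ℕ} {z : Y.Chain n} (hz : z ∈ A'.chains n) :
    φ.f n z ∈ D'.chains n := A'.map_mem (φ.sub n) hz

lemma map_relCycles (φ : PairMap A A' D D') : ∀ n, ∀ z ∈ relCycles A A' n,
    φ.f n z ∈ relCycles D D' n
  | 0, _, hz => φ.map_total hz
  | n + 1, z, hz => ⟨φ.map_total hz.1, by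
      change Z.bd n (φ.f (n + 1) z) ∈ D'.chains n
      rw [φ.chain _ _ hz.1]
      exact φ.map_sub hz.2⟩

lemma map_relBoundaries (φ : PairMap A A' D D') {n : ℕ} {z : Y.Chain n}
    (hz : z ∈ relBoundaries A A' n) : φ.f n z ∈ relBoundaries D D' n := by
  obtain ⟨_, ⟨w, hw, rfl⟩, v, hv, rfl⟩ := Submodule.mem_sup.1 hz
  rw [map_add, ← φ.chain _ _ hw]
  exact Submodule.add_mem_sup (Submodule.mem_map_of_mem (φ.map_total hw)) (φ.map_sub hv)

/-- The homomorphism induced by a chain map of pairs. -/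
def mapH (φ : PairMap A A' D D') (n : ℕ) : RelH A A' n →ₗ[ℤ] RelH D D' n :=
  Submodule.mapQ _ _ ((φ.f n).restrict (φ.map_relCycles n)) fun _ hz ↦ φ.map_relBoundaries hz

lemma mapH_mk (φ : PairMap A A' D D') (n : ℕ) (z : relCycles A A' n) :
    φ.mapH n (Submodule.Quotient.mk z) =
      Submodule.Quotient.mk ⟨φ.f n z, φ.map_relCycles n z z.2⟩ := rfl

/-- Composition of chain maps of pairs. -/
def comp (ψ : PairMap D D' G G') (φ : PairMap A A' D D') : PairMap A A' G G' where
  f n := ψ.f n ∘ₗ φ.f n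
  chain n z hz := by
    simp only [LinearMap.comp_apply]
    rw [ψ.chain _ _ (φ.map_total hz), φ.chain _ _ hz]
  total n x hx := ψ.map_total (φ.total n x hx)
  sub n x hx := ψ.map_sub (φ.sub n x hx)

lemma mapH_comp (ψ : PairMap D D' G G') (φ : PairMap A A' D D') (n : ℕ) :
    (ψ.comp φ).mapH n = ψ.mapH n ∘ₗ φ.mapH n := by
  refine LinearMap.ext fun y ↦ ?_
  obtain ⟨z, rfl⟩ := Submodule.Quotient.mk_surjective _ y
  rfl

/-- The chain map of an inclusion of pairs. -/
def incl {A A' D D' : Sub Y} (h : A ≤ D) (h' : A' ≤ D') : PairMap A A' D D' where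
  f _ := LinearMap.id
  chain _ _ _ := rfl
  total n _ hx := Sub.sx_mem (h n hx)
  sub n _ hx := Sub.sx_mem (h' n hx)

lemma mapH_eq_of_sub_mem {φ ψ : PairMap A A' D D'} {n : ℕ}
    (h : ∀ z ∈ relCycles A A' n, φ.f n z - ψ.f n z ∈ relBoundaries D D' n) :
    φ.mapH n = ψ.mapH n := by
  refine LinearMap.ext fun y ↦ ?_
  obtain ⟨z, rfl⟩ := Submodule.Quotient.mk_surjective _ y
  rw [mapH_mk, mapH_mk, Submodule.Quotient.eq]
  exact h z z.2

lemma mapH_eq_of_f_eq {φ ψ : PairMap A A' D D'} (h : ∀ n, φ.f n = ψ.f n) (n : ℕ) :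
    φ.mapH n = ψ.mapH n :=
  mapH_eq_of_sub_mem fun z _ ↦ by simp [h n]

/-- Chain maps of pairs with the same acyclic carrier induce the same homomorphism. -/
lemma mapH_eq_of_carrier {φ ψ : PairMap A A' D D'} {Φ : ∀ n, Y.obj n → Sub Z}
    (hΦ : IsCarrier A Φ) (hD : ∀ n, ∀ x ∈ A.carrier n, Φ n x ≤ D)
    (hD' : ∀ n, ∀ x ∈ A'.carrier n, Φ n x ≤ D') (hA : A' ≤ A)
    (hφ : CarriedBy A Φ φ.f) (hψ : CarriedBy A Φ ψ.f)
    (hφa : IsAugmented A φ.f) (hψa : IsAugmented A ψ.f) (n : ℕ) : φ.mapH n = ψ.mapH n := by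
  have aux := carrierHomotopy_aux hΦ hφ hψ hφa hψa φ.chain ψ.chain
  have hmem : ∀ n, ∀ z ∈ A.chains n, carrierHomotopy Φ φ.f ψ.f n z ∈ D.chains (n + 1) :=
    fun n z hz ↦ A.map_mem (fun x hx ↦ Sub.chains_mono (hD n x hx) _ ((aux n).1 x hx)) hz
  have hmem' : ∀ n, ∀ z ∈ A'.chains n, carrierHomotopy Φ φ.f ψ.f n z ∈ D'.chains (n + 1) :=
    fun n z hz ↦ A'.map_mem
      (fun x hx ↦ Sub.chains_mono (hD' n x hx) _ ((aux n).1 x (hA n hx))) hz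
  refine mapH_eq_of_sub_mem fun z hz ↦ ?_
  cases n with
  | zero =>
    have := A.map_eq (f := Z.bd 0 ∘ₗ carrierHomotopy Φ φ.f ψ.f 0) (g := φ.f 0 - ψ.f 0)
      (fun x hx ↦ (carrierHomotopy_zero hΦ hφ hψ hφa hψa hx).2) hz
    simp only [LinearMap.comp_apply, LinearMap.sub_apply] at this
    rw [← this]
    exact Submodule.mem_sup_left (Submodule.mem_map_of_mem (hmem _ _ hz))
  | succ n =>
    have := A.map_eq (f := Z.bd (n + 1) ∘ₗ carrierHomotopy Φ φ.f ψ.f (n + 1))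
      (g := φ.f (n + 1) - ψ.f (n + 1) - carrierHomotopy Φ φ.f ψ.f n ∘ₗ Y.bd n)
      (fun x hx ↦ ((aux n).2 x hx).2) hz.1
    simp only [LinearMap.comp_apply, LinearMap.sub_apply] at this
    -- The difference is ∂hz + h∂z. The second term is a chain of `D'`, since ∂z is a chain of `A'`
    -- and h maps such chains to `D'`.
    rw [← sub_add_cancel (φ.f (n + 1) z - ψ.f (n + 1) z)
      (carrierHomotopy Φ φ.f ψ.f n (Y.bd n z)), ← this]
    exact Submodule.add_mem_sup (Submodule.mem_map_of_mem (hmem _ _ hz.1)) (hmem' _ _ hz.2)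

/-- The chain map of pairs that is carried by an acyclic carrier. -/
def ofCarrier (Φ : ∀ n, Y.obj n → Sub Z) (hΦ : IsCarrier A Φ)
    (hD : ∀ n, ∀ x ∈ A.carrier n, Φ n x ≤ D) (hD' : ∀ n, ∀ x ∈ A'.carrier n, Φ n x ≤ D')
    (hA : A' ≤ A) : PairMap A A' D D' where
  f := carrierMap Φ
  chain := carrierMap_chain hΦ
  total n x hx := Sub.chains_mono (hD n x hx) _ (carrierMap_carried hΦ n x hx)
  sub n x hx := Sub.chains_mono (hD' n x hx) _ (carrierMap_carried hΦ n x (hA n hx))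

/-- The chain map of pairs induced by a map of simplices. -/
def ofSimplexMap (s : ∀ n, Y.obj n → Z.obj n)
    (hs : ∀ n, ∀ x ∈ A.carrier (n + 1), ∀ i, s n (Y.δ i x) = Z.δ i (s (n + 1) x))
    (hD : ∀ n, ∀ x ∈ A.carrier n, s n x ∈ D.carrier n)
    (hD' : ∀ n, ∀ x ∈ A'.carrier n, s n x ∈ D'.carrier n) : PairMap A A' D D' where
  f n := Finsupp.lmapDomain ℤ ℤ (s n)
  chain := .of_sx fun n x hx ↦ by
    have e : ∀ n (x : Y.obj n), Finsupp.lmapDomain ℤ ℤ (s n) (Y.sx x) = Z.sx (s n x) := by simp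
    rw [e, bd_sx, bd_sx, map_sum]
    simp only [map_zsmul, e, hs n x hx]
  total n x hx := by simpa using Sub.sx_mem (hD n x hx)
  sub n x hx := by simpa using Sub.sx_mem (hD' n x hx)

end PairMap

end FaceSystem

end LocalHomology

end

noncomputable section

namespace LocalHomology

open FaceSystem
open scoped Simplicial

/-! ### Comparison with the homology of pairs of simplicial sets -/

/-- The faces of a simplicial set. -/
def faceSystem (X : SSet.{u}) : FaceSystem.{u} where
  obj n := X _⦋n⦌
  δ i x := X.δ i x
  δ_δ _ _ x h := SSet.δ_comp_δ_apply h x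

/-- The map of simplices underlying a map of simplicial sets. -/
def faceMap {X' X : SSet.{u}} (g : X' ⟶ X) (n : ℕ) (x : (faceSystem X').obj n) :
    (faceSystem X).obj n := (g.app _ x : X _⦋n⦌)

/-- The integers, as coefficients in the universe `u`. -/
abbrev coeff : ModuleCat.{u} ℤ := ModuleCat.of ℤ (ULift.{u} ℤ)

/-! ### The categorical chain complex of a simplicial set, in terms of finitely supported functions
-/

section Chains

variable (X : SSet.{u})

/-- The simplicial chain complex with integer coefficients. -/
abbrev intComplex : ChainComplex (ModuleCat.{u} ℤ) ℕ := X.chainComplex coeff.{u}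

variable {X} in
/-- A simplex as an element of the chain complex. -/
def simplexToComplex {n : ℕ} (x : (faceSystem X).obj n) : (intComplex X).X n :=
  (X.ιChainComplex (R := coeff.{u}) x).hom ⟨1⟩

/-- A chain of simplices as an element of the chain complex of a simplicial set. -/
def chainToComplex (n : ℕ) : (faceSystem X).Chain n →ₗ[ℤ] (intComplex X).X n :=
  Finsupp.linearCombination ℤ simplexToComplex

lemma chainToComplex_sx {n : ℕ} (x : (faceSystem X).obj n) :
    chainToComplex X n ((faceSystem X).sx x) = simplexToComplex x := by
  rw [chainToComplex, Finsupp.linearCombination_single]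
  exact @MulAction.one_smul _ _ _ (_) _

/-- The inverse of `chainToComplex`. -/
def complexToChain (n : ℕ) : (intComplex X).X n ⟶ ModuleCat.of ℤ ((faceSystem X).Chain n) :=
  Sigma.desc fun x : X _⦋n⦌ ↦ ModuleCat.ofHom
    ((Finsupp.lsingle x : ℤ →ₗ[ℤ] (faceSystem X).Chain n) ∘ₗ ULift.moduleEquiv.toLinearMap)

lemma ι_complexToChain {n : ℕ} (x : X _⦋n⦌) :
    X.ιChainComplex (R := coeff.{u}) x ≫ complexToChain X n = ModuleCat.ofHom
      ((Finsupp.lsingle x : ℤ →ₗ[ℤ] (faceSystem X).Chain n) ∘ₗ ULift.moduleEquiv.toLinearMap) :=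
  Sigma.ι_desc _ _

lemma complexToChain_simplexToComplex {n : ℕ} (x : (faceSystem X).obj n) :
    (complexToChain X n).hom (simplexToComplex x) = (faceSystem X).sx x :=
  congrArg (fun f ↦ f.hom ⟨1⟩) (ι_complexToChain X x)

/-- In each degree the complex is a coproduct of copies of the coefficients indexed by the
simplices, so that both composites with `complexToChain` can be checked on single simplices. -/
lemma chainToComplex_bijective (n : ℕ) : Function.Bijective (chainToComplex X n) := by
  have h1 : (complexToChain X n).hom ∘ₗ chainToComplex X n = LinearMap.id := by
    refine hom_ext fun x ↦ ?_
    rw [LinearMap.comp_apply, chainToComplex_sx, complexToChain_simplexToComplex]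
    rfl
  have h2 : complexToChain X n ≫ ModuleCat.ofHom (chainToComplex X n) = 𝟙 _ := by
    refine SSet.chainComplex_hom_ext fun x ↦ ?_
    rw [← Category.assoc, ι_complexToChain, Category.comp_id]
    refine ModuleCat.hom_ext (LinearMap.ext fun r ↦ ?_)
    obtain ⟨r⟩ := r
    change chainToComplex X n (Finsupp.single x r) =
      (X.ιChainComplex (R := coeff.{u}) x).hom ⟨r⟩
    have hr : (⟨r⟩ : coeff.{u}) = r • (⟨1⟩ : coeff.{u}) :=
      ULift.ext _ _ (show r = r * 1 from (mul_one r).symm)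
    rw [hr, LinearMap.map_smul]
    exact Finsupp.linearCombination_single ℤ r x
  exact ⟨Function.LeftInverse.injective (g := (complexToChain X n).hom) (LinearMap.congr_fun h1),
    Function.RightInverse.surjective (g := (complexToChain X n).hom)
      fun y ↦ LinearMap.congr_fun (congrArg ModuleCat.Hom.hom h2) y⟩

lemma d_chainToComplex (n : ℕ) (z : (faceSystem X).Chain (n + 1)) :
    ((intComplex X).d (n + 1) n).hom (chainToComplex X (n + 1) z) =
      chainToComplex X n ((faceSystem X).bd n z) := by
  suffices h : ((intComplex X).d (n + 1) n).hom ∘ₗ chainToComplex X (n + 1) =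
      chainToComplex X n ∘ₗ (faceSystem X).bd n from LinearMap.congr_fun h z
  refine hom_ext fun x ↦ ?_
  rw [LinearMap.comp_apply, chainToComplex_sx, LinearMap.comp_apply, bd_sx, map_sum]
  refine (congrArg (fun f ↦ f.hom ⟨1⟩) (X.ιChainComplex_d coeff.{u} x)).trans ?_
  simp only [ModuleCat.hom_sum, LinearMap.sum_apply]
  refine Finset.sum_congr rfl fun i _ ↦ ?_
  rw [map_zsmul, chainToComplex_sx, ModuleCat.hom_zsmul]
  rfl

variable {X} {X' : SSet.{u}} (f : X' ⟶ X)

lemma chainToComplex_map (n : ℕ) (z : (faceSystem X').Chain n) :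
    ((SSet.chainComplexMap f coeff.{u}).f n).hom (chainToComplex X' n z) =
      chainToComplex X n (Finsupp.lmapDomain ℤ ℤ (faceMap f n) z) := by
  suffices h : ((SSet.chainComplexMap f coeff.{u}).f n).hom ∘ₗ chainToComplex X' n =
      chainToComplex X n ∘ₗ Finsupp.lmapDomain ℤ ℤ (faceMap f n) from
    LinearMap.congr_fun h z
  refine hom_ext fun x ↦ ?_
  rw [LinearMap.comp_apply, chainToComplex_sx, LinearMap.comp_apply]
  refine (congrArg (fun f ↦ f.hom ⟨1⟩) (SSet.ι_chainComplexMap_f _ _ f coeff.{u} x)).trans ?_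
  have : (Finsupp.lmapDomain ℤ ℤ (faceMap f n)) ((faceSystem X').sx x) =
      (faceSystem X).sx (faceMap f n x) := by simp
  rw [this, chainToComplex_sx]
  rfl

end Chains

/-! ### Homology of the cokernel complex as relative cycles modulo relative boundaries -/

section Quotient

variable (f : Arrow SSet.{u})

/-- The relative chain complex. -/
abbrev relComplex : ChainComplex (ModuleCat.{u} ℤ) ℕ :=
  cokernel (SSet.chainComplexMap f.hom coeff.{u})

/-- The class of a chain in the relative chain complex. -/
def chainToRel (n : ℕ) : (faceSystem f.right).Chain n →ₗ[ℤ] (relComplex f).X n :=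
  ((cokernel.π (SSet.chainComplexMap f.hom coeff.{u})).f n).hom ∘ₗ chainToComplex f.right n

lemma chainToRel_surjective (n : ℕ) : Function.Surjective (chainToRel f n) := by
  rw [chainToRel, LinearMap.coe_comp]
  refine Function.Surjective.comp ?_ (chainToComplex_bijective f.right n).2
  exact (ModuleCat.epi_iff_surjective _).1 inferInstance

/-- The simplices in the image of a map of simplicial sets. -/
def imageSub {X' X : SSet.{u}} (g : X' ⟶ X) : Sub (faceSystem X) where
  carrier n := Set.range (faceMap g n)
  δ_mem := by
    rintro n i _ ⟨x, rfl⟩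
    exact ⟨X'.δ i x, SSet.δ_naturality_apply g i x⟩

lemma imageSub_chains {X' X : SSet.{u}} (g : X' ⟶ X) (n : ℕ) : (imageSub g).chains n =
    LinearMap.range (Finsupp.lmapDomain ℤ ℤ (faceMap g n)) := by
  rw [Finsupp.range_lmapDomain, Sub.chains_eq_span]
  congr 1
  exact (Set.range_comp _ _).symm

/-- Evaluation in a degree preserves the exactness of the cokernel sequence, so the kernel of the
projection is the range of the chain map, that is, the chains supported on the image simplices. -/
lemma chainToRel_eq_zero_iff (n : ℕ) (z : (faceSystem f.right).Chain n) :
    chainToRel f n z = 0 ↔ z ∈ (imageSub f.hom).chains n := by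
  have hex := (ShortComplex.exact_cokernel (SSet.chainComplexMap f.hom coeff.{u})).map
    (HomologicalComplex.eval (ModuleCat.{u} ℤ) (ComplexShape.down ℕ) n)
  have h := (ShortComplex.moduleCat_exact_iff_range_eq_ker _).1 hex
  have h' : ∀ y : (intComplex f.right).X n,
      ((cokernel.π (SSet.chainComplexMap f.hom coeff.{u})).f n).hom y = 0 ↔
      y ∈ LinearMap.range ((SSet.chainComplexMap f.hom coeff.{u}).f n).hom :=
    fun y ↦ (SetLike.ext_iff.1 h y).symm
  rw [chainToRel, LinearMap.comp_apply, h', imageSub_chains]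
  constructor
  · rintro ⟨w, hw⟩
    obtain ⟨v, rfl⟩ := (chainToComplex_bijective f.left n).2 w
    refine ⟨v, (chainToComplex_bijective f.right n).1 ?_⟩
    rw [← hw]
    exact (chainToComplex_map f.hom n v).symm
  · rintro ⟨v, rfl⟩
    exact ⟨_, chainToComplex_map f.hom n v⟩

lemma d_chainToRel (n : ℕ) (z : (faceSystem f.right).Chain (n + 1)) :
    ((relComplex f).d (n + 1) n).hom (chainToRel f (n + 1) z) =
      chainToRel f n ((faceSystem f.right).bd n z) := by
  have h := (cokernel.π (SSet.chainComplexMap f.hom coeff.{u})).comm (n + 1) n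
  refine (congrArg (fun g ↦ g.hom (chainToComplex f.right (n + 1) z)) h).trans ?_
  change ((cokernel.π (SSet.chainComplexMap f.hom coeff.{u})).f n).hom _ = _
  rw [chainToRel, LinearMap.comp_apply, ← d_chainToComplex]
  rfl

/-- All simplices. -/
def allSimplices (Y : FaceSystem) : Sub Y := ⟨fun _ ↦ Set.univ, fun _ _ _ ↦ trivial⟩

lemma mem_allSimplices {Y : FaceSystem} {n : ℕ} (z : Y.Chain n) :
    z ∈ (allSimplices Y).chains n := by
  simp [allSimplices, Sub.chains, Finsupp.supported_univ]

lemma d_eq_zero_iff (n : ℕ) (z : (faceSystem f.right).Chain n) :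
    ((relComplex f).d n ((ComplexShape.down ℕ).next n)).hom (chainToRel f n z) = 0 ↔
      z ∈ relCycles (allSimplices _) (imageSub f.hom) n := by
  cases n with
  | zero =>
    -- In degree 0 the next index is 0 again and this differential vanishes, in accordance with the
    -- convention that every 0-chain is a relative cycle.
    rw [ChainComplex.next_nat_zero, HomologicalComplex.shape _ _ _ (by simp)]
    simp [relCycles, mem_allSimplices]
  | succ n =>
    rw [ChainComplex.next_nat_succ, d_chainToRel, chainToRel_eq_zero_iff]
    simp [relCycles, mem_allSimplices]

/-- The homology class of a relative cycle. -/
def relClass (n : ℕ) : relCycles (allSimplices _) (imageSub f.hom) n →ₗ[ℤ] (relHomology n).obj f :=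
  ((relComplex f).liftCycles (A := ModuleCat.of ℤ (relCycles (allSimplices _) (imageSub f.hom) n))
    (ModuleCat.ofHom (chainToRel f n ∘ₗ Submodule.subtype _)) _ rfl
      (by
        refine ModuleCat.hom_ext (LinearMap.ext fun z ↦ ?_)
        exact (d_eq_zero_iff f n z).2 z.2) ≫ (relComplex f).homologyπ n).hom

lemma iCycles_injective (K : ChainComplex (ModuleCat.{u} ℤ) ℕ) (n : ℕ) :
    Function.Injective (K.iCycles n).hom :=
  (ModuleCat.mono_iff_injective _).1 inferInstance

lemma exists_relClass (n : ℕ) (z : relCycles (allSimplices _) (imageSub f.hom) n) :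
    ∃ y, ((relComplex f).iCycles n).hom y = chainToRel f n z ∧
      relClass f n z = ((relComplex f).homologyπ n).hom y :=
  ⟨_, congrArg (fun g : ModuleCat.of ℤ (relCycles (allSimplices _) (imageSub f.hom) n) ⟶
    (relComplex f).X n ↦ g.hom z) ((relComplex f).liftCycles_i _ _ _ _), rfl⟩

lemma relClass_surjective (n : ℕ) : Function.Surjective (relClass f n) := by
  intro h
  obtain ⟨y, rfl⟩ := (ModuleCat.epi_iff_surjective ((relComplex f).homologyπ n)).1 inferInstance h
  obtain ⟨z, hz⟩ := chainToRel_surjective f n (((relComplex f).iCycles n).hom y)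
  have hz' : z ∈ relCycles (allSimplices _) (imageSub f.hom) n := by
    refine (d_eq_zero_iff f n z).1 ?_
    rw [hz]
    exact congrArg (fun g : (relComplex f).cycles n ⟶ (relComplex f).X _ ↦ g.hom y)
      ((relComplex f).iCycles_d n _)
  obtain ⟨y', h1, h2⟩ := exists_relClass f n ⟨z, hz'⟩
  refine ⟨⟨z, hz'⟩, h2.trans ?_⟩
  rw [iCycles_injective _ _ (h1.trans hz)]

/-- Homology is the cokernel of `toCycles`, and cycles embed in chains; so the vanishing of a class
becomes an equation between chains. -/
lemma homologyπ_eq_zero_iff (K : ChainComplex (ModuleCat.{u} ℤ) ℕ) (n : ℕ) (y : K.cycles n) :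
    (K.homologyπ n).hom y = 0 ↔ ∃ w, (K.d (n + 1) n).hom w = (K.iCycles n).hom y := by
  have hex := ShortComplex.exact_of_g_is_cokernel (ShortComplex.mk _ _
    (K.toCycles_comp_homologyπ (n + 1) n)) (K.homologyIsCokernel (n + 1) n (by simp))
  have hi : ∀ w, (K.iCycles n).hom ((K.toCycles (n + 1) n).hom w) = (K.d (n + 1) n).hom w :=
    fun w ↦ congrArg (fun g ↦ g.hom w) (K.toCycles_i (n + 1) n)
  constructor
  · intro h
    obtain ⟨w, hw⟩ := (ShortComplex.moduleCat_exact_iff _).1 hex y h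
    exact ⟨w, by rw [← hi]; exact congrArg _ hw⟩
  · rintro ⟨w, hw⟩
    rw [← hi] at hw
    rw [← iCycles_injective _ _ hw]
    exact congrArg (fun g ↦ g.hom w) (K.toCycles_comp_homologyπ (n + 1) n)

lemma relClass_eq_zero_iff (n : ℕ) (z : relCycles (allSimplices _) (imageSub f.hom) n) :
    relClass f n z = 0 ↔
      (z : (faceSystem f.right).Chain n) ∈ relBoundaries (allSimplices _) (imageSub f.hom) n := by
  obtain ⟨y, h1, h2⟩ := exists_relClass f n z
  rw [h2]
  refine (homologyπ_eq_zero_iff (relComplex f) n y).trans ?_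
  rw [h1]
  constructor
  · rintro ⟨w, hw⟩
    obtain ⟨v, rfl⟩ := chainToRel_surjective f (n + 1) w
    rw [d_chainToRel] at hw
    refine Submodule.mem_sup.2 ⟨_, Submodule.mem_map_of_mem (mem_allSimplices v), _,
      (chainToRel_eq_zero_iff f n (z - (faceSystem f.right).bd n v)).1 ?_,
      add_sub_cancel _ _⟩
    rw [map_sub, hw, sub_self]
  · intro h
    obtain ⟨_, ⟨v, -, rfl⟩, v', hv', hz⟩ := Submodule.mem_sup.1 h
    refine ⟨chainToRel f (n + 1) v, ?_⟩
    rw [d_chainToRel, ← hz, map_add, (chainToRel_eq_zero_iff f n v').2 hv', add_zero]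

/-- Relative homology, computed from relative cycles and relative boundaries. -/
def relHEquiv (n : ℕ) :
    RelH (allSimplices _) (imageSub f.hom) n ≃ₗ[ℤ] (relHomology n).obj f :=
  LinearEquiv.ofBijective
    (Submodule.liftQ _ (relClass f n) fun z hz ↦ (relClass_eq_zero_iff f n z).2 hz)
    ⟨by
      rw [← LinearMap.ker_eq_bot, Submodule.ker_liftQ_eq_bot']
      ext z
      exact (relClass_eq_zero_iff f n z).symm,
     fun h ↦ by
      obtain ⟨z, hz⟩ := relClass_surjective f n h
      exact ⟨Submodule.Quotient.mk z, hz⟩⟩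

lemma relHEquiv_mk (n : ℕ) (z : relCycles (allSimplices _) (imageSub f.hom) n) :
    relHEquiv f n (Submodule.Quotient.mk z) = relClass f n z := rfl

variable {f} {g : Arrow SSet.{u}} (φ : f ⟶ g)

/-- The chain map of pairs induced by a morphism of arrows of simplicial sets. -/
def arrowPairMap :
    PairMap (allSimplices _) (imageSub f.hom) (allSimplices _) (imageSub g.hom) :=
  .ofSimplexMap (faceMap φ.right)
    (fun _ x _ i ↦ SSet.δ_naturality_apply φ.right i x)
    (fun _ _ _ ↦ trivial) (by
      rintro n _ ⟨x, rfl⟩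
      refine ⟨faceMap φ.left n x, ?_⟩
      have := congrArg (fun h ↦ faceMap h n x) (Arrow.w φ)
      exact this)

lemma chainToRel_naturality (n : ℕ) (z : (faceSystem f.right).Chain n) :
    ((coker _).map (((SSet.chainComplexFunctor (ModuleCat.{u} ℤ)).obj coeff.{u}).mapArrow.map
      φ) |>.f n).hom (chainToRel f n z) = chainToRel g n ((arrowPairMap φ).f n z) := by
  have h := congrArg (fun k : intComplex f.right ⟶ relComplex g ↦ (k.f n).hom (chainToComplex f.right n z))
    ((coker.π (ChainComplex (ModuleCat.{u} ℤ) ℕ)).naturality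
      (((SSet.chainComplexFunctor (ModuleCat.{u} ℤ)).obj coeff.{u}).mapArrow.map φ))
  refine h.symm.trans ?_
  change ((cokernel.π (SSet.chainComplexMap g.hom coeff.{u})).f n).hom
    (((SSet.chainComplexMap φ.right coeff.{u}).f n).hom (chainToComplex f.right n z)) = _
  rw [chainToComplex_map]
  rfl

/-- Both sides are classes of cycles, and two cycles agree once they agree as chains, by injectivity
of `iCycles`; there the claim is `chainToRel_naturality`. -/
lemma relHEquiv_naturality (n : ℕ) (y : RelH (allSimplices _) (imageSub f.hom) n) :
    ((relHomology n).map φ).hom (relHEquiv f n y) =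
      relHEquiv g n ((arrowPairMap φ).mapH n y) := by
  obtain ⟨z, rfl⟩ := Submodule.Quotient.mk_surjective _ y
  rw [PairMap.mapH_mk, relHEquiv_mk, relHEquiv_mk]
  obtain ⟨y, h1, h2⟩ := exists_relClass f n z
  obtain ⟨y', h1', h2'⟩ := exists_relClass g n
    ⟨(arrowPairMap φ).f n z, (arrowPairMap φ).map_relCycles n z z.2⟩
  let ψ : relComplex f ⟶ relComplex g := (coker _).map
    (((SSet.chainComplexFunctor (ModuleCat.{u} ℤ)).obj coeff.{u}).mapArrow.map φ)
  have e1 := congrArg (fun k : (relComplex f).cycles n ⟶ (relComplex g).homology n ↦ k.hom y)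
    (HomologicalComplex.homologyπ_naturality ψ n)
  have e2 := congrArg (fun k : (relComplex f).cycles n ⟶ (relComplex g).X n ↦ k.hom y)
    (HomologicalComplex.cyclesMap_i ψ n)
  rw [h2, h2']
  refine e1.trans (congrArg ((relComplex g).homologyπ n).hom (iCycles_injective _ _ ?_))
  refine e2.trans ?_
  rw [h1']
  change (ψ.f n).hom (((relComplex f).iCycles n).hom y) = _
  rw [h1]
  exact chainToRel_naturality φ n z

end Quotient

/-! ### Injective maps of simplices -/

section Embedding

variable {Y Z : FaceSystem}

lemma lmapDomain_mem_iff {n : ℕ} {s : Y.obj n → Z.obj n} (hs : Function.Injective s) {A : Sub Y}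
    {D : Sub Z} (hD : D.carrier n = s '' A.carrier n) (z : Y.Chain n) :
    Finsupp.lmapDomain ℤ ℤ s z ∈ D.chains n ↔ z ∈ A.chains n := by
  have h : D.chains n = (A.chains n).map (Finsupp.lmapDomain ℤ ℤ s) := by
    rw [Sub.chains, Sub.chains, hD, Finsupp.lmapDomain_supported]
  rw [h]
  exact Function.Injective.mem_set_image (s := (A.chains n : Set (Y.Chain n)))
    (Finsupp.mapDomain_injective hs)

lemma exists_lmapDomain_eq {n : ℕ} {s : Y.obj n → Z.obj n} {A : Sub Y}
    {D : Sub Z} (hD : D.carrier n = s '' A.carrier n) {w : Z.Chain n} (hw : w ∈ D.chains n) :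
    ∃ z ∈ A.chains n, Finsupp.lmapDomain ℤ ℤ s z = w := by
  have h : D.chains n = (A.chains n).map (Finsupp.lmapDomain ℤ ℤ s) := by
    rw [Sub.chains, Sub.chains, hD, Finsupp.lmapDomain_supported]
  rwa [h, Submodule.mem_map] at hw

/-- An injective map of simplices induces an isomorphism onto the homology of its image. -/
lemma mapH_ofSimplexMap_bijective {A A' : Sub Y} {D D' : Sub Z} (s : ∀ n, Y.obj n → Z.obj n)
    (hs : ∀ n, ∀ x ∈ A.carrier (n + 1), ∀ i, s n (Y.δ i x) = Z.δ i (s (n + 1) x))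
    (hinj : ∀ n, Function.Injective (s n)) (hD : ∀ n, D.carrier n = s n '' A.carrier n)
    (hD' : ∀ n, D'.carrier n = s n '' A'.carrier n) (n : ℕ) :
    Function.Bijective ((PairMap.ofSimplexMap (A := A) (A' := A') (D := D) (D' := D') s hs
      (fun n x hx ↦ hD n ▸ ⟨x, hx, rfl⟩) (fun n x hx ↦ hD' n ▸ ⟨x, hx, rfl⟩)).mapH n) := by
  set φ := PairMap.ofSimplexMap (A := A) (A' := A') (D := D) (D' := D') s hs
      (fun n x hx ↦ hD n ▸ ⟨x, hx, rfl⟩) (fun n x hx ↦ hD' n ▸ ⟨x, hx, rfl⟩)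
  have hφ : ∀ n, Function.Injective (φ.f n) := fun n ↦ Finsupp.mapDomain_injective (hinj n)
  have hmem : ∀ n z, φ.f n z ∈ D.chains n ↔ z ∈ A.chains n :=
    fun n ↦ lmapDomain_mem_iff (hinj n) (hD n)
  have hmem' : ∀ n z, φ.f n z ∈ D'.chains n ↔ z ∈ A'.chains n :=
    fun n ↦ lmapDomain_mem_iff (hinj n) (hD' n)
  constructor
  · rw [injective_iff_map_eq_zero]
    intro y hy
    obtain ⟨z, rfl⟩ := Submodule.Quotient.mk_surjective _ y
    rw [PairMap.mapH_mk, Submodule.Quotient.mk_eq_zero] at hy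
    rw [Submodule.Quotient.mk_eq_zero]
    obtain ⟨_, ⟨w, hw, rfl⟩, v, hv, h⟩ := Submodule.mem_sup.1 (show _ ∈ relBoundaries D D' n from hy)
    obtain ⟨w, hw', rfl⟩ := exists_lmapDomain_eq (hD _) hw
    obtain ⟨v, hv', rfl⟩ := exists_lmapDomain_eq (hD' _) hv
    refine Submodule.mem_sup.2 ⟨_, Submodule.mem_map_of_mem hw', v, hv', hφ n ?_⟩
    rw [map_add, ← φ.chain _ _ hw']
    exact h
  · intro y
    obtain ⟨z, rfl⟩ := Submodule.Quotient.mk_surjective _ y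
    obtain ⟨w, hw, h⟩ := exists_lmapDomain_eq (hD _) (relCycles_le _ _ _ z.2)
    have hw' : w ∈ relCycles A A' n := by
      cases n with
      | zero => exact hw
      | succ n =>
        refine ⟨hw, (hmem' _ _).1 ?_⟩
        rw [← φ.chain _ _ hw]
        have := z.2.2
        rw [← h] at this
        exact this
    refine ⟨Submodule.Quotient.mk ⟨w, hw'⟩, ?_⟩
    rw [PairMap.mapH_mk]
    exact congrArg _ (Subtype.ext h)

end Embedding

/-- An embedding of the simplices of a simplicial set into those of a system, identifying a pair
with a pair of families of simplices. -/
structure ArrowEmbedding (f : Arrow SSet.{u}) {Z : FaceSystem} (D D' : Sub Z) where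
  s : ∀ n, (faceSystem f.right).obj n → Z.obj n
  comm : ∀ n x (i : Fin (n + 2)), s n ((faceSystem f.right).δ i x) = Z.δ i (s (n + 1) x)
  inj : ∀ n, Function.Injective (s n)
  total : ∀ n, D.carrier n = Set.range (s n)
  sub : ∀ n, D'.carrier n = Set.range (s n ∘ faceMap f.hom n)

namespace ArrowEmbedding

variable {f g : Arrow SSet.{u}} {Z : FaceSystem} {D D' G G' : Sub Z}
  (j : ArrowEmbedding f D D') (k : ArrowEmbedding g G G')

/-- The chain map of an embedding. -/
def pairMap : PairMap (allSimplices _) (imageSub f.hom) D D' :=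
  .ofSimplexMap j.s (fun n x _ i ↦ j.comm n x i)
    (fun n x _ ↦ j.total n ▸ ⟨x, rfl⟩) (fun n x hx ↦ by
      obtain ⟨y, rfl⟩ := hx
      exact j.sub n ▸ ⟨y, rfl⟩)

lemma mapH_bijective (n : ℕ) : Function.Bijective (j.pairMap.mapH n) :=
  mapH_ofSimplexMap_bijective j.s (fun n x _ i ↦ j.comm n x i) j.inj
    (fun n ↦ by rw [j.total]; exact Set.image_univ.symm)
    (fun n ↦ by rw [j.sub]; exact Set.range_comp _ _) n

/-- The homology of an embedded pair. -/
def equiv (n : ℕ) : RelH D D' n ≃ₗ[ℤ] (relHomology n).obj f :=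
  (LinearEquiv.ofBijective _ (j.mapH_bijective n)).symm.trans (relHEquiv f n)

lemma equiv_mapH (n : ℕ) (y : RelH (allSimplices _) (imageSub f.hom) n) :
    j.equiv n (j.pairMap.mapH n y) = relHEquiv f n y :=
  congrArg (relHEquiv f n) ((LinearEquiv.ofBijective _ (j.mapH_bijective n)).symm_apply_apply y)

/-- Every class of the embedded pair comes from the pair of simplicial sets. There the claim is that
two chain maps agree on simplices, which is `hφ`. -/
lemma equiv_naturality (φ : f ⟶ g) (hφ : ∀ n x, k.s n (faceMap φ.right n x) = j.s n x)
    (h : D ≤ G) (h' : D' ≤ G') (n : ℕ) (y : RelH D D' n) :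
    ((relHomology n).map φ).hom (j.equiv n y) =
      k.equiv n ((PairMap.incl h h').mapH n y) := by
  obtain ⟨y, rfl⟩ := (j.mapH_bijective n).2 y
  have e : (PairMap.incl h h').mapH n (j.pairMap.mapH n y) =
      k.pairMap.mapH n ((arrowPairMap φ).mapH n y) := by
    have : ((PairMap.incl h h').comp j.pairMap).mapH n =
        (k.pairMap.comp (arrowPairMap φ)).mapH n := by
      refine PairMap.mapH_eq_of_f_eq (fun n ↦ hom_ext fun x ↦ ?_) n
      simp [PairMap.comp, PairMap.incl, pairMap, arrowPairMap, PairMap.ofSimplexMap, hφ]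
    rw [PairMap.mapH_comp, PairMap.mapH_comp] at this
    exact LinearMap.congr_fun this y
  rw [e, equiv_mapH, equiv_mapH, relHEquiv_naturality]

end ArrowEmbedding

/-! ### The systems of tuples and of singular simplices -/

lemma succAbove_succ_succAbove {n : ℕ} {i j : Fin (n + 2)} (h : i ≤ j) (k : Fin (n + 1)) :
    j.succ.succAbove (i.succAbove k) = i.castSucc.succAbove (j.succAbove k) := by
  rw [Fin.le_def] at h
  ext
  simp only [Fin.succAbove, Fin.lt_def, apply_ite Fin.val, Fin.val_castSucc, Fin.val_succ]
  split_ifs <;> omega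

/-- The system of all tuples of elements of `V`. -/
abbrev tuples (V : Type*) : FaceSystem where
  obj n := Fin (n + 1) → V
  δ i w := w ∘ i.succAbove
  δ_δ i j w h := by
    funext k
    exact congrArg w (succAbove_succ_succAbove h k)

/-- The tuples of vertices of a common face. -/
def complexSub {V : Type u} (S : PreAbstractSimplicialComplex V) : Sub (tuples V) where
  carrier n := {w | ∃ σ ∈ S.faces, ∀ i, w i ∈ σ}
  δ_mem := by
    rintro n i w ⟨σ, hσ, hw⟩
    exact ⟨σ, hσ, fun k ↦ hw _⟩

lemma complexSub_mono {V : Type u} {S S' : PreAbstractSimplicialComplex V} (h : S ≤ S') :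
    complexSub S ≤ complexSub S' := by
  rintro n w ⟨σ, hσ, hw⟩
  exact ⟨σ, h hσ, hw⟩

/-- The simplices of a pair of complexes, as tuples of vertices. -/
def ComplexPair.embedding {V : Type u} (A : ComplexPair V) :
    ArrowEmbedding A.arrow (complexSub A.total) (complexSub A.sub) where
  s _ x := x.1
  comm _ _ _ := rfl
  inj _ _ _ h := Subtype.ext h
  total _ := Subtype.range_coe.symm
  sub _ := Subtype.range_coe.symm

lemma ComplexPair.mapH_equiv {V : Type u} {A B : ComplexPair V} (h : A ≤ B) (n : ℕ)
    (y : RelH (complexSub A.total) (complexSub A.sub) n) :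
    ComplexPair.mapH n h (A.embedding.equiv n y) = B.embedding.equiv n
      ((PairMap.incl (complexSub_mono h.1) (complexSub_mono h.2)).mapH n y) :=
  A.embedding.equiv_naturality B.embedding (ComplexPair.incl h) (fun _ _ ↦ rfl) _ _ n y

/-! ### Singular simplices of subspaces, as simplices of one ambient space -/

section Singular

variable {X : Type u} [TopologicalSpace X]

/-- The standard simplex. -/
abbrev Simp (n : ℕ) : Type := stdSimplex ℝ (Fin (n + 1))

variable (X) in
/-- The system of singular simplices. -/
abbrev singular : FaceSystem where
  obj n := C(Simp n, X)
  δ i s := s.comp ⟨stdSimplex.map i.succAbove, stdSimplex.continuous_map _⟩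
  δ_δ i j s h := by
    ext t
    simp only [ContinuousMap.comp_apply, ContinuousMap.coe_mk, stdSimplex.map_comp_apply]
    congr 2
    funext k
    exact succAbove_succ_succAbove h k

/-- The singular simplices of a subspace. -/
def singularSub (A : Set X) : Sub (singular X) where
  carrier n := Set.ofPred fun s : C(Simp n, X) ↦ ∀ t, s t ∈ A
  δ_mem := fun _ _ hs _ ↦ hs _

lemma singularSub_mono {A B : Set X} (h : A ⊆ B) : singularSub A ≤ singularSub B :=
  fun _ _ hs t ↦ h (hs t)

/-- The singular simplices of a pair of subspaces, as singular simplices of the space. -/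
def SetPair.embedding (A : SetPair X) :
    ArrowEmbedding (TopCat.toSSet.mapArrow.obj A.arrow) (singularSub A.total)
      (singularSub A.sub) where
  s n x := (⟨Subtype.val, continuous_subtype_val⟩ : C(A.total, X)).comp
    (TopCat.toSSetObjEquiv (TopCat.of A.total) (Opposite.op (SimplexCategory.mk n)) x)
  comm _ _ _ := rfl
  inj n x y h := by
    apply (TopCat.toSSetObjEquiv (TopCat.of A.total) (Opposite.op (SimplexCategory.mk n))).injective
    ext t
    exact congrArg (fun s : C(Simp n, X) ↦ s t) h
  total n := by
    refine Set.ext fun (s : C(Simp n, X)) ↦ ?_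
    constructor
    · intro (hs : ∀ t, s t ∈ _)
      refine ⟨(TopCat.toSSetObjEquiv (TopCat.of A.total) _).symm
        (⟨fun t ↦ ⟨s t, hs t⟩, by fun_prop⟩ : C(Simp n, A.total)), ?_⟩
      rfl
    · rintro ⟨x, rfl⟩ (t : Simp n)
      exact Subtype.property _
  sub n := by
    refine Set.ext fun (s : C(Simp n, X)) ↦ ?_
    constructor
    · intro (hs : ∀ t, s t ∈ _)
      refine ⟨(TopCat.toSSetObjEquiv (TopCat.of A.sub) _).symm
        (⟨fun t ↦ ⟨s t, hs t⟩, by fun_prop⟩ : C(Simp n, A.sub)), ?_⟩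
      rfl
    · rintro ⟨x, rfl⟩ (t : Simp n)
      exact (TopCat.toSSetObjEquiv (TopCat.of A.sub) (Opposite.op (SimplexCategory.mk n)) x t).2

lemma SetPair.mapH_equiv {A B : SetPair X} (h : A ≤ B) (n : ℕ)
    (y : RelH (singularSub A.total) (singularSub A.sub) n) :
    SetPair.mapH n h (A.embedding.equiv n y) = B.embedding.equiv n
      ((PairMap.incl (singularSub_mono h.1) (singularSub_mono h.2)).mapH n y) :=
  A.embedding.equiv_naturality B.embedding (TopCat.toSSet.mapArrow.map (SetPair.incl h))
    (fun _ _ ↦ rfl) _ _ n y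

end Singular

end LocalHomology
end

noncomputable section

namespace LocalHomology

open FaceSystem

/-! ### Barycentric subdivision of chains of tuples -/

section Tuples

variable {V V' : Type*}

/-- The cone over a chain of tuples. -/
def coneL (c : V) (n : ℕ) : (tuples V).Chain n →ₗ[ℤ] (tuples V).Chain (n + 1) :=
  Finsupp.lmapDomain ℤ ℤ fun w : Fin (n + 1) → V ↦ (Fin.cons c w : Fin (n + 2) → V)

lemma coneL_sx (c : V) {n : ℕ} (w : Fin (n + 1) → V) : coneL c n ((tuples V).sx w) =
    (tuples V).sx (n := n + 1) (Fin.cons c w : Fin (n + 2) → V) := by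
  rw [coneL]
  exact Finsupp.mapDomain_single

lemma tuples_δ_zero (c : V) {n : ℕ} (w : Fin (n + 1) → V) :
    (tuples V).δ (n := n) 0 (Fin.cons c w : Fin (n + 2) → V) = w := by
  funext i
  simp

lemma tuples_δ_succ (c : V) {n : ℕ} (w : Fin (n + 2) → V) (i : Fin (n + 2)) :
    (tuples V).δ i.succ (Fin.cons c w : Fin (n + 3) → V) =
      (Fin.cons c ((tuples V).δ i w) : Fin (n + 2) → V) := by
  funext k
  refine Fin.cases ?_ (fun k ↦ ?_) k <;> simp

lemma tuples_δ_one (c : V) (w : Fin 1 → V) :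
    (tuples V).δ (n := 0) 1 (Fin.cons c w : Fin 2 → V) = fun _ ↦ c := by
  funext k
  obtain rfl : k = 0 := Fin.fin_one_eq_zero k
  simp

lemma bd_coneL (c : V) (n : ℕ) (z : (tuples V).Chain (n + 1)) :
    (tuples V).bd (n + 1) (coneL c (n + 1) z) = z - coneL c n ((tuples V).bd n z) := by
  suffices h : (tuples V).bd (n + 1) ∘ₗ coneL c (n + 1) =
      LinearMap.id - coneL c n ∘ₗ (tuples V).bd n from LinearMap.congr_fun h z
  refine hom_ext fun (w : Fin (n + 2) → V) ↦ ?_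
  rw [LinearMap.comp_apply, coneL_sx, bd_sx, Fin.sum_univ_succ, LinearMap.sub_apply,
    LinearMap.comp_apply, bd_sx, map_sum, tuples_δ_zero]
  simp only [map_zsmul]
  rw [sub_eq_add_neg, ← Finset.sum_neg_distrib]
  congr 1
  · simp
  · refine Finset.sum_congr rfl fun i _ ↦ ?_
    rw [coneL_sx]
    simp [pow_succ]
    rfl

lemma bd_coneL_zero (c : V) (z : (tuples V).Chain 0) :
    (tuples V).bd 0 (coneL c 0 z) = z - (tuples V).aug z • (tuples V).sx (n := 0) fun _ ↦ c := by
  suffices h : (tuples V).bd 0 ∘ₗ coneL c 0 =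
      LinearMap.id - LinearMap.toSpanSingleton ℤ _ ((tuples V).sx (n := 0) fun _ ↦ c) ∘ₗ
        (tuples V).aug from LinearMap.congr_fun h z
  refine hom_ext fun (w : Fin 1 → V) ↦ ?_
  rw [LinearMap.comp_apply, coneL_sx, bd_sx, Fin.sum_univ_two, LinearMap.sub_apply,
    LinearMap.comp_apply, aug_sx, tuples_δ_zero, tuples_δ_one]
  simp [sub_eq_add_neg]

/-- The chain map of tuples induced by a map. -/
def mapL (g : V → V') (n : ℕ) : (tuples V).Chain n →ₗ[ℤ] (tuples V').Chain n :=
  Finsupp.lmapDomain ℤ ℤ fun w : Fin (n + 1) → V ↦ g ∘ w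

lemma mapL_sx (g : V → V') {n : ℕ} (w : Fin (n + 1) → V) :
    mapL g n ((tuples V).sx w) = (tuples V').sx (n := n) (g ∘ w) := by
  rw [mapL]
  exact Finsupp.mapDomain_single

lemma bd_mapL (g : V → V') (n : ℕ) (z : (tuples V).Chain (n + 1)) :
    (tuples V').bd n (mapL g (n + 1) z) = mapL g n ((tuples V).bd n z) := by
  suffices h : (tuples V').bd n ∘ₗ mapL g (n + 1) = mapL g n ∘ₗ (tuples V).bd n from
    LinearMap.congr_fun h z
  refine hom_ext fun (w : Fin (n + 2) → V) ↦ ?_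
  rw [LinearMap.comp_apply, mapL_sx, bd_sx, LinearMap.comp_apply, bd_sx, map_sum]
  refine Finset.sum_congr rfl fun i _ ↦ ?_
  rw [map_zsmul]
  exact congrArg _ (mapL_sx g (w ∘ i.succAbove)).symm

lemma mapL_coneL (g : V → V') (c : V) (n : ℕ) (z : (tuples V).Chain n) :
    mapL g (n + 1) (coneL c n z) = coneL (g c) n (mapL g n z) := by
  suffices h : mapL g (n + 1) ∘ₗ coneL c n = coneL (g c) n ∘ₗ mapL g n from
    LinearMap.congr_fun h z
  refine hom_ext fun (w : Fin (n + 1) → V) ↦ ?_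
  rw [LinearMap.comp_apply, coneL_sx, mapL_sx, LinearMap.comp_apply, mapL_sx, coneL_sx]
  congr 1
  funext k
  refine Fin.cases ?_ (fun k ↦ ?_) k <;> simp

variable (b : ∀ n, (Fin (n + 1) → V) → V) (b' : ∀ n, (Fin (n + 1) → V') → V')

/-- The subdivision of chains of tuples, for a given choice of barycenters. -/
def sd : ∀ n, (tuples V).Chain n →ₗ[ℤ] (tuples V).Chain n
  | 0 => LinearMap.id
  | n + 1 => Finsupp.linearCombination ℤ fun w : Fin (n + 2) → V ↦
      coneL (b (n + 1) w) n (sd n ((tuples V).bd n ((tuples V).sx w)))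

lemma sd_succ_sx {n : ℕ} (w : Fin (n + 2) → V) : sd b (n + 1) ((tuples V).sx w) =
    coneL (b (n + 1) w) n (sd b n ((tuples V).bd n ((tuples V).sx w))) := by
  rw [sd]
  exact (Finsupp.linearCombination_single _ _ _).trans (one_smul _ _)

/-- The chain homotopy between the subdivision and the identity. -/
def sdT : ∀ n, (tuples V).Chain n →ₗ[ℤ] (tuples V).Chain (n + 1)
  | 0 => 0
  | n + 1 => Finsupp.linearCombination ℤ fun w : Fin (n + 2) → V ↦
      coneL (b (n + 1) w) (n + 1)
        ((tuples V).sx w - sdT n ((tuples V).bd n ((tuples V).sx w)))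

lemma sdT_succ_sx {n : ℕ} (w : Fin (n + 2) → V) : sdT b (n + 1) ((tuples V).sx w) =
    coneL (b (n + 1) w) (n + 1)
      ((tuples V).sx w - sdT b n ((tuples V).bd n ((tuples V).sx w))) := by
  rw [sdT]
  exact (Finsupp.linearCombination_single _ _ _).trans (one_smul _ _)

/-- By the cone formula, ∂ sd w = sd ∂w - b·(∂ sd ∂w), where b· denotes the cone; the last term is
b·(sd ∂∂w) = 0 by induction. In the lowest degree the weight of ∂w plays the role of ∂∂w. -/
lemma bd_sd (n : ℕ) (z : (tuples V).Chain (n + 1)) :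
    (tuples V).bd n (sd b (n + 1) z) = sd b n ((tuples V).bd n z) := by
  induction n with
  | zero =>
    suffices h : (tuples V).bd 0 ∘ₗ sd b 1 = sd b 0 ∘ₗ (tuples V).bd 0 from
      LinearMap.congr_fun h z
    refine hom_ext fun (w : Fin 2 → V) ↦ ?_
    rw [LinearMap.comp_apply, sd_succ_sx, bd_coneL_zero, LinearMap.comp_apply]
    simp [sd, aug_bd]
  | succ n ih =>
    suffices h : (tuples V).bd (n + 1) ∘ₗ sd b (n + 2) = sd b (n + 1) ∘ₗ (tuples V).bd (n + 1) from
      LinearMap.congr_fun h z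
    refine hom_ext fun (w : Fin (n + 3) → V) ↦ ?_
    rw [LinearMap.comp_apply, sd_succ_sx, bd_coneL, LinearMap.comp_apply, ih, bd_bd]
    simp

lemma bd_sdT_zero (z : (tuples V).Chain 0) :
    (tuples V).bd 0 (sdT b 0 z) = z - sd b 0 z := by simp [sdT, sd]

lemma bd_sdT (n : ℕ) (z : (tuples V).Chain (n + 1)) :
    (tuples V).bd (n + 1) (sdT b (n + 1) z) =
      z - sd b (n + 1) z - sdT b n ((tuples V).bd n z) := by
  -- The inductive step needs the homotopy formula only on boundaries, where the term T∂ drops out.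
  -- In this form, degree 0 serves as a start like any other degree.
  have key : ∀ n, (∀ z, (tuples V).bd n (sdT b n ((tuples V).bd n z)) =
      (tuples V).bd n z - sd b n ((tuples V).bd n z)) → ∀ z,
      (tuples V).bd (n + 1) (sdT b (n + 1) z) =
      z - sd b (n + 1) z - sdT b n ((tuples V).bd n z) := by
    intro n ih z
    suffices h : (tuples V).bd (n + 1) ∘ₗ sdT b (n + 1) =
        LinearMap.id - sd b (n + 1) - sdT b n ∘ₗ (tuples V).bd n from LinearMap.congr_fun h z
    refine hom_ext fun (w : Fin (n + 2) → V) ↦ ?_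
    simp only [LinearMap.comp_apply, LinearMap.sub_apply, LinearMap.id_apply]
    rw [sdT_succ_sx, bd_coneL, map_sub, ih, sub_sub_cancel, sd_succ_sx]
    abel
  induction n with
  | zero => exact key 0 (fun z ↦ bd_sdT_zero b _) z
  | succ n ih =>
    refine key (n + 1) (fun z ↦ ?_) z
    rw [ih, bd_bd, map_zero, sub_zero]

variable {b b'}

/-- Subdivision is natural for maps that respect the choice of barycenters. Affine maps do
(`aff_bary`), which makes the subdivision of singular simplices compatible with faces. -/
lemma mapL_sd {g : V → V'} (hg : ∀ n w, g (b n w) = b' n (g ∘ w)) (n : ℕ)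
    (z : (tuples V).Chain n) : mapL g n (sd b n z) = sd b' n (mapL g n z) := by
  induction n with
  | zero => rfl
  | succ n ih =>
    suffices h : mapL g (n + 1) ∘ₗ sd b (n + 1) = sd b' (n + 1) ∘ₗ mapL g (n + 1) from
      LinearMap.congr_fun h z
    refine hom_ext fun (w : Fin (n + 2) → V) ↦ ?_
    rw [LinearMap.comp_apply, sd_succ_sx, mapL_coneL, ih, ← bd_mapL, LinearMap.comp_apply, mapL_sx,
      sd_succ_sx, hg]

lemma mapL_sdT {g : V → V'} (hg : ∀ n w, g (b n w) = b' n (g ∘ w)) (n : ℕ)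
    (z : (tuples V).Chain n) : mapL g (n + 1) (sdT b n z) = sdT b' n (mapL g n z) := by
  induction n with
  | zero => simp [sdT]
  | succ n ih =>
    suffices h : mapL g (n + 2) ∘ₗ sdT b (n + 1) = sdT b' (n + 1) ∘ₗ mapL g (n + 1) from
      LinearMap.congr_fun h z
    refine hom_ext fun (w : Fin (n + 2) → V) ↦ ?_
    rw [LinearMap.comp_apply, sdT_succ_sx, mapL_coneL, map_sub, ih, ← bd_mapL,
      LinearMap.comp_apply, mapL_sx, sdT_succ_sx, hg]

/-- The tuples of elements of a set. -/
def tuplesIn (B : Set V) : Sub (tuples V) where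
  carrier n := Set.ofPred fun w : Fin (n + 1) → V ↦ ∀ i, w i ∈ B
  δ_mem := fun _ _ hw _ ↦ hw _

/-- Subdividing only ever adds barycenters. In the mesh estimate `B` is a ball, closed under
barycenters by convexity. -/
lemma sd_mem_tuplesIn {B : Set V} (hB : ∀ n w, (∀ i, w i ∈ B) → b n w ∈ B) (n : ℕ)
    {z : (tuples V).Chain n} (hz : z ∈ (tuplesIn B).chains n) : sd b n z ∈ (tuplesIn B).chains n := by
  induction n with
  | zero => exact hz
  | succ n ih =>
    refine Sub.map_mem (fun (w : Fin (n + 2) → V) (hw : ∀ i, w i ∈ B) ↦ ?_) hz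
    rw [sd_succ_sx]
    have h := ih (Sub.bd_mem (Sub.sx_mem (A := tuplesIn B) (n := n + 1) hw))
    refine Sub.map_mem (fun (v : Fin (n + 1) → V) (hv : ∀ i, v i ∈ B) ↦ ?_) h
    rw [coneL_sx]
    refine Sub.sx_mem fun i ↦ ?_
    refine Fin.cases ?_ (fun k ↦ ?_) i
    · exact hB _ _ hw
    · exact hv k

end Tuples

/-! ### Affine simplices -/

section Affine

variable {n m k : ℕ}

/-- The affine singular simplex with given vertices. -/
def aff (w : Fin (k + 1) → Simp n) : C(Simp k, Simp n) where
  toFun t := ⟨∑ i, t i • (w i : Fin (n + 1) → ℝ),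
    (convex_stdSimplex ℝ _).sum_mem (fun i _ ↦ t.2.1 i) t.2.2 fun i _ ↦ (w i).2⟩
  continuous_toFun := by
    refine Continuous.subtype_mk (continuous_finsetSum _ fun i _ ↦ ?_) _
    exact ((continuous_apply i).comp continuous_subtype_val).smul continuous_const

lemma aff_coe (w : Fin (k + 1) → Simp n) (t : Simp k) :
    (aff w t : Fin (n + 1) → ℝ) = ∑ i, t i • (w i : Fin (n + 1) → ℝ) := rfl

lemma aff_apply (w : Fin (k + 1) → Simp n) (t : Simp k) (j : Fin (n + 1)) :
    (aff w t) j = ∑ i, t i * w i j := by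
  rw [aff_coe, Finset.sum_apply]
  rfl

/-- The vertices of the standard simplex. -/
def verts (n : ℕ) : Fin (n + 1) → Simp n := fun i ↦ stdSimplex.vertex i

lemma aff_comp_verts (w : Fin (k + 1) → Simp n) : aff w ∘ verts k = w := by
  funext i
  refine stdSimplex.ext (funext fun j ↦ ?_)
  rw [Function.comp_apply, aff_apply]
  simp [verts, Pi.single_apply]

lemma aff_verts : aff (verts n) = ContinuousMap.id _ := by
  refine ContinuousMap.ext fun t ↦ stdSimplex.ext (funext fun j ↦ ?_)
  rw [aff_apply]
  simp [verts, Pi.single_apply]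

lemma aff_comp_aff (w : Fin (k + 1) → Simp n) (v : Fin (m + 1) → Simp k) :
    (aff w).comp (aff v) = aff (aff w ∘ v) := by
  refine ContinuousMap.ext fun t ↦ stdSimplex.ext (funext fun j ↦ ?_)
  rw [ContinuousMap.comp_apply, aff_apply, aff_apply]
  simp only [aff_apply, Function.comp_apply, Finset.sum_mul, Finset.mul_sum, mul_assoc]
  exact Finset.sum_comm

lemma aff_comp_map (w : Fin (k + 1) → Simp n) (f : Fin (m + 1) → Fin (k + 1)) :
    (aff w).comp ⟨stdSimplex.map f, stdSimplex.continuous_map _⟩ = aff (w ∘ f) := by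
  refine ContinuousMap.ext fun t ↦ stdSimplex.ext (funext fun j ↦ ?_)
  rw [ContinuousMap.comp_apply, aff_apply, aff_apply]
  simp only [ContinuousMap.coe_mk, stdSimplex.map_coe, FunOnFinite.linearMap_apply_apply,
    Function.comp_apply, Finset.sum_mul]
  rw [← Finset.sum_fiberwise Finset.univ f]
  refine Finset.sum_congr rfl fun i _ ↦ Finset.sum_congr rfl fun x hx ↦ ?_
  rw [(Finset.mem_filter.1 hx).2]

/-- The barycenter of a tuple of points of the standard simplex. -/
def bary (n k : ℕ) (w : Fin (k + 1) → Simp n) : Simp n := aff w stdSimplex.barycenter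

lemma aff_bary (w : Fin (k + 1) → Simp n) (m : ℕ) (v : Fin (m + 1) → Simp k) :
    aff w (bary k m v) = bary n m (aff w ∘ v) := by
  rw [bary, bary, ← aff_comp_aff]
  rfl

/-- Affine singular simplices of the standard simplex, mapped to a space. -/
def push {X : Type u} [TopologicalSpace X] (s : C(Simp n, X)) (k : ℕ) :
    (tuples (Simp n)).Chain k →ₗ[ℤ] (singular X).Chain k :=
  Finsupp.lmapDomain ℤ ℤ fun w : Fin (k + 1) → Simp n ↦ s.comp (aff w)

section Push

variable {X : Type u} [TopologicalSpace X] (s : C(Simp n, X))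

lemma push_sx (w : Fin (k + 1) → Simp n) :
    push s k ((tuples (Simp n)).sx w) = (singular X).sx (n := k) (s.comp (aff w)) := by
  rw [push]
  exact Finsupp.mapDomain_single

lemma bd_push (k : ℕ) (z : (tuples (Simp n)).Chain (k + 1)) :
    (singular X).bd k (push s (k + 1) z) = push s k ((tuples (Simp n)).bd k z) := by
  suffices h : (singular X).bd k ∘ₗ push s (k + 1) = push s k ∘ₗ (tuples (Simp n)).bd k from
    LinearMap.congr_fun h z
  refine hom_ext fun (w : Fin (k + 2) → Simp n) ↦ ?_
  rw [LinearMap.comp_apply, push_sx, bd_sx, LinearMap.comp_apply, bd_sx, map_sum]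
  refine Finset.sum_congr rfl fun i _ ↦ ?_
  rw [map_zsmul, push_sx]
  congr 2
  change (s.comp (aff w)).comp _ = _
  rw [ContinuousMap.comp_assoc, aff_comp_map]

lemma push_comp_aff (w : Fin (k + 1) → Simp n) (z : (tuples (Simp k)).Chain m) :
    push (s.comp (aff w)) m z = push s m (mapL (aff w) m z) := by
  suffices h : push (s.comp (aff w)) m = push s m ∘ₗ mapL (aff w) m from LinearMap.congr_fun h z
  refine hom_ext fun (v : Fin (m + 1) → Simp k) ↦ ?_
  rw [push_sx, LinearMap.comp_apply, mapL_sx, push_sx, ContinuousMap.comp_assoc, aff_comp_aff]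

end Push

/-! ### Barycentric subdivision of singular chains -/

section Subdivision

variable (X : Type u) [TopologicalSpace X]

/-- The barycentric subdivision of singular chains. -/
def singSd (n : ℕ) : (singular X).Chain n →ₗ[ℤ] (singular X).Chain n :=
  Finsupp.linearCombination ℤ fun s : C(Simp n, X) ↦
    push s n (sd (bary n) n ((tuples (Simp n)).sx (verts n)))

/-- The chain homotopy between the subdivision of singular chains and the identity. -/
def singT (n : ℕ) : (singular X).Chain n →ₗ[ℤ] (singular X).Chain (n + 1) :=
  Finsupp.linearCombination ℤ fun s : C(Simp n, X) ↦
    push s (n + 1) (sdT (bary n) n ((tuples (Simp n)).sx (verts n)))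

variable {X}

lemma singSd_sx (s : C(Simp n, X)) : singSd X n ((singular X).sx (n := n) s) =
    push s n (sd (bary n) n ((tuples (Simp n)).sx (verts n))) :=
  (Finsupp.linearCombination_single _ _ _).trans (one_smul _ _)

lemma singT_sx (s : C(Simp n, X)) : singT X n ((singular X).sx (n := n) s) =
    push s (n + 1) (sdT (bary n) n ((tuples (Simp n)).sx (verts n))) :=
  (Finsupp.linearCombination_single _ _ _).trans (one_smul _ _)

/-- A piece `s ∘ aff w` can be subdivided in its own model simplex or inside that of `s`; naturality
under `aff w` makes the results agree. This reduces identities for singular chains to those for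
tuples. -/
lemma singSd_push (s : C(Simp n, X)) (z : (tuples (Simp n)).Chain k) :
    singSd X k (push s k z) = push s k (sd (bary n) k z) := by
  suffices h : singSd X k ∘ₗ push s k = push s k ∘ₗ sd (bary n) k from LinearMap.congr_fun h z
  refine hom_ext fun (w : Fin (k + 1) → Simp n) ↦ ?_
  rw [LinearMap.comp_apply, push_sx, singSd_sx, push_comp_aff, mapL_sd (aff_bary w), mapL_sx,
    aff_comp_verts, LinearMap.comp_apply]

lemma singT_push (s : C(Simp n, X)) (z : (tuples (Simp n)).Chain k) :
    singT X k (push s k z) = push s (k + 1) (sdT (bary n) k z) := by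
  suffices h : singT X k ∘ₗ push s k = push s (k + 1) ∘ₗ sdT (bary n) k from
    LinearMap.congr_fun h z
  refine hom_ext fun (w : Fin (k + 1) → Simp n) ↦ ?_
  rw [LinearMap.comp_apply, push_sx, singT_sx, push_comp_aff, mapL_sdT (aff_bary w), mapL_sx,
    aff_comp_verts, LinearMap.comp_apply]

lemma push_verts (s : C(Simp n, X)) :
    push s n ((tuples (Simp n)).sx (verts n)) = (singular X).sx (n := n) s := by
  rw [push_sx, aff_verts, ContinuousMap.comp_id]

lemma bd_singSd (n : ℕ) (z : (singular X).Chain (n + 1)) :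
    (singular X).bd n (singSd X (n + 1) z) = singSd X n ((singular X).bd n z) := by
  suffices h : (singular X).bd n ∘ₗ singSd X (n + 1) = singSd X n ∘ₗ (singular X).bd n from
    LinearMap.congr_fun h z
  refine hom_ext fun (s : C(Simp (n + 1), X)) ↦ ?_
  rw [LinearMap.comp_apply, LinearMap.comp_apply, ← push_verts, singSd_push, bd_push, bd_sd,
    bd_push, singSd_push]

lemma bd_singT_zero (z : (singular X).Chain 0) :
    (singular X).bd 0 (singT X 0 z) = z - singSd X 0 z := by
  suffices h : (singular X).bd 0 ∘ₗ singT X 0 = LinearMap.id - singSd X 0 from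
    LinearMap.congr_fun h z
  refine hom_ext fun (s : C(Simp 0, X)) ↦ ?_
  rw [LinearMap.comp_apply, LinearMap.sub_apply, ← push_verts, singSd_push, singT_push, bd_push,
    bd_sdT_zero, map_sub]
  rfl

lemma bd_singT (n : ℕ) (z : (singular X).Chain (n + 1)) :
    (singular X).bd (n + 1) (singT X (n + 1) z) =
      z - singSd X (n + 1) z - singT X n ((singular X).bd n z) := by
  suffices h : (singular X).bd (n + 1) ∘ₗ singT X (n + 1) =
      LinearMap.id - singSd X (n + 1) - singT X n ∘ₗ (singular X).bd n from
    LinearMap.congr_fun h z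
  refine hom_ext fun (s : C(Simp (n + 1), X)) ↦ ?_
  simp only [LinearMap.comp_apply, LinearMap.sub_apply, LinearMap.id_apply]
  rw [← push_verts, singSd_push, singT_push, bd_push, bd_push, bd_sdT, singT_push, map_sub,
    map_sub]

/-- A family of singular simplices that is closed under reparametrization. -/
def IsSaturated (R : Sub (singular X)) : Prop :=
  ∀ n m, ∀ s : C(Simp n, X), s ∈ R.carrier n → ∀ g : C(Simp m, Simp n), s.comp g ∈ R.carrier m

lemma push_mem {R : Sub (singular X)} (hR : IsSaturated R) {s : C(Simp n, X)}
    (hs : s ∈ R.carrier n) (z : (tuples (Simp n)).Chain k) : push s k z ∈ R.chains k := by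
  refine Sub.map_mem (A := allSimplices _) (fun (w : Fin (k + 1) → Simp n) _ ↦ ?_)
    (mem_allSimplices z)
  rw [push_sx]
  exact Sub.sx_mem (hR _ _ s hs _)

lemma singSd_mem {R : Sub (singular X)} (hR : IsSaturated R) {z : (singular X).Chain n}
    (hz : z ∈ R.chains n) : singSd X n z ∈ R.chains n :=
  Sub.map_mem (fun (s : C(Simp n, X)) hs ↦ by rw [singSd_sx]; exact push_mem hR hs _) hz

lemma singT_mem {R : Sub (singular X)} (hR : IsSaturated R) {z : (singular X).Chain n}
    (hz : z ∈ R.chains n) : singT X n z ∈ R.chains (n + 1) :=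
  Sub.map_mem (fun (s : C(Simp n, X)) hs ↦ by rw [singT_sx]; exact push_mem hR hs _) hz

lemma singSd_iterate_mem {R : Sub (singular X)} (hR : IsSaturated R) (N : ℕ)
    {z : (singular X).Chain n} (hz : z ∈ R.chains n) : (singSd X n)^[N] z ∈ R.chains n := by
  induction N with
  | zero => exact hz
  | succ N ih =>
    rw [Function.iterate_succ_apply']
    exact singSd_mem hR ih

lemma bd_singSd_iterate (N n : ℕ) (z : (singular X).Chain (n + 1)) :
    (singular X).bd n ((singSd X (n + 1))^[N] z) = (singSd X n)^[N] ((singular X).bd n z) := by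
  induction N with
  | zero => rfl
  | succ N ih => rw [Function.iterate_succ_apply', Function.iterate_succ_apply', bd_singSd, ih]

/-- The chain homotopy between the identity and an iterated subdivision. -/
def iterT (X : Type u) [TopologicalSpace X] (N n : ℕ) :
    (singular X).Chain n →ₗ[ℤ] (singular X).Chain (n + 1) :=
  ∑ i ∈ Finset.range N, singT X n ∘ₗ (singSd X n) ^ i

lemma iterT_mem {R : Sub (singular X)} (hR : IsSaturated R) (N : ℕ)
    {z : (singular X).Chain n} (hz : z ∈ R.chains n) : iterT X N n z ∈ R.chains (n + 1) := by
  rw [iterT, LinearMap.sum_apply]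
  refine sum_mem fun i _ ↦ singT_mem hR ?_
  rw [Module.End.coe_pow]
  exact singSd_iterate_mem hR i hz

lemma bd_iterT_zero (N : ℕ) (z : (singular X).Chain 0) :
    (singular X).bd 0 (iterT X N 0 z) = z - (singSd X 0)^[N] z := by
  induction N with
  | zero => simp [iterT]
  | succ N ih =>
    have : iterT X (N + 1) 0 z = iterT X N 0 z + singT X 0 ((singSd X 0)^[N] z) := by
      rw [iterT, Finset.sum_range_succ, LinearMap.add_apply, ← iterT, LinearMap.comp_apply,
        Module.End.coe_pow]
    rw [this, map_add, ih, bd_singT_zero, Function.iterate_succ_apply']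
    abel

lemma bd_iterT (N n : ℕ) (z : (singular X).Chain (n + 1)) :
    (singular X).bd (n + 1) (iterT X N (n + 1) z) =
      z - (singSd X (n + 1))^[N] z - iterT X N n ((singular X).bd n z) := by
  induction N with
  | zero => simp [iterT]
  | succ N ih =>
    have : ∀ n z, iterT X (N + 1) n z = iterT X N n z + singT X n ((singSd X n)^[N] z) := by
      intro n z
      rw [iterT, Finset.sum_range_succ, LinearMap.add_apply, ← iterT, LinearMap.comp_apply,
        Module.End.coe_pow]
    rw [this, this, map_add, ih, bd_singT, bd_singSd_iterate, Function.iterate_succ_apply']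
    abel

end Subdivision

end Affine

end LocalHomology
end

noncomputable section

namespace LocalHomology

open FaceSystem

/-- The intersection of two families of simplices. -/
def FaceSystem.Sub.inter {Y : FaceSystem} (A B : Sub Y) : Sub Y where
  carrier n := A.carrier n ∩ B.carrier n
  δ_mem i _ hx := ⟨A.δ_mem i hx.1, B.δ_mem i hx.2⟩

lemma FaceSystem.Sub.mem_inter_chains {Y : FaceSystem} {A B : Sub Y} {n : ℕ} {z : Y.Chain n} :
    z ∈ (A.inter B).chains n ↔ z ∈ A.chains n ∧ z ∈ B.chains n := by
  rw [Sub.chains, Sub.inter, Finsupp.supported_inter]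
  exact Iff.rfl

/-! ### The mesh of the barycentric subdivision -/

section Mesh

variable {n k : ℕ}

/-- The tuples of points at mutual distance at most `d`. -/
def fine (n : ℕ) (d : ℝ) : Sub (tuples (Simp n)) where
  carrier k := Set.ofPred fun w : Fin (k + 1) → Simp n ↦ ∀ i j, dist (w i) (w j) ≤ d
  δ_mem := fun _ _ hw _ _ ↦ hw _ _

lemma aff_mem_closedBall {w : Fin (k + 1) → Simp n} {c : Simp n} {R : ℝ}
    (h : ∀ i, w i ∈ Metric.closedBall c R) (t : Simp k) : aff w t ∈ Metric.closedBall c R := by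
  have := (convex_closedBall (c : Fin (n + 1) → ℝ) R).sum_mem (t := Finset.univ)
    (w := fun i ↦ t i) (z := fun i ↦ (w i : Fin (n + 1) → ℝ)) (fun i _ ↦ t.2.1 i) t.2.2
    (fun i _ ↦ h i)
  exact this

lemma dist_aff_le {w : Fin (k + 1) → Simp n} {d : ℝ} (h : ∀ i j, dist (w i) (w j) ≤ d)
    (t t' : Simp k) : dist (aff w t) (aff w t') ≤ d := by
  have h1 : ∀ j, aff w t ∈ Metric.closedBall (w j) d := fun j ↦
    aff_mem_closedBall (fun i ↦ h i j) t
  have h2 : aff w t' ∈ Metric.closedBall (aff w t) d :=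
    aff_mem_closedBall (fun j ↦ by rw [Metric.mem_closedBall']; exact h1 j) t'
  rw [dist_comm]
  exact h2

lemma dist_bary_le {w : Fin (k + 1) → Simp n} {d : ℝ} (h : ∀ i j, dist (w i) (w j) ≤ d)
    (i : Fin (k + 1)) : dist (bary n k w) (w i) ≤ k / (k + 1) * d := by
  have e : (bary n k w : Fin (n + 1) → ℝ) - (w i : Fin (n + 1) → ℝ) =
      ∑ j, ((k : ℝ) + 1)⁻¹ • ((w j : Fin (n + 1) → ℝ) - w i) := by
    rw [bary, aff_coe, ← Finset.smul_sum, Finset.sum_sub_distrib, smul_sub]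
    congr 1
    · rw [Finset.smul_sum]
      refine Finset.sum_congr rfl fun j _ ↦ ?_
      congr 1
      exact (stdSimplex.barycenter_apply j).trans (by simp)
    · rw [Finset.sum_const, Finset.card_univ, Fintype.card_fin, ← Nat.cast_smul_eq_nsmul ℝ,
        smul_smul, Nat.cast_add, Nat.cast_one, inv_mul_cancel₀ (by positivity), one_smul]
  have hd : ∀ j, ‖(w j : Fin (n + 1) → ℝ) - w i‖ ≤ d := fun j ↦ by
    rw [← dist_eq_norm]; exact h j i
  rw [Subtype.dist_eq, dist_eq_norm]
  change ‖(bary n k w : Fin (n + 1) → ℝ) - (w i : Fin (n + 1) → ℝ)‖ ≤ _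
  rw [e]
  refine (norm_sum_le _ _).trans ?_
  -- The term j = i vanishes, so that only k of the k + 1 terms contribute; this yields the factor k
  -- / (k + 1).
  rw [Fin.sum_univ_succAbove _ i]
  simp only [sub_self, smul_zero, norm_zero, zero_add, norm_smul]
  refine (Finset.sum_le_sum fun j _ ↦ mul_le_mul_of_nonneg_left (hd _) (norm_nonneg _)).trans ?_
  rw [Finset.sum_const, Finset.card_univ, Fintype.card_fin, nsmul_eq_mul, Real.norm_of_nonneg
    (by positivity), div_eq_mul_inv, mul_assoc]

/-- A simplex of the subdivision is a cone from the barycenter over a simplex of a subdivided face.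
Distances within the face are bounded by induction, those to the barycenter by `dist_bary_le`. In
degree 0 the factor is 0, and there is a single point. -/
lemma sd_mem_fine {d : ℝ} (hd : 0 ≤ d) (k : ℕ) {z : (tuples (Simp n)).Chain k}
    (hz : z ∈ (fine n d).chains k) : sd (bary n) k z ∈ (fine n (k / (k + 1) * d)).chains k := by
  induction k with
  | zero =>
    refine Sub.map_mem (fun (w : Fin 1 → Simp n) _ ↦ Sub.sx_mem fun i j ↦ ?_) hz
    obtain rfl : i = j := (Fin.fin_one_eq_zero i).trans (Fin.fin_one_eq_zero j).symm
    simp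
  | succ k ih =>
    refine Sub.map_mem (fun (w : Fin (k + 2) → Simp n) (hw : ∀ i j, dist (w i) (w j) ≤ d) ↦ ?_) hz
    rw [sd_succ_sx]
    set r : ℝ := ((k + 1 : ℕ) : ℝ) / ((k + 1 : ℕ) + 1) * d with hr
    set b := bary n (k + 1) w
    -- Two properties of the subdivided faces are kept at once: their mesh, and their containment in
    -- a ball around the barycenter b, which holds because the ball is convex and contains the
    -- vertices of w.
    have h1 : sd (bary n) k ((tuples (Simp n)).bd k ((tuples (Simp n)).sx w)) ∈
        ((fine n (k / (k + 1) * d)).inter (tuplesIn (Metric.closedBall b r))).chains k := by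
      refine Sub.mem_inter_chains.2 ⟨ih (Sub.bd_mem (Sub.sx_mem (A := fine n d) (n := k + 1) hw)),
        sd_mem_tuplesIn (fun m v hv ↦ aff_mem_closedBall hv _) k
        (Sub.bd_mem (Sub.sx_mem (A := tuplesIn (Metric.closedBall b r)) (n := k + 1)
          fun i ↦ ?_))⟩
      rw [Metric.mem_closedBall']
      exact dist_bary_le hw i
    refine Sub.map_mem (fun (v : Fin (k + 1) → Simp n) hv ↦ ?_) h1
    rw [coneL_sx]
    have hv1 : ∀ i j, dist (v i) (v j) ≤ k / (k + 1) * d := hv.1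
    have hv2 : ∀ i, v i ∈ Metric.closedBall b r := hv.2
    have hle : (k : ℝ) / (k + 1) * d ≤ r := by
      rw [hr]
      refine mul_le_mul_of_nonneg_right ?_ hd
      rw [div_le_div_iff₀ (by positivity) (by positivity)]
      push_cast
      nlinarith
    have hr0 : 0 ≤ r := by positivity
    refine Sub.sx_mem fun i j ↦ ?_
    refine Fin.cases ?_ (fun i ↦ ?_) i <;> refine Fin.cases ?_ (fun j ↦ ?_) j
    · simpa using hr0
    · simpa [dist_comm] using hv2 j
    · simpa using hv2 i
    · simpa using (hv1 i j).trans hle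

lemma sd_iterate_mem_fine {d : ℝ} (hd : 0 ≤ d) (N : ℕ) {z : (tuples (Simp n)).Chain k}
    (hz : z ∈ (fine n d).chains k) :
    (sd (bary n) k)^[N] z ∈ (fine n (((k : ℝ) / (k + 1)) ^ N * d)).chains k := by
  induction N with
  | zero => simpa using hz
  | succ N ih =>
    rw [Function.iterate_succ_apply', pow_succ', mul_assoc]
    exact sd_mem_fine (by positivity) k ih

end Mesh

/-! ### Small singular simplices -/

section Small

variable {X : Type u} [PseudoMetricSpace X] {n : ℕ}

/-- The singular simplices of diameter less than `η`, in the sense that the points of their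
images have mutual distances less than `η`. -/
def small (X : Type u) [PseudoMetricSpace X] (η : ℝ) : Sub (singular X) where
  carrier n := Set.ofPred fun s : C(Simp n, X) ↦ ∀ t t', dist (s t) (s t') < η
  δ_mem := fun _ _ hs _ _ ↦ hs _ _

lemma small_saturated (η : ℝ) : IsSaturated (small X η) := fun _ _ _ hs _ _ _ ↦ hs _ _

lemma singularSub_saturated (A : Set X) : IsSaturated (singularSub A) := fun _ _ _ hs _ _ ↦ hs _

lemma IsSaturated.inter {R R' : Sub (singular X)} (h : IsSaturated R) (h' : IsSaturated R') :
    IsSaturated (R.inter R') := fun _ _ s hs g ↦ ⟨h _ _ s hs.1 g, h' _ _ s hs.2 g⟩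

lemma singSd_iterate_push (s : C(Simp n, X)) (N k : ℕ) (z : (tuples (Simp n)).Chain k) :
    (singSd X k)^[N] (push s k z) = push s k ((sd (bary n) k)^[N] z) := by
  induction N with
  | zero => rfl
  | succ N ih => rw [Function.iterate_succ_apply', Function.iterate_succ_apply', ih, singSd_push]

/-- The mesh of the N-fold subdivision tends to 0 geometrically, and `s` is uniformly continuous on
the compact simplex. -/
lemma eventually_small_simplex {η : ℝ} (hη : 0 < η) (s : C(Simp n, X)) :
    ∃ N, (singSd X n)^[N] ((singular X).sx (n := n) s) ∈ (small X η).chains n := by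
  obtain ⟨δ, hδ, h⟩ := Metric.uniformContinuous_iff.1
    (CompactSpace.uniformContinuous_of_continuous s.continuous) η hη
  set d := Metric.diam (stdSimplex ℝ (Fin (n + 1)))
  have hlim : Tendsto (fun N : ℕ ↦ ((n : ℝ) / (n + 1)) ^ N * d) atTop (𝓝 0) := by
    rw [← zero_mul d]
    refine (tendsto_pow_atTop_nhds_zero_of_lt_one (by positivity) ?_).mul_const d
    rw [div_lt_one (by positivity)]
    linarith
  obtain ⟨N, hN⟩ := (hlim.eventually (gt_mem_nhds hδ)).exists
  refine ⟨N, ?_⟩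
  rw [← push_verts, singSd_iterate_push]
  have hv : (tuples (Simp n)).sx (verts n) ∈ (fine n d).chains n :=
    Sub.sx_mem fun i j ↦ Metric.dist_le_diam_of_mem (bounded_stdSimplex _)
      (verts n i).2 (verts n j).2
  refine Sub.map_mem (fun (w : Fin (n + 1) → Simp n) hw ↦ ?_)
    (sd_iterate_mem_fine Metric.diam_nonneg N hv)
  rw [push_sx]
  exact Sub.sx_mem fun t t' ↦ h ((dist_aff_le hw t t').trans_lt hN)

/-- Smallness persists under further subdivision, so the numbers of subdivisions needed for two
summands can be added. -/
lemma eventually_small {η : ℝ} (hη : 0 < η) (z : (singular X).Chain n) :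
    ∃ N, (singSd X n)^[N] z ∈ (small X η).chains n := by
  induction z using Finsupp.induction_linear with
  | zero => exact ⟨0, by simp⟩
  | add z w hz hw =>
    obtain ⟨N, hN⟩ := hz
    obtain ⟨M, hM⟩ := hw
    refine ⟨N + M, ?_⟩
    rw [← Module.End.coe_pow, map_add, Module.End.coe_pow]
    refine add_mem ?_ ?_
    · rw [add_comm, Function.iterate_add_apply]
      exact singSd_iterate_mem (small_saturated η) _ hN
    · rw [Function.iterate_add_apply]
      exact singSd_iterate_mem (small_saturated η) _ hM
  | single s r =>
    obtain ⟨N, hN⟩ := eventually_small_simplex hη s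
    refine ⟨N, ?_⟩
    have : Finsupp.single s r = r • (singular X).sx (n := n) s := by simp
    rw [this, ← Module.End.coe_pow, map_zsmul, Module.End.coe_pow]
    exact Submodule.smul_mem _ r hN

/-- The small singular simplices of a subspace. -/
def smallSub (η : ℝ) (A : Set X) : Sub (singular X) := (singularSub A).inter (small X η)

lemma smallSub_saturated (η : ℝ) (A : Set X) : IsSaturated (smallSub η A) :=
  (singularSub_saturated A).inter (small_saturated η)

lemma smallSub_le (η : ℝ) (A : Set X) : smallSub η A ≤ singularSub A := fun _ _ h ↦ h.1

lemma smallSub_mono (η : ℝ) {A B : Set X} (h : A ⊆ B) : smallSub η A ≤ smallSub η B :=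
  fun _ _ hs ↦ ⟨fun t ↦ h (hs.1 t), hs.2⟩

/-- Small simplices compute relative singular homology. -/
theorem smallSub_bijective {η : ℝ} (hη : 0 < η) (A A' : Set X) (n : ℕ) :
    Function.Bijective
      ((PairMap.incl (smallSub_le η A) (smallSub_le η A')).mapH n) := by
  have hA := singularSub_saturated A
  have hA' := singularSub_saturated A'
  have hsA := smallSub_saturated η A
  have hsA' := smallSub_saturated η A'
  constructor
  · rw [injective_iff_map_eq_zero]
    intro y hy
    obtain ⟨z, rfl⟩ := Submodule.Quotient.mk_surjective _ y
    rw [PairMap.mapH_mk, Submodule.Quotient.mk_eq_zero] at hy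
    rw [Submodule.Quotient.mk_eq_zero]
    obtain ⟨_, ⟨w, hw, rfl⟩, v, hv, h⟩ :=
      Submodule.mem_sup.1 (show (z : (singular X).Chain n) ∈ relBoundaries _ _ n from hy)
    obtain ⟨N, hN⟩ := eventually_small hη w
    obtain ⟨M, hM⟩ := eventually_small hη v
    have hw' : (singSd X (n + 1))^[M + N] w ∈ (smallSub η A).chains (n + 1) :=
      Sub.mem_inter_chains.2 ⟨singSd_iterate_mem hA _ hw, by
        rw [Function.iterate_add_apply]
        exact singSd_iterate_mem (small_saturated η) _ hN⟩
    have hv' : (singSd X n)^[M + N] v ∈ (smallSub η A').chains n :=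
      Sub.mem_inter_chains.2 ⟨singSd_iterate_mem hA' _ hv, by
        rw [add_comm, Function.iterate_add_apply]
        exact singSd_iterate_mem (small_saturated η) _ hM⟩
    -- The iterated subdivision of z bounds among small simplices, since w and v have become small.
    -- It differs from z by a small relative boundary, since the homotopy keeps the small chain z
    -- small.
    have hz1 : (singSd X n)^[M + N] z ∈ relBoundaries (smallSub η A) (smallSub η A') n := by
      rw [← h, ← Module.End.coe_pow, map_add, Module.End.coe_pow, ← bd_singSd_iterate]
      exact Submodule.add_mem_sup (Submodule.mem_map_of_mem hw') hv'
    have hz2 : (z : (singular X).Chain n) - (singSd X n)^[M + N] z ∈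
        relBoundaries (smallSub η A) (smallSub η A') n := by
      have hT := iterT_mem hsA (M + N) (relCycles_le _ _ _ z.2)
      obtain ⟨z, hz⟩ := z
      cases n with
      | zero =>
        rw [← bd_iterT_zero]
        exact Submodule.mem_sup_left (Submodule.mem_map_of_mem hT)
      | succ n =>
        rw [← sub_add_cancel (z - _) (iterT X (M + N) n ((singular X).bd n z)), ← bd_iterT]
        exact Submodule.add_mem_sup (Submodule.mem_map_of_mem hT) (iterT_mem hsA' _ hz.2)
    have := add_mem hz1 hz2
    rwa [add_sub_cancel] at this
  · intro y
    obtain ⟨⟨z, hz⟩, rfl⟩ := Submodule.Quotient.mk_surjective _ y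
    obtain ⟨N, hN⟩ := eventually_small hη z
    have hzA := relCycles_le _ _ _ hz
    have hNA : (singSd X n)^[N] z ∈ (smallSub η A).chains n :=
      Sub.mem_inter_chains.2 ⟨singSd_iterate_mem hA _ hzA, hN⟩
    have hT := iterT_mem hA N hzA
    have hmem : (singSd X n)^[N] z ∈ relCycles (smallSub η A) (smallSub η A') n := by
      cases n with
      | zero => exact hNA
      | succ n =>
        refine ⟨hNA, Sub.mem_inter_chains.2 ⟨?_, Sub.bd_mem hN⟩⟩
        rw [bd_singSd_iterate]
        exact singSd_iterate_mem hA' _ hz.2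
    refine ⟨Submodule.Quotient.mk ⟨_, hmem⟩, ?_⟩
    rw [PairMap.mapH_mk, eq_comm, Submodule.Quotient.eq]
    change z - (singSd X n)^[N] z ∈ relBoundaries (singularSub A) (singularSub A') n
    cases n with
    | zero =>
      rw [← bd_iterT_zero]
      exact Submodule.mem_sup_left (Submodule.mem_map_of_mem hT)
    | succ n =>
      rw [← sub_add_cancel (z - _) (iterT X N n ((singular X).bd n z)), ← bd_iterT]
      exact Submodule.add_mem_sup (Submodule.mem_map_of_mem hT) (iterT_mem hA' _ hz.2)

/-- Small simplices compute reduced singular homology. -/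
theorem smallSub_acyclic {η : ℝ} (hη : 0 < η) {A : Set X} (h : (singularSub A).Acyclic) :
    (smallSub η A).Acyclic := by
  have hA := singularSub_saturated A
  have hsA := smallSub_saturated η A
  refine ⟨?_, fun z hz hz0 ↦ ?_, fun n z hz hz0 ↦ ?_⟩
  · obtain ⟨s, hs⟩ := h.nonempty
    refine ⟨s, hs, fun t t' ↦ ?_⟩
    have : t = t' := Subsingleton.elim (α := stdSimplex ℝ (Fin 1)) t t'
    rw [this, dist_self]
    exact hη
  · obtain ⟨w, hw, rfl⟩ := h.zero z (Sub.chains_mono (smallSub_le η A) _ hz) hz0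
    obtain ⟨N, hN⟩ := eventually_small hη w
    -- The subdivided w bounds the subdivided cycle, and the homotopy, applied to the small cycle
    -- ∂w, bounds the difference from ∂w.
    refine ⟨(singSd X 1)^[N] w + iterT X N 0 ((singular X).bd 0 w), add_mem
      (Sub.mem_inter_chains.2 ⟨singSd_iterate_mem hA _ hw, hN⟩) (iterT_mem hsA _ hz), ?_⟩
    rw [map_add, bd_iterT_zero, bd_singSd_iterate]
    abel
  · obtain ⟨w, hw, rfl⟩ := h.succ n z (Sub.chains_mono (smallSub_le η A) _ hz) hz0
    obtain ⟨N, hN⟩ := eventually_small hη w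
    refine ⟨(singSd X (n + 2))^[N] w + iterT X N (n + 1) ((singular X).bd (n + 1) w), add_mem
      (Sub.mem_inter_chains.2 ⟨singSd_iterate_mem hA _ hw, hN⟩) (iterT_mem hsA _ hz), ?_⟩
    rw [map_add, bd_iterT, bd_singSd_iterate, bd_bd, map_zero]
    abel

end Small

end LocalHomology
end

noncomputable section

namespace LocalHomology

open FaceSystem

/-! ### Contractible sets -/

section Cone

variable {n : ℕ}

lemma simp_map_apply {m : ℕ} {f : Fin (n + 1) → Fin (m + 1)} (hf : Function.Injective f)
    (t : Simp n) (i : Fin (n + 1)) : stdSimplex.map f t (f i) = t i := by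
  rw [stdSimplex.map_coe, FunOnFinite.linearMap_apply_apply]
  refine (Finset.sum_congr ?_ fun _ _ ↦ rfl).trans (Finset.sum_singleton (fun i ↦ t i) i)
  ext j
  simp [hf.eq_iff]

lemma simp_map_apply_eq_zero {m : ℕ} {f : Fin (n + 1) → Fin (m + 1)} (t : Simp n)
    {j : Fin (m + 1)} (hj : ∀ i, f i ≠ j) : stdSimplex.map f t j = 0 := by
  rw [stdSimplex.map_coe, FunOnFinite.linearMap_apply_apply]
  refine Finset.sum_eq_zero fun i hi ↦ ?_
  exact absurd (Finset.mem_filter.1 hi).2 (hj i)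

/-- The standard simplex as a quotient of a cylinder on its face opposite to the vertex `0`. -/
def cylinder (n : ℕ) : C(Simp n × Icc (0 : ℝ) 1, Simp (n + 1)) where
  toFun q := ⟨Fin.cons (1 - (q.2 : ℝ)) fun i ↦ (q.2 : ℝ) * q.1 i, by
    refine ⟨fun i ↦ ?_, ?_⟩
    · refine Fin.cases ?_ (fun i ↦ ?_) i
      · simpa using q.2.2.2
      · exact mul_nonneg q.2.2.1 (q.1.2.1 i)
    · rw [Fin.sum_univ_succ]
      simp only [Fin.cons_zero, Fin.cons_succ]
      rw [← Finset.mul_sum, stdSimplex.sum_eq_one]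
      ring⟩
  continuous_toFun := by
    refine Continuous.subtype_mk (continuous_pi fun i ↦ ?_) _
    refine Fin.cases ?_ (fun i ↦ ?_) i
    · simp only [Fin.cons_zero]
      fun_prop
    · simp only [Fin.cons_succ]
      exact (continuous_subtype_val.comp continuous_snd).mul
        ((continuous_apply i).comp (continuous_subtype_val.comp continuous_fst))

lemma cylinder_zero (t : Simp n) (u : Icc (0 : ℝ) 1) : cylinder n (t, u) 0 = 1 - u := rfl

lemma cylinder_succ (t : Simp n) (u : Icc (0 : ℝ) 1) (i : Fin (n + 1)) :
    cylinder n (t, u) i.succ = u * t i := rfl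

lemma cylinder_surjective (n : ℕ) : Function.Surjective (cylinder n) := by
  intro τ
  have hsum : τ 0 + ∑ i : Fin (n + 1), τ i.succ = 1 := by
    rw [← Fin.sum_univ_succ]
    exact stdSimplex.sum_eq_one τ
  have hnn : ∀ i, 0 ≤ τ i := fun i ↦ stdSimplex.zero_le τ i
  by_cases h : τ 0 = 1
  · refine ⟨(Classical.arbitrary _, 0), stdSimplex.ext (funext fun j ↦ ?_)⟩
    have h0 : ∑ i : Fin (n + 1), τ i.succ = 0 := by linarith
    refine Fin.cases ?_ (fun i ↦ ?_) j
    · simp [cylinder_zero, h]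
    · rw [(Finset.sum_eq_zero_iff_of_nonneg fun i _ ↦ hnn i.succ).1 h0 i (Finset.mem_univ i)]
      simp [cylinder_succ]
  · have hle : τ 0 ≤ 1 := stdSimplex.le_one τ 0
    have hpos : 0 < 1 - τ 0 := by
      rcases hle.lt_or_eq with h' | h'
      · linarith
      · exact absurd h' h
    refine ⟨(⟨fun i ↦ τ i.succ / (1 - τ 0), fun i ↦ div_nonneg (hnn _) hpos.le, ?_⟩,
      ⟨1 - τ 0, hpos.le, by linarith [hnn 0]⟩), stdSimplex.ext (funext fun j ↦ ?_)⟩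
    · rw [← Finset.sum_div, div_eq_one_iff_eq hpos.ne']
      linarith
    · refine Fin.cases ?_ (fun i ↦ ?_) j
      · simp [cylinder_zero]
      · rw [cylinder_succ]
        exact mul_div_cancel₀ _ hpos.ne'

/-- A continuous surjection from a compact space to a Hausdorff space is a quotient map, so that a
contraction of a singular simplex descends from the cylinder to a singular simplex of one dimension
more. -/
lemma isQuotientMap_cylinder (n : ℕ) : IsQuotientMap (cylinder n) :=
  IsQuotientMap.of_surjective_continuous (cylinder_surjective n) (cylinder n).continuous

lemma cylinder_map_zero (t : Simp n) : stdSimplex.map (Fin.succAbove 0) t = cylinder n (t, 1) := by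
  refine stdSimplex.ext (funext fun j ↦ ?_)
  refine Fin.cases ?_ (fun i ↦ ?_) j
  · rw [simp_map_apply_eq_zero _ fun i ↦ Fin.succAbove_ne 0 i, cylinder_zero]
    simp
  · rw [cylinder_succ]
    have := simp_map_apply (Fin.succAbove_right_injective (p := (0 : Fin (n + 2)))) t i
    rw [Fin.succAbove_zero] at this ⊢
    rw [this]
    simp

lemma cylinder_map_succ (i : Fin (n + 2)) (t : Simp n) (u : Icc (0 : ℝ) 1) :
    stdSimplex.map i.succ.succAbove (cylinder n (t, u)) =
      cylinder (n + 1) (stdSimplex.map i.succAbove t, u) := by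
  refine stdSimplex.ext (funext fun j ↦ ?_)
  have hinj := Fin.succAbove_right_injective (p := i.succ)
  refine Fin.cases ?_ (fun k ↦ ?_) j
  · have := simp_map_apply hinj (cylinder n (t, u)) 0
    rw [Fin.succ_succAbove_zero] at this
    rw [this, cylinder_zero, cylinder_zero]
  · rw [cylinder_succ]
    rcases Fin.eq_self_or_eq_succAbove i k with rfl | ⟨l, rfl⟩
    · rw [simp_map_apply_eq_zero _ fun i ↦ Fin.succAbove_ne _ i,
        simp_map_apply_eq_zero _ fun i ↦ Fin.succAbove_ne _ i, mul_zero]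
    · have := simp_map_apply hinj (cylinder n (t, u)) l.succ
      rw [Fin.succ_succAbove_succ] at this
      rw [this, cylinder_succ, simp_map_apply Fin.succAbove_right_injective]

lemma cylinder_map_one (t : Simp 0) (t' : Simp 0) :
    stdSimplex.map (Fin.succAbove (1 : Fin 2)) t = cylinder 0 (t', 0) := by
  refine stdSimplex.ext (funext fun j ↦ ?_)
  have hinj := Fin.succAbove_right_injective (p := (1 : Fin 2))
  refine Fin.cases ?_ (fun k ↦ ?_) j
  · have := simp_map_apply hinj t 0
    rw [Fin.one_succAbove_zero] at this
    rw [this, cylinder_zero, stdSimplex.eq_one_of_unique (X := Fin 1)]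
    simp
  · obtain rfl : k = 0 := Fin.fin_one_eq_zero k
    rw [cylinder_succ]
    refine (simp_map_apply_eq_zero t fun i ↦ Fin.succAbove_ne (1 : Fin 2) i).trans ?_
    simp

variable {X : Type u} [TopologicalSpace X]

/-- A set that contracts to one of its points has no reduced singular homology. -/
theorem acyclic_of_contraction {U : Set X} {z : X} (hz : z ∈ U) (H : X → ℝ → X)
    (hH : ContinuousOn (fun q : X × ℝ ↦ H q.1 q.2) (U ×ˢ Icc 0 1))
    (hU : ∀ y ∈ U, ∀ u ∈ Icc (0 : ℝ) 1, H y u ∈ U) (h0 : ∀ y ∈ U, H y 0 = z)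
    (h1 : ∀ y ∈ U, H y 1 = y) : (singularSub U).Acyclic := by
  have key : ∀ n, ∀ s : C(Simp n, X), ∃ c : C(Simp (n + 1), X), (∀ t, s t ∈ U) →
      ∀ t (u : Icc (0 : ℝ) 1), c (cylinder n (t, u)) = H (s t) u := by
    intro n s
    by_cases hs : ∀ t, s t ∈ U
    · let g : C(Simp n × Icc (0 : ℝ) 1, X) := ⟨fun q ↦ H (s q.1) q.2, by
        refine hH.comp_continuous (f := fun q : Simp n × Icc (0 : ℝ) 1 ↦ (s q.1, (q.2 : ℝ)))
          (by fun_prop) fun q ↦ ⟨hs _, q.2.2⟩⟩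
      -- The cylinder map identifies distinct points only at u = 0, where the contraction is
      -- constant with value z.
      have hg : Function.FactorsThrough g (cylinder n) := by
        rintro ⟨t, u⟩ ⟨t', u'⟩ h
        have hu : u = u' := by
          have := DFunLike.congr_fun h 0
          rw [cylinder_zero, cylinder_zero] at this
          exact Subtype.ext (by linarith)
        subst hu
        change H (s t) u = H (s t') u
        by_cases hu : (u : ℝ) = 0
        · rw [hu, h0 _ (hs _), h0 _ (hs _)]
        · have ht : t = t' := by
            refine stdSimplex.ext (funext fun i ↦ ?_)
            have := DFunLike.congr_fun h i.succ
            rw [cylinder_succ, cylinder_succ] at this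
            exact mul_left_cancel₀ hu this
          rw [ht]
      refine ⟨(isQuotientMap_cylinder n).lift g hg, fun _ t u ↦ ?_⟩
      exact DFunLike.congr_fun ((isQuotientMap_cylinder n).lift_comp g hg) (t, u)
    · exact ⟨ContinuousMap.const _ z, fun h ↦ absurd h hs⟩
  choose cone hcone using key
  refine Sub.acyclic_of_cone (A := singularSub U) (ContinuousMap.const (Simp 0) z) cone
    (fun _ ↦ hz) (fun n s (hs : ∀ t, s t ∈ U) τ ↦ ?_) (fun n s (hs : ∀ t, s t ∈ U) ↦ ?_)
    (fun s (hs : ∀ t, s t ∈ U) ↦ ?_) (fun n s (hs : ∀ t, s t ∈ U) i ↦ ?_)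
  · obtain ⟨⟨t, u⟩, rfl⟩ := cylinder_surjective n τ
    rw [hcone n s hs]
    exact hU _ (hs t) _ u.2
  · refine ContinuousMap.ext fun t ↦ ?_
    change cone n s (stdSimplex.map (Fin.succAbove 0) t) = s t
    rw [cylinder_map_zero, hcone n s hs]
    exact h1 _ (hs t)
  · refine ContinuousMap.ext fun t ↦ ?_
    change cone 0 s (stdSimplex.map (Fin.succAbove 1) t) = z
    rw [cylinder_map_one t t, hcone 0 s hs]
    exact h0 _ (hs t)
  · refine ContinuousMap.ext fun τ ↦ ?_
    obtain ⟨⟨t, u⟩, rfl⟩ := cylinder_surjective n τ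
    change cone (n + 1) s (stdSimplex.map i.succ.succAbove (cylinder n (t, u))) = _
    rw [cylinder_map_succ, hcone _ s hs]
    exact (hcone n ((singular X).δ i s) (fun t ↦ hs _) t u).symm

end Cone

/-! ### Strongly convex balls -/

section Convex

variable {X : Type u} [MetricSpace X]

/-- A closed ball of radius less than the convexity radius is strongly convex. -/
lemma stronglyConvex_closedBall {v : X} {a : ℝ} (h : (a : EReal) < convRadius v) :
    StronglyConvex (Metric.closedBall v a) := by
  obtain ⟨_, ⟨δ, ⟨-, hδ⟩, rfl⟩, haδ⟩ := lt_sSup_iff.1 h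
  rw [EReal.coe_lt_coe_iff] at haδ
  obtain ⟨Γ, hΓ, hc⟩ := hδ δ le_rfl
  have hsub : Metric.closedBall v a ⊆ Metric.ball v δ := Metric.closedBall_subset_ball haδ
  refine ⟨Γ, fun x hx y hy ↦ ⟨(hΓ x (hsub hx) y (hsub hy)).1, fun t ht ↦ ?_,
    (hΓ x (hsub hx) y (hsub hy)).2.2⟩, hc.mono
    (prod_mono hsub (prod_mono hsub Subset.rfl))⟩
  rw [Metric.mem_closedBall]
  -- The closed ball is the intersection of the open balls of radius r > a. For r ≤ δ such a ball is
  -- strongly convex, and its path is the one of the δ-ball, by uniqueness.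
  refine le_of_forall_gt_imp_ge_of_dense fun r hr ↦ ?_
  rcases le_total δ r with hr' | hr'
  · exact ((hΓ x (hsub hx) y (hsub hy)).2.1 t ht).le.trans hr'
  · obtain ⟨Γ', hΓ', -⟩ := hδ r hr'
    have hsub' : Metric.closedBall v a ⊆ Metric.ball v r := Metric.closedBall_subset_ball hr
    have h' := hΓ' x (hsub' hx) y (hsub' hy)
    rw [h'.2.2 _ (hΓ x (hsub hx) y (hsub hy)).1 ht]
    exact (h'.2.1 t ht).le

/-- The union of finitely many strongly convex closed sets with a common point is acyclic. -/
lemma acyclic_biUnion {σ : Set X} (hσ : σ.Finite) {D : X → Set X} (hne : σ.Nonempty)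
    (hcl : ∀ v ∈ σ, IsClosed (D v)) (hD : ∀ v ∈ σ, StronglyConvex (D v)) {z : X}
    (hz : ∀ v ∈ σ, z ∈ D v) : (singularSub (⋃ v ∈ σ, D v)).Acyclic := by
  have hD' : ∀ v : σ, StronglyConvex (D v) := fun v ↦ hD v v.2
  choose Γ hΓ hc using hD'
  have hex : ∀ y, ∃ v : σ, y ∈ (⋃ v ∈ σ, D v) → y ∈ D v := by
    intro y
    by_cases hy : y ∈ ⋃ v ∈ σ, D v
    · obtain ⟨v, hv, h⟩ := mem_iUnion₂.1 hy
      exact ⟨⟨v, hv⟩, fun _ ↦ h⟩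
    · exact ⟨⟨hne.some, hne.some_mem⟩, fun h ↦ absurd h hy⟩
  choose c hcy using hex
  -- Shortest paths are unique in the whole space, so the path from z to y does not depend on the
  -- chosen set that contains y. The contractions of the sets therefore agree on overlaps and paste
  -- along the finite closed cover.
  have heq : ∀ v : σ, ∀ y ∈ D v, EqOn (Γ (c y) z y) (Γ v z y) (Icc 0 1) := by
    intro v y hy
    have hy' := hcy y (mem_biUnion v.2 hy)
    exact (hΓ v z (hz v v.2) y hy).2.2 _ (hΓ (c y) z (hz _ (c y).2) y hy').1
  have hpath : ∀ y ∈ ⋃ v ∈ σ, D v, IsShortestPath (Γ (c y) z y) z y := fun y hy ↦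
    (hΓ (c y) z (hz _ (c y).2) y (hcy y hy)).1
  refine acyclic_of_contraction (z := z) (mem_biUnion hne.some_mem (hz _ hne.some_mem))
    (fun y t ↦ Γ (c y) z y t) ?_ (fun y hy t ht ↦ ?_) (fun y hy ↦ (hpath y hy).1)
    (fun y hy ↦ (hpath y hy).2.1)
  · have : (⋃ v ∈ σ, D v) ×ˢ Icc (0 : ℝ) 1 = ⋃ v : σ, D v ×ˢ Icc (0 : ℝ) 1 := by
      ext ⟨y, t⟩
      simp only [mem_prod, mem_iUnion, Subtype.exists]
      tauto
    rw [this]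
    have := hσ.to_subtype
    refine (locallyFinite_of_finite _).continuousOn_iUnion (fun v ↦ (hcl v v.2).prod isClosed_Icc)
      fun v ↦ ?_
    have h1 : ContinuousOn (fun q : X × ℝ ↦ Γ v z q.1 q.2) (D v ×ˢ Icc (0 : ℝ) 1) := by
      refine (hc v).comp (f := fun q : X × ℝ ↦ (z, q.1, q.2)) (by fun_prop) fun q hq ↦ ?_
      exact ⟨hz v v.2, hq.1, hq.2⟩
    exact h1.congr fun q hq ↦ heq v q.1 hq.1 hq.2
  · exact mem_biUnion (c y).2 ((hΓ (c y) z (hz _ (c y).2) y (hcy y hy)).2.1 t ht)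

/-- A nonempty intersection of strongly convex sets is acyclic. -/
lemma acyclic_biInter {σ : Set X} {D : X → Set X} (hne : σ.Nonempty)
    (hD : ∀ v ∈ σ, StronglyConvex (D v)) (hz : (⋂ v ∈ σ, D v).Nonempty) :
    (singularSub (⋂ v ∈ σ, D v)).Acyclic := by
  obtain ⟨z, hz⟩ := hz
  obtain ⟨v, hv⟩ := hne
  obtain ⟨Γ, hΓ, hc⟩ := hD v hv
  have hsub : (⋂ v ∈ σ, D v) ⊆ D v := biInter_subset_of_mem hv
  have hzv := hsub hz
  refine acyclic_of_contraction hz (fun y t ↦ Γ z y t) ?_ (fun y hy t ht ↦ ?_)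
    (fun y hy ↦ (hΓ z hzv y (hsub hy)).1.1) (fun y hy ↦ (hΓ z hzv y (hsub hy)).1.2.1)
  · refine hc.comp (f := fun q : X × ℝ ↦ (z, q.1, q.2)) (by fun_prop) fun q hq ↦ ?_
    exact ⟨hzv, hsub hq.1, hq.2⟩
  · refine mem_iInter₂.2 fun w hw ↦ ?_
    obtain ⟨Γ', hΓ', -⟩ := hD w hw
    have h' := hΓ' z (mem_iInter₂.1 hz w hw) y (mem_iInter₂.1 hy w hw)
    change Γ z y t ∈ D w
    rw [h'.2.2 _ (hΓ z hzv y (hsub hy)).1 ht]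
    exact h'.2.1 t ht

end Convex

/-! ### Vietoris–Rips and Čech complexes -/

section Jung

variable {E : Type*} [NormedAddCommGroup E] [InnerProductSpace ℝ E] [FiniteDimensional ℝ E]

/-- A finite set of diameter at most `2 a` in a Euclidean space lies in a ball of radius `√2 a`. -/
lemma exists_dist_le_sqrt_two_mul {σ : Finset E} (hσ : σ.Nonempty) {a : ℝ}
    (h : ∀ u ∈ σ, ∀ v ∈ σ, dist u v ≤ 2 * a) : ∃ c, ∀ u ∈ σ, dist u c ≤ √2 * a := by
  have ha : 0 ≤ a := by
    obtain ⟨u, hu⟩ := hσ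
    have := h u hu u hu
    rw [dist_self] at this
    linarith
  let f : E → ℝ := fun c ↦ σ.sup' hσ fun u ↦ dist u c
  have hf : Continuous f := Continuous.finset_sup'_apply hσ fun u _ ↦ by fun_prop
  -- The center is a minimum of the largest distance to σ; it exists because this function is
  -- proper.
  have hlim : Tendsto f (cocompact E) atTop := by
    obtain ⟨u, hu⟩ := hσ
    refine tendsto_atTop_mono (fun c ↦ ?_) (tendsto_dist_left_cocompact_atTop u)
    exact Finset.le_sup' (fun u ↦ dist u c) hu
  obtain ⟨c, hc⟩ := hf.exists_forall_le hlim
  obtain ⟨w, hw, hwc⟩ := Finset.exists_mem_eq_sup' hσ fun u ↦ dist u c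
  have hwf : f c = dist w c := hwc
  have hle : ∀ u ∈ σ, dist u c ≤ dist w c := fun u hu ↦ hwf ▸ Finset.le_sup' (fun u ↦ dist u c) hu
  set r := dist w c with hr
  have hr0 : 0 ≤ r := dist_nonneg
  suffices hra : r ^ 2 ≤ 2 * a ^ 2 by
    refine ⟨c, fun u hu ↦ (hle u hu).trans ?_⟩
    rw [← Real.sqrt_sq ha, ← Real.sqrt_mul (by norm_num)]
    exact Real.le_sqrt_of_sq_le hra
  by_contra! hra
  have hr2 : 0 < r ^ 2 := lt_of_le_of_lt (by positivity) hra
  -- Moving the center by the fraction t towards a farthest point w brings all squared distances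
  -- below r² - 2t(r² - 2a²) + t²r², by the law of cosines and |u - w| ≤ 2a. This t minimizes the
  -- bound, making it r² - t(r² - 2a²) < r², against minimality of the center.
  set t : ℝ := (r ^ 2 - 2 * a ^ 2) / r ^ 2 with ht
  have htr : t * r ^ 2 = r ^ 2 - 2 * a ^ 2 := div_mul_cancel₀ _ hr2.ne'
  have ht0 : 0 < t := div_pos (by linarith) hr2
  have ht1 : t ≤ 1 := by
    rw [ht, div_le_one hr2]
    nlinarith
  obtain ⟨u, hu, huc⟩ := Finset.exists_mem_eq_sup' hσ fun u ↦ dist u (c + t • (w - c))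
  have hmin : r ≤ dist u (c + t • (w - c)) := by
    rw [← hwf, ← huc]
    exact hc _
  have hexp : dist u (c + t • (w - c)) ^ 2 =
      dist u c ^ 2 - 2 * t * inner ℝ (u - c) (w - c) + t ^ 2 * r ^ 2 := by
    rw [hr, dist_eq_norm, dist_eq_norm, dist_eq_norm, ← sub_sub, norm_sub_sq_real, norm_smul,
      inner_smul_right, mul_pow, Real.norm_eq_abs, sq_abs]
    ring
  have hin : dist u w ^ 2 = dist u c ^ 2 - 2 * inner ℝ (u - c) (w - c) + r ^ 2 := by
    rw [hr, dist_eq_norm, dist_eq_norm, dist_eq_norm, ← norm_sub_sq_real]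
    congr 2
    abel
  have huw : dist u w ^ 2 ≤ 4 * a ^ 2 := by
    have := h u hu w hw
    have h0 : 0 ≤ dist u w := dist_nonneg
    nlinarith
  have hd : dist u c ^ 2 ≤ r ^ 2 := pow_le_pow_left₀ dist_nonneg (hle u hu) 2
  have hge : r ^ 2 ≤ dist u (c + t • (w - c)) ^ 2 := pow_le_pow_left₀ hr0 hmin 2
  have h1 : (1 - t) * dist u c ^ 2 ≤ (1 - t) * r ^ 2 :=
    mul_le_mul_of_nonneg_left hd (by linarith)
  have h2 : 2 * t * inner ℝ (u - c) (w - c) ≥ t * (dist u c ^ 2 + r ^ 2 - 4 * a ^ 2) := by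
    nlinarith
  have h3 : t ^ 2 * r ^ 2 = t * (r ^ 2 - 2 * a ^ 2) := by rw [← htr]; ring
  have h4 : 0 < t * (r ^ 2 - 2 * a ^ 2) := mul_pos ht0 (by linarith)
  nlinarith

end Jung

/-! ### Inclusions between Čech and Vietoris–Rips complexes -/

section Complexes

variable {X : Type u} [MetricSpace X]

lemma cech_mono {a a' : ℝ} {Q Q' : Set X} (ha : a ≤ a') (hQ : Q ⊆ Q') : cech a Q ≤ cech a' Q' := by
  rintro σ ⟨h1, h2, y, hy⟩
  refine ⟨h1, h2.trans hQ, y, ?_⟩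
  simp only [mem_iInter] at hy ⊢
  exact fun q hq ↦ Metric.closedBall_subset_closedBall ha (hy q hq)

lemma rips_mono {a a' : ℝ} {Q Q' : Set X} (ha : a ≤ a') (hQ : Q ⊆ Q') : rips a Q ≤ rips a' Q' :=
  fun _ ⟨h1, h2, h3⟩ ↦ ⟨h1, h2.trans hQ, fun u hu v hv huv ↦ cech_mono ha hQ (h3 u hu v hv huv)⟩

lemma cech_le_rips (a : ℝ) (Q : Set X) : cech a Q ≤ rips a Q := by
  classical
  intro σ hσ
  refine ⟨hσ.1, hσ.2.1, fun u hu v hv _ ↦ ?_⟩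
  exact (cech a Q).isRelLowerSet_faces hσ |>.2
    (show ({u, v} : Finset X) ⊆ σ by simp [Finset.insert_subset_iff, hu, hv]) (by simp)

lemma dist_le_of_mem_rips {a : ℝ} (ha : 0 ≤ a) {Q : Set X} {σ : Finset X}
    (hσ : σ ∈ (rips a Q).faces) {u v : X} (hu : u ∈ σ) (hv : v ∈ σ) : dist u v ≤ 2 * a := by
  by_cases huv : u = v
  · rw [huv, dist_self]
    positivity
  · obtain ⟨-, -, y, hy⟩ := hσ.2.2 u hu v hv huv
    simp only [mem_iInter] at hy
    have h1 : dist y u ≤ a := hy u (by simp)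
    have h2 : dist y v ≤ a := hy v (by simp)
    calc dist u v ≤ dist y u + dist y v := dist_triangle_left _ _ _
      _ ≤ 2 * a := by linarith

/-- Vietoris–Rips complexes are contained in Čech complexes at a larger scale. -/
lemma rips_le_cech {a : ℝ} (ha : 0 ≤ a) (Q : Set X) : rips a Q ≤ cech (ripsConst X * a) Q := by
  intro σ hσ
  refine ⟨hσ.1, hσ.2.1, ?_⟩
  rw [ripsConst]
  split_ifs with hE
  · obtain ⟨n, ⟨e⟩⟩ := hE
    classical
    obtain ⟨c, hc⟩ := exists_dist_le_sqrt_two_mul (σ := σ.image e) (a := a)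
      (hσ.1.image e) (by
        simp only [Finset.forall_mem_image, e.dist_eq]
        exact fun u hu v hv ↦ dist_le_of_mem_rips ha hσ hu hv)
    refine ⟨e.symm c, mem_iInter₂.2 fun u hu ↦ ?_⟩
    rw [Metric.mem_closedBall', ← e.dist_eq, e.apply_symm_apply]
    exact hc _ (Finset.mem_image_of_mem e hu)
  -- In a general space any vertex is within 2a of all the others and serves as the common point.
  · obtain ⟨v, hv⟩ := hσ.1
    exact ⟨v, mem_iInter₂.2 fun u hu ↦ dist_le_of_mem_rips ha hσ hv hu⟩

lemma one_le_ripsConst : 1 ≤ ripsConst X := by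
  rw [ripsConst]
  split_ifs
  · exact Real.one_le_sqrt.2 (by norm_num)
  · norm_num

end Complexes

end LocalHomology
end

noncomputable section

namespace LocalHomology

open FaceSystem

/-! ### Augmented and carried maps -/

section Aux

variable {Y Z W : FaceSystem}

lemma isAugmented_ofSimplexMap (A : Sub Y) (s : ∀ n, Y.obj n → Z.obj n) :
    IsAugmented A fun n ↦ Finsupp.lmapDomain ℤ ℤ (s n) :=
  .of_sx fun x _ ↦ by
    have : Finsupp.lmapDomain ℤ ℤ (s 0) (Y.sx x) = Z.sx (s 0 x) := by simp
    rw [this, aug_sx]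

lemma isAugmented_incl {A A' D D' : Sub Y} (h : A ≤ D) (h' : A' ≤ D') :
    IsAugmented A (PairMap.incl h h').f := fun _ _ ↦ rfl

lemma isAugmented_comp {A A' : Sub Y} {D D' : Sub Z} {G G' : Sub W} {φ : PairMap A A' D D'}
    (hφ : IsAugmented A φ.f) {ψ : PairMap D D' G G'} (hψ : IsAugmented D ψ.f) :
    IsAugmented A (ψ.comp φ).f := fun z hz ↦ by
  change W.aug (ψ.f 0 (φ.f 0 z)) = _
  rw [hψ _ (φ.map_total hz), hφ z hz]

lemma tuplesIn_acyclic {V : Type*} {B : Set V} (hB : B.Nonempty) : (tuplesIn B).Acyclic := by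
  obtain ⟨c, hc⟩ := hB
  refine Sub.acyclic_of_cone (fun _ ↦ c) (fun n (w : Fin (n + 1) → V) ↦
    (Fin.cons c w : Fin (n + 2) → V)) (fun _ ↦ hc) (fun n w (hw : ∀ i, w i ∈ B) i ↦ ?_)
    (fun n w _ ↦ tuples_δ_zero c w) (fun w _ ↦ tuples_δ_one c w)
    (fun n w _ i ↦ tuples_δ_succ c w i)
  refine Fin.cases ?_ (fun i ↦ ?_) i
  · exact hc
  · exact hw i

end Aux

/-! ### Flags of simplices -/

section Flags

variable {V : Type u}

/-- The decreasing sequences of faces of a complex. -/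
def flagSub (S : PreAbstractSimplicialComplex V) : Sub (tuples (Finset V)) where
  carrier n := Set.ofPred fun f : Fin (n + 1) → Finset V ↦ Antitone f ∧ ∀ i, f i ∈ S.faces
  δ_mem := fun i _ hf ↦ ⟨hf.1.comp_monotone (Fin.strictMono_succAbove i).monotone, fun _ ↦ hf.2 _⟩

/-- The decreasing sequences of nonempty subsets of a finite set. -/
def flagsIn (σ : Finset V) : Sub (tuples (Finset V)) where
  carrier n := Set.ofPred fun f : Fin (n + 1) → Finset V ↦
    Antitone f ∧ ∀ i, (f i).Nonempty ∧ f i ⊆ σ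
  δ_mem := fun i _ hf ↦ ⟨hf.1.comp_monotone (Fin.strictMono_succAbove i).monotone, fun _ ↦ hf.2 _⟩

/-- As the greatest member, σ can be put in front of every decreasing sequence and is the apex of a
cone. -/
lemma flagsIn_acyclic {σ : Finset V} (hσ : σ.Nonempty) : (flagsIn σ).Acyclic := by
  refine Sub.acyclic_of_cone (fun _ ↦ σ) (fun n (w : Fin (n + 1) → Finset V) ↦
    (Fin.cons σ w : Fin (n + 2) → Finset V)) ⟨antitone_const, fun _ ↦ ⟨hσ, Finset.Subset.refl _⟩⟩
    (fun n w hw ↦ ⟨?_, fun i ↦ ?_⟩)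
    (fun n w _ ↦ tuples_δ_zero σ w) (fun w _ ↦ tuples_δ_one σ w)
    (fun n w _ i ↦ tuples_δ_succ σ w i)
  · intro i
    refine Fin.cases (fun j _ ↦ ?_) (fun i j hij ↦ ?_) i
    · refine Fin.cases ?_ (fun j ↦ ?_) j
      · exact le_rfl
      · exact (hw.2 j).2
    · obtain ⟨j, rfl⟩ := Fin.exists_succ_eq.2 (Fin.ne_zero_of_lt ((Fin.succ_pos i).trans_le hij))
      exact hw.1 (Fin.succ_le_succ_iff.1 hij)
  · refine Fin.cases ?_ (fun i ↦ ?_) i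
    · exact ⟨hσ, Finset.Subset.refl _⟩
    · exact hw.2 i

open Classical in
/-- The set of vertices of a tuple. -/
def support {n : ℕ} (w : Fin (n + 1) → V) : Finset V := Finset.univ.image w

lemma mem_support {n : ℕ} {w : Fin (n + 1) → V} {v : V} : v ∈ support w ↔ ∃ i, w i = v := by
  simp [support]

lemma support_nonempty {n : ℕ} (w : Fin (n + 1) → V) : (support w).Nonempty :=
  ⟨w 0, mem_support.2 ⟨0, rfl⟩⟩

lemma support_subset {n m : ℕ} (w : Fin (n + 1) → V) (f : Fin (m + 1) → Fin (n + 1)) :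
    support (w ∘ f) ⊆ support w := fun v hv ↦ by
  obtain ⟨i, rfl⟩ := mem_support.1 hv
  exact mem_support.2 ⟨f i, rfl⟩

lemma support_mem_faces {S : PreAbstractSimplicialComplex V} {n : ℕ} {w : Fin (n + 1) → V}
    (hw : w ∈ (complexSub S).carrier n) : support w ∈ S.faces := by
  obtain ⟨σ, hσ, h⟩ := hw
  refine (S.isRelLowerSet_faces hσ).2 (fun v hv ↦ ?_) (support_nonempty w)
  obtain ⟨i, rfl⟩ := mem_support.1 hv
  exact h i

lemma flagsIn_le {S : PreAbstractSimplicialComplex V} {σ : Finset V} (hσ : σ ∈ S.faces) :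
    flagsIn σ ≤ flagSub S :=
  fun _ _ hf ↦ ⟨hf.1, fun i ↦ (S.isRelLowerSet_faces hσ).2 (hf.2 i).2 (hf.2 i).1⟩

lemma isCarrier_flagsIn (S : PreAbstractSimplicialComplex V) :
    IsCarrier (complexSub S) fun _ w ↦ flagsIn (support w) where
  acyclic _ w _ := flagsIn_acyclic (support_nonempty w)
  mono _ w _ _ := fun _ _ hf ↦ ⟨hf.1, fun j ↦ ⟨(hf.2 j).1, (hf.2 j).2.trans (support_subset w _)⟩⟩

variable {S S' : PreAbstractSimplicialComplex V}

/-- The subdivision of a complex into flags. -/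
def toFlags (h : S' ≤ S) :
    PairMap (complexSub S) (complexSub S') (flagSub S) (flagSub S') :=
  .ofCarrier _ (isCarrier_flagsIn S) (fun _ _ hw ↦ flagsIn_le (support_mem_faces hw))
    (fun _ _ hw ↦ flagsIn_le (support_mem_faces hw)) (complexSub_mono h)

lemma toFlags_carried (h : S' ≤ S) :
    CarriedBy (complexSub S) (fun _ w ↦ flagsIn (support w)) (toFlags h).f :=
  carrierMap_carried (isCarrier_flagsIn S)

lemma toFlags_augmented (h : S' ≤ S) : IsAugmented (complexSub S) (toFlags h).f :=
  carrierMap_aug (isCarrier_flagsIn S)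

lemma exists_vertexChoice (V : Type u) [Nonempty V] :
    ∃ c : Finset V → V, ∀ σ : Finset V, σ.Nonempty → c σ ∈ σ := by
  have h : ∀ σ : Finset V, ∃ v, σ.Nonempty → v ∈ σ := fun σ ↦ by
    rcases σ.eq_empty_or_nonempty with rfl | ⟨v, hv⟩
    · exact ⟨Classical.arbitrary V, fun h ↦ (Finset.not_nonempty_empty h).elim⟩
    · exact ⟨v, fun _ ↦ hv⟩
  choose c hc using h
  exact ⟨c, hc⟩

/-- The chain map that sends each member of a flag to one of its vertices. -/
def flagVertex {c : Finset V → V} (hc : ∀ σ : Finset V, σ.Nonempty → c σ ∈ σ) :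
    PairMap (flagSub S) (flagSub S') (complexSub S) (complexSub S') :=
  have h : ∀ S : PreAbstractSimplicialComplex V, ∀ n, ∀ f ∈ (flagSub S).carrier n,
      (fun i ↦ c (f i)) ∈ (complexSub S).carrier n := fun S _ f hf ↦
    -- The first member of a flag is the largest and contains all the chosen vertices.
    ⟨f 0, hf.2 0, fun i ↦ hf.1 (Fin.zero_le i) (hc _ ((S.isRelLowerSet_faces (hf.2 i)).1))⟩
  .ofSimplexMap (fun n (f : Fin (n + 1) → Finset V) i ↦ c (f i)) (fun _ _ _ _ ↦ rfl) (h S) (h S')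

lemma flagVertex_sx {c : Finset V → V} (hc : ∀ σ : Finset V, σ.Nonempty → c σ ∈ σ) (n : ℕ)
    (f : Fin (n + 1) → Finset V) :
    (flagVertex (S := S) (S' := S') hc).f n ((tuples (Finset V)).sx (n := n) f) =
      (tuples V).sx (n := n) fun i ↦ c (f i) := by
  simp only [flagVertex, PairMap.ofSimplexMap, Finsupp.lmapDomain_apply, Finsupp.mapDomain_single]

lemma flagVertex_augmented {c : Finset V → V} (hc : ∀ σ : Finset V, σ.Nonempty → c σ ∈ σ) :
    IsAugmented (flagSub S) (flagVertex (S := S) (S' := S') hc).f :=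
  isAugmented_ofSimplexMap _ _

/-- The flags in the subdivision of a simplex consist of subsets of its vertices, so the chosen
vertices belong to that simplex. All tuples of its vertices form an acyclic carrier of both maps. -/
lemma flagVertex_toFlags {G G' : PreAbstractSimplicialComplex V}
    {c : Finset V → V} (hc : ∀ σ : Finset V, σ.Nonempty → c σ ∈ σ)
    (h : S' ≤ S) (hG : S ≤ G) (hG' : S' ≤ G') (n : ℕ) :
    ((PairMap.incl (complexSub_mono hG) (complexSub_mono hG')).comp
      ((flagVertex hc).comp (toFlags h))).mapH n =
    (PairMap.incl (complexSub_mono hG) (complexSub_mono hG')).mapH n := by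
  have hle : ∀ {S G : PreAbstractSimplicialComplex V}, S ≤ G → ∀ n,
      ∀ w ∈ (complexSub S).carrier n, tuplesIn (support w : Set V) ≤ complexSub G :=
    fun hG n w hw m v hv ↦ ⟨support w, hG (support_mem_faces hw), hv⟩
  refine PairMap.mapH_eq_of_carrier (Φ := fun _ w ↦ tuplesIn (support w : Set V))
    ⟨fun _ w _ ↦ tuplesIn_acyclic (Finset.coe_nonempty.2 (support_nonempty w)), fun n w _ i m v hv j ↦
      support_subset w _ (hv j)⟩ (hle hG) (hle hG') (complexSub_mono h) (fun n w hw ↦ ?_)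
    (fun n w _ ↦ Sub.sx_mem (A := tuplesIn (support w : Set V)) (n := n) (x := w)
      fun i ↦ mem_support.2 ⟨i, rfl⟩)
    (isAugmented_comp (isAugmented_comp (toFlags_augmented h) (flagVertex_augmented hc))
      (isAugmented_incl _ _)) (isAugmented_incl _ _) n
  refine Sub.map_mem (f := (flagVertex (S := S) (S' := S') hc).f n) (fun f hf ↦ ?_)
    (toFlags_carried h n w hw)
  rw [flagVertex_sx]
  exact Sub.sx_mem (A := tuplesIn (support w : Set V)) (n := n)
    fun i ↦ (hf.2 i).2 (hc _ (hf.2 i).1)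

end Flags

/-! ### Comparison of Čech complexes with spaces -/

section Realization

variable {X : Type u} [MetricSpace X] {η : ℝ}

/-- The intersection of the closed balls around the points of the last member of a flag. -/
def flagBall (a : ℝ) {n : ℕ} (f : Fin (n + 1) → Finset X) : Set X :=
  ⋂ v ∈ (f (Fin.last n) : Set X), Metric.closedBall v a

/-- The union of the closed balls around the points of a tuple. -/
def tupleBall (a : ℝ) {n : ℕ} (w : Fin (n + 1) → X) : Set X :=
  ⋃ v ∈ (support w : Set X), Metric.closedBall v a

lemma flagBall_subset {a : ℝ} {n : ℕ} {f : Fin (n + 1) → Finset X} {v : X}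
    (hv : v ∈ f (Fin.last n)) : flagBall a f ⊆ Metric.closedBall v a :=
  biInter_subset_of_mem hv

variable {a : ℝ} {P P' : Set X}

/-- Intersections of balls shrink when a simplex grows, the wrong direction for a carrier on the
complex itself. On flags, a face has a last member at least as large, hence a smaller intersection,
as a carrier requires. -/
lemma isCarrier_flagBall (hη : 0 < η) (hP : ∀ v ∈ P, StronglyConvex (Metric.closedBall v a)) :
    IsCarrier (flagSub (cech a P)) fun _ f ↦ smallSub η (flagBall a f) where
  acyclic n _ hf := smallSub_acyclic hη <| acyclic_biInter (hf.2 (Fin.last n)).1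
    (fun v hv ↦ hP v ((hf.2 (Fin.last n)).2.1 hv)) (hf.2 (Fin.last n)).2.2
  mono _ _ hf _ := smallSub_mono η <| biInter_subset_biInter_left
    (Finset.coe_subset.2 (hf.1 (Fin.le_last _)))

lemma smallSub_flagBall_le {B : Set X} (hB : ∀ v ∈ P, Metric.closedBall v a ⊆ B) (n : ℕ)
    (f : Fin (n + 1) → Finset X) (hf : f ∈ (flagSub (cech a P)).carrier n) :
    smallSub η (flagBall a f) ≤ smallSub η B := by
  obtain ⟨v, hv⟩ := (hf.2 (Fin.last n)).1
  exact smallSub_mono η ((flagBall_subset hv).trans (hB v ((hf.2 (Fin.last n)).2.1 hv)))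

lemma flagSub_mono {V : Type u} {S S' : PreAbstractSimplicialComplex V} (h : S ≤ S') :
    flagSub S ≤ flagSub S' := fun _ _ hf ↦ ⟨hf.1, fun i ↦ h (hf.2 i)⟩

variable {B B' : Set X}

/-- The chain map from the flags of a Čech complex to the small singular simplices of a space
that contains the balls. -/
def flagsToSpace (hη : 0 < η) (hP : ∀ v ∈ P, StronglyConvex (Metric.closedBall v a))
    (hPP : P' ⊆ P) (hB : ∀ v ∈ P, Metric.closedBall v a ⊆ B)
    (hB' : ∀ v ∈ P', Metric.closedBall v a ⊆ B') :
    PairMap (flagSub (cech a P)) (flagSub (cech a P')) (smallSub η B) (smallSub η B') :=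
  .ofCarrier _ (isCarrier_flagBall hη hP) (smallSub_flagBall_le hB) (smallSub_flagBall_le hB')
    (flagSub_mono (cech_mono le_rfl hPP))

/-- The chain map from a Čech complex to the small singular simplices of a space that contains the
balls. -/
def cechToSpace (hη : 0 < η) (hP : ∀ v ∈ P, StronglyConvex (Metric.closedBall v a))
    (hPP : P' ⊆ P) (hB : ∀ v ∈ P, Metric.closedBall v a ⊆ B)
    (hB' : ∀ v ∈ P', Metric.closedBall v a ⊆ B') :
    PairMap (complexSub (cech a P)) (complexSub (cech a P')) (smallSub η B) (smallSub η B') :=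
  (flagsToSpace hη hP hPP hB hB').comp (toFlags (cech_mono le_rfl hPP))

section

variable (hη : 0 < η) (hP : ∀ v ∈ P, StronglyConvex (Metric.closedBall v a))
  (hPP : P' ⊆ P) (hB : ∀ v ∈ P, Metric.closedBall v a ⊆ B)
  (hB' : ∀ v ∈ P', Metric.closedBall v a ⊆ B')

lemma flagsToSpace_augmented :
    IsAugmented (flagSub (cech a P)) (flagsToSpace hη hP hPP hB hB').f :=
  carrierMap_aug (isCarrier_flagBall hη hP)

lemma flagsToSpace_carried : CarriedBy (flagSub (cech a P))
    (fun _ f ↦ smallSub η (flagBall a f)) (flagsToSpace hη hP hPP hB hB').f :=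
  carrierMap_carried (isCarrier_flagBall hη hP)

lemma cechToSpace_augmented :
    IsAugmented (complexSub (cech a P)) (cechToSpace hη hP hPP hB hB').f :=
  isAugmented_comp (toFlags_augmented (cech_mono le_rfl hPP))
    (flagsToSpace_augmented hη hP hPP hB hB')

/-- Every member of a flag of w consists of vertices of w, so the intersection carrying the flag
lies in the union of the balls around those vertices. -/
lemma cechToSpace_carried : CarriedBy (complexSub (cech a P))
    (fun _ w ↦ smallSub η (tupleBall a w)) (cechToSpace hη hP hPP hB hB').f := by
  intro n w hw
  refine Sub.map_mem (f := (flagsToSpace hη hP hPP hB hB').f n) (fun f hf ↦ ?_)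
    (toFlags_carried (cech_mono le_rfl hPP) n w hw)
  refine Sub.chains_mono (smallSub_mono η ?_) n (flagsToSpace_carried hη hP hPP hB hB' n f
    (flagsIn_le (support_mem_faces hw) n hf))
  obtain ⟨v, hv⟩ := (hf.2 (Fin.last n)).1
  exact (flagBall_subset hv).trans (subset_biUnion_of_mem (u := fun v ↦ Metric.closedBall v a)
    ((hf.2 (Fin.last n)).2 hv))

end

variable {A A' : Set X} {q : X → X}

/-- The tuple of vertices of a singular simplex, moved by `q`. -/
def vertexTuple (q : X → X) (n : ℕ) (s : C(Simp n, X)) : Fin (n + 1) → X :=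
  fun i ↦ q (s (verts n i))

lemma vertexTuple_δ (q : X → X) (n : ℕ) (s : C(Simp (n + 1), X)) (i : Fin (n + 2)) :
    vertexTuple q n ((singular X).δ i s) = (tuples X).δ i (vertexTuple q (n + 1) s) := by
  funext k
  change q (s (stdSimplex.map i.succAbove (stdSimplex.vertex k))) = _
  rw [stdSimplex.map_vertex]
  rfl

/-- The chain map from small singular simplices to a simplicial complex that moves the vertices
by `q`. -/
def spaceToComplex {S S' : PreAbstractSimplicialComplex X} (q : X → X)
    (hS : ∀ n, ∀ s ∈ (smallSub η A).carrier n, vertexTuple q n s ∈ (complexSub S).carrier n)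
    (hS' : ∀ n, ∀ s ∈ (smallSub η A').carrier n, vertexTuple q n s ∈ (complexSub S').carrier n) :
    PairMap (smallSub η A) (smallSub η A') (complexSub S) (complexSub S') :=
  .ofSimplexMap (vertexTuple q) (fun n s _ i ↦ vertexTuple_δ q n s i) hS hS'

lemma spaceToComplex_sx {S S' : PreAbstractSimplicialComplex X}
    (hS : ∀ n, ∀ s ∈ (smallSub η A).carrier n, vertexTuple q n s ∈ (complexSub S).carrier n)
    (hS' : ∀ n, ∀ s ∈ (smallSub η A').carrier n, vertexTuple q n s ∈ (complexSub S').carrier n)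
    (n : ℕ) (s : C(Simp n, X)) :
    (spaceToComplex q hS hS').f n ((singular X).sx (n := n) s) =
      (tuples X).sx (n := n) (vertexTuple q n s) := by
  simp only [spaceToComplex, PairMap.ofSimplexMap, Finsupp.lmapDomain_apply,
    Finsupp.mapDomain_single]

lemma spaceToComplex_augmented {S S' : PreAbstractSimplicialComplex X}
    (hS : ∀ n, ∀ s ∈ (smallSub η A).carrier n, vertexTuple q n s ∈ (complexSub S).carrier n)
    (hS' : ∀ n, ∀ s ∈ (smallSub η A').carrier n, vertexTuple q n s ∈ (complexSub S').carrier n) :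
    IsAugmented (smallSub η A) (spaceToComplex q hS hS').f :=
  isAugmented_ofSimplexMap _ _

lemma dist_vertexTuple_le {d : ℝ} {n : ℕ} {s : C(Simp n, X)} (hs : s ∈ (small X η).carrier n)
    (hd : ∀ t, dist (s t) (q (s t)) ≤ d) (t : Simp n) (i : Fin (n + 1)) :
    dist (s t) (vertexTuple q n s i) ≤ d + η := by
  have h1 : dist (s t) (s (verts n i)) < η := hs _ _
  have h2 := hd (verts n i)
  calc dist (s t) (vertexTuple q n s i)
      ≤ dist (s t) (s (verts n i)) + dist (s (verts n i)) (q (s (verts n i))) := dist_triangle _ _ _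
    _ ≤ d + η := by linarith

/-- A vertex of the small simplex is a common point of the balls: every other vertex is within η of
it, and is moved by at most d. -/
lemma vertexTuple_mem_cech {d : ℝ} {Q : Set X} (hd : ∀ y ∈ A, dist y (q y) ≤ d)
    (hQ : ∀ y ∈ A, q y ∈ Q) (ha : d + η ≤ a) (n : ℕ) (s : C(Simp n, X))
    (hs : s ∈ (smallSub η A).carrier n) : vertexTuple q n s ∈ (complexSub (cech a Q)).carrier n := by
  refine ⟨support (vertexTuple q n s), ⟨support_nonempty _, fun v hv ↦ ?_, s (verts n 0),
    mem_iInter₂.2 fun v hv ↦ ?_⟩, fun i ↦ mem_support.2 ⟨i, rfl⟩⟩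
  · obtain ⟨i, rfl⟩ := mem_support.1 hv
    exact hQ _ (hs.1 _)
  · obtain ⟨i, rfl⟩ := mem_support.1 hv
    exact (dist_vertexTuple_le hs.2 (fun t ↦ hd _ (hs.1 t)) _ i).trans ha

/-- Small simplices moved to a Čech complex and back are homotopic to themselves. -/
lemma cechToSpace_spaceToComplex (hη : 0 < η)
    (hP : ∀ v ∈ P, StronglyConvex (Metric.closedBall v a))
    (hPP : P' ⊆ P) (hB : ∀ v ∈ P, Metric.closedBall v a ⊆ B)
    (hB' : ∀ v ∈ P', Metric.closedBall v a ⊆ B') {d : ℝ} (hd : ∀ y ∈ A, dist y (q y) ≤ d)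
    (had : d + η ≤ a) (hA : A' ⊆ A) (hAB : A ⊆ B) (hAB' : A' ⊆ B')
    (hS : ∀ n, ∀ s ∈ (smallSub η A).carrier n,
      vertexTuple q n s ∈ (complexSub (cech a P)).carrier n)
    (hS' : ∀ n, ∀ s ∈ (smallSub η A').carrier n,
      vertexTuple q n s ∈ (complexSub (cech a P')).carrier n) (n : ℕ) :
    ((cechToSpace hη hP hPP hB hB').comp (spaceToComplex q hS hS')).mapH n =
      (PairMap.incl (smallSub_mono η hAB) (smallSub_mono η hAB')).mapH n := by
  have hle : ∀ {P B : Set X}, (∀ v ∈ P, Metric.closedBall v a ⊆ B) → ∀ n,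
      ∀ w ∈ (complexSub (cech a P)).carrier n, smallSub η (tupleBall a w) ≤ smallSub η B :=
    fun hB n w hw ↦ smallSub_mono η (iUnion₂_subset fun v hv ↦
      hB v ((support_mem_faces hw).2.1 hv))
  -- The union of the balls around the moved vertices contains s itself, because d + η ≤ a, as well
  -- as its image under the composite. It is acyclic because the moved vertices span a Čech simplex,
  -- whose balls have a common point.
  refine PairMap.mapH_eq_of_carrier (Φ := fun n s ↦ smallSub η (tupleBall a (vertexTuple q n s)))
    ⟨fun n s hs ↦ ?_, fun n s hs i ↦ ?_⟩ (fun n s hs ↦ hle hB n _ (hS n s hs))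
    (fun n s hs ↦ hle hB' n _ (hS' n s hs)) (smallSub_mono η hA) (fun n s hs ↦ ?_)
    (fun n s hs ↦ ?_)
    (isAugmented_comp (spaceToComplex_augmented hS hS')
      (cechToSpace_augmented hη hP hPP hB hB')) (isAugmented_incl _ _) n
  · have h := support_mem_faces (hS n s hs)
    obtain ⟨z, hz⟩ := h.2.2
    exact smallSub_acyclic hη (acyclic_biUnion (Finset.finite_toSet _) h.1
      (fun v _ ↦ Metric.isClosed_closedBall) (fun v hv ↦ hP v (h.2.1 hv))
      (fun v hv ↦ mem_iInter₂.1 hz v hv))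
  · refine smallSub_mono η (biUnion_subset_biUnion_left (Finset.coe_subset.2 ?_))
    rw [vertexTuple_δ]
    exact support_subset (vertexTuple q (n + 1) s) i.succAbove
  · change (cechToSpace hη hP hPP hB hB').f n ((spaceToComplex q hS hS').f n
      ((singular X).sx (n := n) s)) ∈ _
    rw [spaceToComplex_sx]
    exact cechToSpace_carried hη hP hPP hB hB' n _ (hS n s hs)
  · change (singular X).sx (n := n) s ∈ _
    refine Sub.sx_mem (A := smallSub η (tupleBall a (vertexTuple q n s))) (n := n) (x := s)
      ⟨fun t ↦ ?_, hs.2⟩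
    refine mem_biUnion (mem_support.2 ⟨0, rfl⟩) ?_
    exact (dist_vertexTuple_le hs.2 (fun t ↦ hd _ (hs.1 t)) t 0).trans had

/-- A Čech complex moved to a space and back to a Čech complex at a larger scale is homotopic to
the inclusion. -/
lemma spaceToComplex_cechToSpace [Nonempty X] {P'' : Set X} {a' : ℝ} (hη : 0 < η)
    (hP : ∀ v ∈ P, StronglyConvex (Metric.closedBall v a))
    (hPP : P' ⊆ P) (hB : ∀ v ∈ P, Metric.closedBall v a ⊆ B)
    (hB' : ∀ v ∈ P', Metric.closedBall v a ⊆ B') (hqP : ∀ y, q y ∈ P)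
    (hq : ∀ y, ∀ v ∈ P, dist y (q y) ≤ dist y v) (haa : a + η ≤ a')
    (hP'' : ∀ v ∈ P', ∀ v' ∈ P, dist v v' ≤ a + a' → v' ∈ P'') (hle : P' ⊆ P'')
    (hS : ∀ n, ∀ s ∈ (smallSub η B).carrier n,
      vertexTuple q n s ∈ (complexSub (cech a' P)).carrier n)
    (hS' : ∀ n, ∀ s ∈ (smallSub η B').carrier n,
      vertexTuple q n s ∈ (complexSub (cech a' P'')).carrier n) (n : ℕ) :
    ((spaceToComplex q hS hS').comp (cechToSpace hη hP hPP hB hB')).mapH n =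
      (PairMap.incl (complexSub_mono (cech_mono (by linarith) Subset.rfl))
        (complexSub_mono (cech_mono (by linarith) hle))).mapH n := by
  obtain ⟨c, hc⟩ := exists_vertexChoice X
  have haa' : a ≤ a' := by linarith
  rw [← flagVertex_toFlags hc (cech_mono le_rfl hPP) (cech_mono haa' Subset.rfl)
    (cech_mono haa' hle)]
  have key : ((spaceToComplex q hS hS').comp (flagsToSpace hη hP hPP hB hB')).mapH n =
      ((PairMap.incl (complexSub_mono (cech_mono haa' Subset.rfl))
        (complexSub_mono (cech_mono haa' hle))).comp (flagVertex hc)).mapH n := by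
    -- Tuples of sample points within a' of a common point y of the balls of the flag. The point y
    -- may vary with the tuple, yet any vertex v of the last member is a cone apex: y lies in the
    -- a-ball of v, so the same y serves for the cone.
    let Ψ : ∀ n, (tuples (Finset X)).obj n → Sub (tuples X) := fun n f ↦
      { carrier := fun m ↦ Set.ofPred fun w : Fin (m + 1) → X ↦
          (∀ i, w i ∈ P) ∧ ∃ y ∈ flagBall a f, ∀ i, dist y (w i) ≤ a'
        δ_mem := fun i w hw ↦ ⟨fun j ↦ hw.1 _, hw.2.imp fun y hy ↦ ⟨hy.1, fun j ↦ hy.2 _⟩⟩ }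
    have hΨ : ∀ n f m (w : Fin (m + 1) → X), w ∈ (Ψ n f).carrier m ↔
          (∀ i, w i ∈ P) ∧ ∃ y ∈ flagBall a f, ∀ i, dist y (w i) ≤ a' := fun _ _ _ _ ↦ Iff.rfl
    refine PairMap.mapH_eq_of_carrier (Φ := Ψ) ⟨fun n f hf ↦ ?_, fun n f hf i m w hw ↦ ?_⟩
      (fun n f hf m w hw ↦ ?_) (fun n f hf m w hw ↦ ?_) (flagSub_mono (cech_mono le_rfl hPP))
      (fun n f hf ↦ ?_) (fun n f hf ↦ ?_)
      (isAugmented_comp (flagsToSpace_augmented hη hP hPP hB hB')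
        (spaceToComplex_augmented hS hS'))
      (isAugmented_comp (flagVertex_augmented hc) (isAugmented_incl _ _)) n
    · obtain ⟨v, hv⟩ := (hf.2 (Fin.last n)).1
      have hvP := (hf.2 (Fin.last n)).2.1 hv
      have hvy : ∀ y ∈ flagBall a f, dist y v ≤ a' := fun y hy ↦ (flagBall_subset hv hy).trans haa'
      refine Sub.acyclic_of_cone (fun _ ↦ v) (fun n (w : Fin (n + 1) → X) ↦
        (Fin.cons v w : Fin (n + 2) → X)) ?_ (fun m w hw ↦ ?_)
        (fun n w _ ↦ tuples_δ_zero v w) (fun w _ ↦ tuples_δ_one v w)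
        (fun n w _ i ↦ tuples_δ_succ v w i)
      · obtain ⟨y, hy⟩ := (hf.2 (Fin.last n)).2.2
        exact ⟨fun _ ↦ hvP, y, hy, fun _ ↦ hvy y hy⟩
      · obtain ⟨hwP, y, hy, hyw⟩ := hw
        refine ⟨fun i ↦ ?_, y, hy, fun i ↦ ?_⟩
        · refine Fin.cases ?_ (fun i ↦ ?_) i
          · exact hvP
          · exact hwP i
        · refine Fin.cases ?_ (fun i ↦ ?_) i
          · exact hvy y hy
          · exact hyw i
    · obtain ⟨hwP, y, hy, hyw⟩ := hw
      exact ⟨hwP, y, biInter_subset_biInter_left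
        (Finset.coe_subset.2 (hf.1 (Fin.le_last _))) hy, hyw⟩
    · obtain ⟨hwP, y, hy, hyw⟩ := hw
      refine ⟨support w, ⟨support_nonempty w, fun v hv ↦ ?_, y, mem_iInter₂.2 fun v hv ↦ ?_⟩,
        fun i ↦ mem_support.2 ⟨i, rfl⟩⟩
      · obtain ⟨i, rfl⟩ := mem_support.1 hv
        exact hwP i
      · obtain ⟨i, rfl⟩ := mem_support.1 hv
        exact hyw i
    · obtain ⟨hwP, y, hy, hyw⟩ := hw
      refine ⟨support w, ⟨support_nonempty w, fun v hv ↦ ?_, y, mem_iInter₂.2 fun v hv ↦ ?_⟩,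
        fun i ↦ mem_support.2 ⟨i, rfl⟩⟩
      · obtain ⟨i, rfl⟩ := mem_support.1 hv
        obtain ⟨v', hv'⟩ := (hf.2 (Fin.last n)).1
        refine hP'' v' ((hf.2 (Fin.last n)).2.1 hv') _ (hwP i) ?_
        have h1 : dist y v' ≤ a := flagBall_subset hv' hy
        -- The entries of the tuple may leave `P'`, but by at most a + a', which `hP''` allows for.
        exact (dist_triangle_left _ _ y).trans (add_le_add h1 (hyw i))
      · obtain ⟨i, rfl⟩ := mem_support.1 hv
        exact hyw i
    · refine Sub.map_mem (f := (spaceToComplex q hS hS').f n) (fun (s : C(Simp n, X)) hs ↦ ?_)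
        (flagsToSpace_carried hη hP hPP hB hB' n f hf)
      rw [spaceToComplex_sx]
      refine Sub.sx_mem ((hΨ n f n _).2 ⟨fun i ↦ hqP _, s (verts n 0), hs.1 _, fun i ↦ ?_⟩)
      refine (dist_vertexTuple_le hs.2 (d := a) (fun t ↦ ?_) _ i).trans haa
      -- A point of the intersection is within a of the sample point v, hence also of its nearest
      -- sample point.
      obtain ⟨v, hv⟩ := (hf.2 (Fin.last n)).1
      exact (hq _ v ((hf.2 (Fin.last n)).2.1 hv)).trans (flagBall_subset hv (hs.1 t))
    · change (flagVertex (S := cech a P) (S' := cech a P') hc).f n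
        ((tuples (Finset X)).sx (n := n) f) ∈ _
      rw [flagVertex_sx]
      obtain ⟨-, -, y, hy⟩ := hf.2 0
      have hci : ∀ i, c (f i) ∈ f 0 := fun i ↦ hf.1 (Fin.zero_le i) (hc _ (hf.2 i).1)
      refine Sub.sx_mem ((hΨ n f n _).2 ⟨fun i ↦ (hf.2 0).2.1 (hci i), y, ?_, fun i ↦ ?_⟩)
      · exact biInter_subset_biInter_left (Finset.coe_subset.2 (hf.1 (Fin.zero_le _))) hy
      · exact (mem_iInter₂.1 hy _ (hci i)).trans haa'
  rw [PairMap.mapH_comp, cechToSpace, PairMap.mapH_comp, ← LinearMap.comp_assoc,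
    ← PairMap.mapH_comp, key, PairMap.mapH_comp, PairMap.mapH_comp, PairMap.mapH_comp,
    LinearMap.comp_assoc]

end Realization

end LocalHomology
end

noncomputable section

namespace LocalHomology

open FaceSystem

/-! ### Images of interleaved maps -/

/-- The map i ∘ a = d ∘ j₁ ∘ j₀ is an isomorphism onto the range of i. It is injective because e ∘ i
∘ a = j₂ ∘ j₁ ∘ j₀. It has the full range because i factors through d ∘ j₁, whose range is not
diminished by precomposing with j₀. -/
lemma nonempty_range_equiv_of_interleaving {A₀ A₁ A₂ A₃ B B' : Type*} [AddCommGroup A₀]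
    [AddCommGroup A₁] [AddCommGroup A₂] [AddCommGroup A₃] [AddCommGroup B] [AddCommGroup B']
    [Module ℤ A₀] [Module ℤ A₁] [Module ℤ A₂] [Module ℤ A₃] [Module ℤ B] [Module ℤ B']
    {i : B →ₗ[ℤ] B'} {j₀ : A₀ →ₗ[ℤ] A₁} {j₁ : A₁ →ₗ[ℤ] A₂} {j₂ : A₂ →ₗ[ℤ] A₃}
    (a : A₀ →ₗ[ℤ] B) (b : B →ₗ[ℤ] A₁) (d : A₂ →ₗ[ℤ] B') (e : B' →ₗ[ℤ] A₃)
    (hba : b ∘ₗ a = j₀) (hi : d ∘ₗ j₁ ∘ₗ b = i) (hed : e ∘ₗ d = j₂)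
    (hj : LinearMap.range (j₁ ∘ₗ j₀) = LinearMap.range j₁)
    (hinj : Function.Injective (j₂ ∘ₗ j₁ ∘ₗ j₀)) : Nonempty (LinearMap.range i ≃+ A₀) := by
  have h1 : i ∘ₗ a = d ∘ₗ j₁ ∘ₗ j₀ := by rw [← hi, ← hba]; rfl
  have h2 : Function.Injective (i ∘ₗ a) := by
    refine Function.Injective.of_comp (f := e) ?_
    have : j₂ ∘ₗ j₁ ∘ₗ j₀ = e ∘ₗ i ∘ₗ a := by rw [h1, ← hed]; rfl
    rw [this] at hinj
    exact hinj
  have h3 : LinearMap.range (i ∘ₗ a) = LinearMap.range i := by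
    refine le_antisymm (LinearMap.range_comp_le_range _ _) ?_
    rw [h1, LinearMap.range_comp, hj, ← LinearMap.range_comp, ← hi, ← LinearMap.comp_assoc]
    exact LinearMap.range_comp_le_range _ _
  let f : A₀ →+ LinearMap.range i := AddMonoidHom.mk' (fun z ↦ ⟨i (a z), a z, rfl⟩) fun z w ↦
    Subtype.ext ((congrArg i (map_add a z w)).trans (map_add i _ _))
  refine ⟨(AddEquiv.ofBijective f ⟨fun z w h ↦ h2 (congrArg Subtype.val h), ?_⟩).symm⟩
  rintro ⟨y, hy⟩
  rw [← h3] at hy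
  obtain ⟨z, rfl⟩ := hy
  exact ⟨z, rfl⟩

/-! ### Maps between the homology of pairs of spaces and of complexes -/

/-- The map that corresponds to `f` under isomorphisms of source and target. -/
def conj {M₁ M₂ N₁ N₂ : Type*} [AddCommGroup M₁] [AddCommGroup M₂] [AddCommGroup N₁]
    [AddCommGroup N₂] [Module ℤ M₁] [Module ℤ M₂] [Module ℤ N₁] [Module ℤ N₂] (e₁ : M₁ ≃ₗ[ℤ] N₁)
    (e₂ : M₂ ≃ₗ[ℤ] N₂) (f : M₁ →ₗ[ℤ] M₂) : N₁ →ₗ[ℤ] N₂ :=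
  e₂.toLinearMap ∘ₗ f ∘ₗ e₁.symm.toLinearMap

lemma conj_comp_conj {M₁ M₂ M₃ N₁ N₂ N₃ : Type*} [AddCommGroup M₁] [AddCommGroup M₂]
    [AddCommGroup M₃] [AddCommGroup N₁] [AddCommGroup N₂] [AddCommGroup N₃] [Module ℤ M₁]
    [Module ℤ M₂] [Module ℤ M₃] [Module ℤ N₁] [Module ℤ N₂] [Module ℤ N₃] (e₁ : M₁ ≃ₗ[ℤ] N₁)
    (e₂ : M₂ ≃ₗ[ℤ] N₂) (e₃ : M₃ ≃ₗ[ℤ] N₃) (f : M₁ →ₗ[ℤ] M₂) (g : M₂ →ₗ[ℤ] M₃) :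
    conj e₂ e₃ g ∘ₗ conj e₁ e₂ f = conj e₁ e₃ (g ∘ₗ f) := by
  refine LinearMap.ext fun z ↦ ?_
  simp [conj]

lemma eq_conj {M₁ M₂ N₁ N₂ : Type*} [AddCommGroup M₁] [AddCommGroup M₂] [AddCommGroup N₁]
    [AddCommGroup N₂] [Module ℤ M₁] [Module ℤ M₂] [Module ℤ N₁] [Module ℤ N₂] {e₁ : M₁ ≃ₗ[ℤ] N₁}
    {e₂ : M₂ ≃ₗ[ℤ] N₂} {f : M₁ →ₗ[ℤ] M₂} {g : N₁ →ₗ[ℤ] N₂} (h : ∀ y, g (e₁ y) = e₂ (f y)) :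
    g = conj e₁ e₂ f := by
  refine LinearMap.ext fun z ↦ ?_
  obtain ⟨y, rfl⟩ := e₁.surjective z
  simp [conj, h]

/-- The homology of a pair of complexes, as the homology of tuples of vertices. -/
def ComplexPair.tupleEquiv {X : Type u} (A : ComplexPair X) (n : ℕ) :
    RelH (complexSub A.total) (complexSub A.sub) n ≃ₗ[ℤ] A.H n := A.embedding.equiv n

lemma ComplexPair.mapH_eq_conj {X : Type u} {A B : ComplexPair X} (h : A ≤ B) (n : ℕ) :
    ComplexPair.mapH n h = conj (A.tupleEquiv n) (B.tupleEquiv n)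
      ((PairMap.incl (complexSub_mono h.1) (complexSub_mono h.2)).mapH n) :=
  eq_conj fun y ↦ ComplexPair.mapH_equiv h n y

/-! ### Inclusion maps of homology, computed with small simplices -/

section Transfer

variable {X : Type u} [MetricSpace X] {η : ℝ}

/-- The homology of a pair of subspaces, as the homology of its singular simplices. -/
def SetPair.singularEquiv (A : SetPair X) (n : ℕ) :
    RelH (singularSub A.total) (singularSub A.sub) n ≃ₗ[ℤ] A.H n := A.embedding.equiv n

lemma SetPair.mapH_singularEquiv {A B : SetPair X} (h : A ≤ B) (n : ℕ)
    (y : RelH (singularSub A.total) (singularSub A.sub) n) :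
    SetPair.mapH n h (A.singularEquiv n y) = B.singularEquiv n
      ((PairMap.incl (singularSub_mono h.1) (singularSub_mono h.2)).mapH n y) :=
  SetPair.mapH_equiv h n y

lemma SetPair.mapH_comp {A B D : SetPair X} (h : A ≤ B) (h' : B ≤ D) (h'' : A ≤ D) (n : ℕ) :
    SetPair.mapH n h' ∘ₗ SetPair.mapH n h = SetPair.mapH n h'' := by
  rw [eq_conj (SetPair.mapH_singularEquiv h n), eq_conj (SetPair.mapH_singularEquiv h' n),
    eq_conj (SetPair.mapH_singularEquiv h'' n), conj_comp_conj, ← PairMap.mapH_comp]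
  rfl

/-- The homology of a pair of subspaces, as the homology of its small singular simplices. -/
def SetPair.smallEquiv (hη : 0 < η) (A : SetPair X) (n : ℕ) :
    RelH (smallSub η A.total) (smallSub η A.sub) n ≃ₗ[ℤ] A.H n :=
  (LinearEquiv.ofBijective _ (smallSub_bijective hη A.total A.sub n)).trans (A.singularEquiv n)

lemma SetPair.mapH_eq_conj (hη : 0 < η) {A B : SetPair X} (h : A ≤ B) (n : ℕ) :
    SetPair.mapH n h = conj (A.smallEquiv hη n) (B.smallEquiv hη n)
      ((PairMap.incl (smallSub_mono η h.1) (smallSub_mono η h.2)).mapH n) :=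
  eq_conj fun y ↦ by
    simp only [SetPair.smallEquiv, LinearEquiv.trans_apply, LinearEquiv.ofBijective_apply,
      SetPair.mapH_singularEquiv]
    rw [← LinearMap.comp_apply (PairMap.mapH _ n), ← LinearMap.comp_apply (PairMap.mapH _ n),
      ← PairMap.mapH_comp, ← PairMap.mapH_comp]
    rfl

end Transfer

/-! ### Complexes on a sample, interleaved with neighborhoods -/

section Interleaving

variable {X : Type u} [MetricSpace X] {K : TopologicalSpace.Compacts X} {x p : X} {P : Set X}
  {q : X → X} {ε ε₀ : ℝ}

/-- Continuity of q is not needed, since it is applied only to vertices of singular simplices. -/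
lemma exists_nearestPoint {P : Set X} (hP : P.Finite) (hne : P.Nonempty) :
    ∃ q : X → X, (∀ y, q y ∈ P) ∧ ∀ y, ∀ v ∈ P, dist y (q y) ≤ dist y v := by
  choose q hq using fun y : X ↦ Set.exists_min_image P (dist y) hP hne
  exact ⟨q, fun y ↦ (hq y).1, fun y ↦ (hq y).2⟩

lemma exists_dist_le_of_mem_cthickening {a : ℝ} (ha : 0 ≤ a) {y : X}
    (hy : y ∈ Metric.cthickening a (K : Set X)) : ∃ k ∈ K, dist y k ≤ a := by
  rw [K.isCompact.cthickening_eq_biUnion_closedBall ha] at hy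
  obtain ⟨k, hk, h⟩ := mem_iUnion₂.1 hy
  exact ⟨k, hk, h⟩

lemma dist_nearestPoint_le (hq : ∀ y, ∀ v ∈ P, dist y (q y) ≤ dist y v)
    (hKP : ∀ k ∈ K, ∃ v ∈ P, dist k v ≤ ε₀) {a : ℝ} (ha : 0 ≤ a) {y : X}
    (hy : y ∈ Metric.cthickening a (K : Set X)) : dist y (q y) ≤ a + ε₀ := by
  obtain ⟨k, hk, h⟩ := exists_dist_le_of_mem_cthickening ha hy
  obtain ⟨v, hv, h'⟩ := hKP k hk
  exact (hq y v hv).trans ((dist_triangle y k v).trans (add_le_add h h'))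

lemma closedBall_subset_cthickening {a b : ℝ} {v : X}
    (hv : ∃ k ∈ K, dist v k ≤ b) : Metric.closedBall v a ⊆ Metric.cthickening (a + b) K := by
  obtain ⟨k, hk, h⟩ := hv
  intro y hy
  exact Metric.mem_cthickening_of_dist_le y k _ _ hk
    ((dist_triangle y v k).trans (add_le_add hy h))

/-- The image in homology of an inclusion of complexes that are squeezed between Čech complexes
is isomorphic to the homology of a pair of neighborhoods. -/
lemma nonempty_range_equiv_nbhdPair {c t ε' g β R R' R₁ r r' r₁ : ℝ} (hε₀ : ε₀ < ε) (hx : x ∈ K)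
    (hc : 1 ≤ c) (ht : 0 ≤ t)
    (hqP : ∀ y, q y ∈ P) (hq : ∀ y, ∀ v ∈ P, dist y (q y) ≤ dist y v)
    (hKP : ∀ k ∈ K, ∃ v ∈ P, dist k v ≤ ε₀) (hPK : ∀ v ∈ P, ∃ k ∈ K, dist v k ≤ t * ε)
    (hxp : dist x p ≤ t * ε) (hconv : ∀ v ∈ P, StronglyConvex (Metric.closedBall v (c * ε)))
    (hconv' : ∀ v ∈ P, StronglyConvex (Metric.closedBall v (c * (ε' + ε))))
    (hg : g = c * ε + t * ε) (hgε' : g ≤ ε') (hβ : β = c * (ε' + ε) + t * ε)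
    (hR : R + (1 + t) * ε = R') (hR₁ : R₁ + (c + t) * ε = R)
    (hr : r = r' + c * (ε' + ε) + t * ε) (hr₁ : r₁ = r + ε' + (1 + t) * ε)
    (h₀ : nbhdPair K x 0 R' ≤ nbhdPair K x g R₁) (h₁ : nbhdPair K x g R₁ ≤ nbhdPair K x ε' r₁)
    (h₂ : nbhdPair K x ε' r₁ ≤ nbhdPair K x β r') (hrR : r₁ ≤ R₁)
    {A B : ComplexPair X} (h : A ≤ B)
    (hA : cech ε P ≤ A.total) (hA' : cech ε (P \ Metric.ball p R) ≤ A.sub)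
    (hAc : A.total ≤ cech (c * ε) P) (hAc' : A.sub ≤ cech (c * ε) (P \ Metric.ball p R))
    (hB : cech (ε' + ε) P ≤ B.total) (hB' : cech (ε' + ε) (P \ Metric.ball p r) ≤ B.sub)
    (hBc : B.total ≤ cech (c * (ε' + ε)) P)
    (hBc' : B.sub ≤ cech (c * (ε' + ε)) (P \ Metric.ball p r)) (n : ℕ)
    (hj : LinearMap.range (SetPair.mapH n h₁ ∘ₗ SetPair.mapH n h₀) =
      LinearMap.range (SetPair.mapH n h₁))
    (hinj : Function.Injective (SetPair.mapH n h₂ ∘ₗ SetPair.mapH n h₁ ∘ₗ SetPair.mapH n h₀)) :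
    Nonempty (LinearMap.range (ComplexPair.mapH n h) ≃+ (nbhdPair K x 0 R').H n) := by
  have : Nonempty X := ⟨x⟩
  have hε₀0 : 0 ≤ ε₀ := by
    obtain ⟨v, -, hv⟩ := hKP x hx
    exact dist_nonneg.trans hv
  have hε : 0 < ε := hε₀0.trans_lt hε₀
  have htε : 0 ≤ t * ε := mul_nonneg ht hε.le
  have hcε : ε ≤ c * ε := le_mul_of_one_le_left hε.le hc
  have hε' : 0 ≤ ε' := by linarith
  have hcε' : ε' + ε ≤ c * (ε' + ε) := le_mul_of_one_le_left (by linarith) hc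
  -- The slack in the strict sampling bound is the admitted size of simplices: a nearest sample
  -- point costs ε₀, the diameter η, in total exactly ε.
  obtain ⟨η, hη⟩ : ∃ η, η = ε - ε₀ := ⟨_, rfl⟩
  have hη0 : 0 < η := by linarith
  have hqD : ∀ {a : ℝ}, 0 ≤ a → ∀ y ∈ Metric.cthickening a (K : Set X), dist y (q y) ≤ a + ε₀ :=
    fun ha y hy ↦ dist_nearestPoint_le hq hKP ha hy
  -- Radii are measured around x in the space but around p in the sample. The change of center costs
  -- tε, moving y to q y costs a + ε₀; going back (`hball`), a ball of radius a around a sample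
  -- point costs a + tε.
  have hmem : ∀ {a b b' : ℝ}, 0 ≤ a → b' + a + ε₀ + t * ε ≤ b →
      ∀ y ∈ (nbhdPair K x a b).sub, q y ∈ P \ Metric.ball p b' := fun {a b b'} ha hb y hy ↦ by
    refine ⟨hqP y, fun hy' ↦ hy.2 ?_⟩
    rw [Metric.mem_ball] at hy' ⊢
    have h1 := hqD ha y hy.1
    have h2 := dist_triangle4 y (q y) p x
    rw [dist_comm p x] at h2
    linarith
  have hball : ∀ {a b b' : ℝ}, b' + a + t * ε ≤ b → ∀ v ∈ P \ Metric.ball p b,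
      Metric.closedBall v a ⊆ (nbhdPair K x (a + t * ε) b').sub := fun {a b b'} hb v hv y hy ↦ by
    refine ⟨closedBall_subset_cthickening (hPK v hv.1) hy, fun hy' ↦ hv.2 ?_⟩
    rw [Metric.mem_ball] at hy' ⊢
    have h1 : dist y v ≤ a := hy
    have h2 := dist_triangle4 v y x p
    rw [dist_comm v y] at h2
    linarith
  have hball' : ∀ a : ℝ, ∀ v ∈ P, Metric.closedBall v a ⊆ Metric.cthickening (a + t * ε) K :=
    fun a v hv ↦ closedBall_subset_cthickening (hPK v hv)
  -- from neighborhoods to complexes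
  have ha : ∀ n, ∀ s ∈ (smallSub η (nbhdPair K x 0 R').total).carrier n,
      vertexTuple q n s ∈ (complexSub (cech ε P)).carrier n :=
    vertexTuple_mem_cech (d := ε₀) (fun y hy ↦ by simpa using hqD le_rfl y hy) (fun y _ ↦ hqP y)
      (by linarith)
  have ha' : ∀ n, ∀ s ∈ (smallSub η (nbhdPair K x 0 R').sub).carrier n,
      vertexTuple q n s ∈ (complexSub (cech ε (P \ Metric.ball p R))).carrier n :=
    vertexTuple_mem_cech (d := ε₀) (fun y hy ↦ by simpa using hqD le_rfl y hy.1)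
      (hmem le_rfl (by linarith)) (by linarith)
  have hd : ∀ n, ∀ s ∈ (smallSub η (nbhdPair K x ε' r₁).total).carrier n,
      vertexTuple q n s ∈ (complexSub (cech (ε' + ε) P)).carrier n :=
    vertexTuple_mem_cech (hqD hε') (fun y _ ↦ hqP y) (by linarith)
  have hd' : ∀ n, ∀ s ∈ (smallSub η (nbhdPair K x ε' r₁).sub).carrier n,
      vertexTuple q n s ∈ (complexSub (cech (ε' + ε) (P \ Metric.ball p r))).carrier n :=
    vertexTuple_mem_cech (fun y hy ↦ hqD hε' y hy.1) (hmem hε' (by linarith)) (by linarith)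
  -- from complexes to neighborhoods
  subst hg hβ
  have hb : ∀ v ∈ P, Metric.closedBall v (c * ε) ⊆ (nbhdPair K x (c * ε + t * ε) R₁).total :=
    hball' (c * ε)
  have hb' := hball (a := c * ε) (b := R) (b' := R₁) (by linarith)
  have he : ∀ v ∈ P, Metric.closedBall v (c * (ε' + ε)) ⊆
      (nbhdPair K x (c * (ε' + ε) + t * ε) r').total := hball' (c * (ε' + ε))
  have he' := hball (a := c * (ε' + ε)) (b := r) (b' := r') (by linarith)
  let a := spaceToComplex (η := η) q (fun n s hs ↦ complexSub_mono hA n (ha n s hs))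
    (fun n s hs ↦ complexSub_mono hA' n (ha' n s hs))
  let b := (cechToSpace hη0 hconv sdiff_subset hb hb').comp
    (PairMap.incl (complexSub_mono hAc) (complexSub_mono hAc'))
  let d := spaceToComplex (η := η) q (fun n s hs ↦ complexSub_mono hB n (hd n s hs))
    (fun n s hs ↦ complexSub_mono hB' n (hd' n s hs))
  let e := (cechToSpace hη0 hconv' sdiff_subset he he').comp
    (PairMap.incl (complexSub_mono hBc) (complexSub_mono hBc'))
  refine nonempty_range_equiv_of_interleaving (j₀ := SetPair.mapH n h₀) (j₁ := SetPair.mapH n h₁)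
    (j₂ := SetPair.mapH n h₂)
    (conj (SetPair.smallEquiv hη0 _ n) (A.tupleEquiv n) (a.mapH n))
    (conj (A.tupleEquiv n) (SetPair.smallEquiv hη0 _ n) (b.mapH n))
    (conj (SetPair.smallEquiv hη0 _ n) (B.tupleEquiv n) (d.mapH n))
    (conj (B.tupleEquiv n) (SetPair.smallEquiv hη0 _ n) (e.mapH n))
    ?_ ?_ ?_ hj hinj
  -- A₀ → B → A₁: the passage through the intermediate complex is the passage through the Čech
  -- complex at scale cε that contains it.
  · rw [conj_comp_conj, SetPair.mapH_eq_conj hη0, ← PairMap.mapH_comp]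
    refine congrArg _ ((PairMap.mapH_eq_of_f_eq (fun _ ↦ rfl) n).trans
      (cechToSpace_spaceToComplex hη0 hconv sdiff_subset hb hb' (q := q) (d := ε₀) ?_ ?_
        sdiff_subset h₀.1 h₀.2 (fun n s hs ↦ complexSub_mono (hA.trans hAc) n (ha n s hs))
        (fun n s hs ↦ complexSub_mono (hA'.trans hAc') n (ha' n s hs)) n))
    · exact fun y hy ↦ by simpa using hqD le_rfl y hy
    · linarith
  · rw [SetPair.mapH_eq_conj hη0, conj_comp_conj, conj_comp_conj, ComplexPair.mapH_eq_conj,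
      ← PairMap.mapH_comp, ← PairMap.mapH_comp]
    -- The comparison takes place between Čech complexes at scales cε and ε' + ε, composed with the
    -- inclusions of the first complex into the former and of the latter into the second complex.
    -- The scales leave room, cε + η ≤ ε' + ε, because g ≤ ε' and η ≤ ε.
    have key := spaceToComplex_cechToSpace hη0 hconv sdiff_subset hb hb' hqP hq (a' := ε' + ε)
      (P'' := P \ Metric.ball p r) (by linarith) ?_ ?_
      (fun n s hs ↦ hd n s (smallSub_mono η h₁.1 n hs))
      (fun n s hs ↦ hd' n s (smallSub_mono η h₁.2 n hs)) n
    · refine congrArg _ (.trans ?_ ((congrArg (fun f ↦ (PairMap.incl (complexSub_mono hB)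
        (complexSub_mono hB')).mapH n ∘ₗ f ∘ₗ (PairMap.incl (complexSub_mono hAc)
          (complexSub_mono hAc')).mapH n) key).trans ?_))
      all_goals
        simp only [← PairMap.mapH_comp]
        exact PairMap.mapH_eq_of_f_eq (fun _ ↦ rfl) n
    · intro v hv v' hv' hvv
      refine ⟨hv', fun hb ↦ hv.2 ?_⟩
      rw [Metric.mem_ball] at hb ⊢
      have := dist_triangle v v' p
      linarith
    · refine sdiff_subset_sdiff_right (Metric.ball_subset_ball ?_)
      linarith
  · rw [conj_comp_conj, SetPair.mapH_eq_conj hη0, ← PairMap.mapH_comp]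
    refine congrArg _ ((PairMap.mapH_eq_of_f_eq (fun _ ↦ rfl) n).trans
      (cechToSpace_spaceToComplex hη0 hconv' sdiff_subset he he' (q := q) (d := ε' + ε₀) (hqD hε') ?_
        sdiff_subset h₂.1 h₂.2 (fun n s hs ↦ complexSub_mono (hB.trans hBc) n (hd n s hs))
        (fun n s hs ↦ complexSub_mono (hB'.trans hBc') n (hd' n s hs)) n))
    linarith

end Interleaving

end LocalHomology
end

noncomputable section

namespace LocalHomology

open FaceSystem

/-! ### Admissible triples -/

section Admissible

variable {X : Type u} [MetricSpace X] {K : TopologicalSpace.Compacts X} {x : X} {T : Set ℝ}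
  {αl : ℝ → ℝ}

/-- The defining inequality of the triangle is strict, so the infimum δ̄ can be replaced by one of
the numbers δ over which it is taken. If δ̄ = ∞ the triangle is empty. -/
lemma exists_triangle_subset_slab {ε β γ R r : ℝ}
    (h : (R, r) ∈ triangle K x T αl ε β (deltaBar K x T αl ε β + (γ : EReal))) :
    ∃ δ : ℝ, 0 < δ ∧ triangle K x T αl ε β δ ⊆ slab K x T αl ε β ∧ r + δ + γ < R := by
  have h1 : deltaBar K x T αl ε β < ((R - γ - r : ℝ) : EReal) := by
    have h2 := h.2.2
    induction hδ : deltaBar K x T αl ε β with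
    | bot => exact EReal.bot_lt_coe _
    | coe d =>
      rw [hδ] at h2
      have h3 : r + (d + γ) < R := by exact_mod_cast h2
      exact_mod_cast (by linarith : d < R - γ - r)
    | top =>
      rw [hδ, EReal.top_add_coe, EReal.coe_add_top] at h2
      exact absurd h2 not_top_lt
  obtain ⟨_, ⟨δ, hδ, rfl⟩, h2⟩ := sInf_lt_iff.1 h1
  have h3 : δ < R - γ - r := EReal.coe_lt_coe_iff.1 h2
  exact ⟨δ, hδ.1, hδ.2, by linarith⟩

lemma mem_slab {ε β : ℝ} {z : ℝ × ℝ} (h : z ∈ slab K x T αl ε β) {ε' α : ℝ} (hε' : ε' ∈ Icc 0 ε)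
    (hα : α ∈ Icc (αl ε') β) : IsAdmissible K x T ε' z.1 z.2 α :=
  mem_iInter₂.1 (mem_iInter₂.1 h ε' hε') α hα

/-- The local homology of `K` at `x` is the image in homology of an inclusion of complexes that
are squeezed between Čech complexes. -/
theorem nonempty_range_equiv_localPair {εx : ℝ} {αu : ℝ → ℝ} (hK : IsWeaklySeemly K x T εx αl αu)
    (hx : x ∈ K) {P : Set X} {ε : ℝ} (hP : IsSample (K : Set X) P ε) {p : X} (hp : p ∈ P)
    (hxp : (P ⊆ K ∧ ∀ z ∈ K, dist p x ≤ dist p z) ∨ (¬ P ⊆ K ∧ dist x p < ε))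
    {t c ε' β γ R' r' R r : ℝ} (ht : t = noiseConst (K : Set X) P) (hc : 1 ≤ c)
    (hε : ε ∈ goodSet K x T αl εx αu (fFun t c) (gFun t c)) (hε' : ε' = αl (gFun t c 0 ε))
    (hβ : β = gFun t c ε' ε) (hγ : γ = fFun t c 0 ε + fFun t c ε' ε)
    (hconv : ((c * (ε' + ε) : ℝ) : EReal) < setConvRadius P)
    (htri : (R', r') ∈ triangle K x T αl ε' β (deltaBar K x T αl ε' β + (γ : EReal)))
    (hR : R = R' - gFun t 1 0 ε) (hr : r = r' + gFun t c ε' ε)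
    (𝒦 : ℝ → Set X → PreAbstractSimplicialComplex X)
    (h𝒦 : ∀ {a : ℝ}, 0 ≤ a → ∀ Q, cech a Q ≤ 𝒦 a Q ∧ 𝒦 a Q ≤ cech (c * a) Q)
    (hmono : ∀ {a a' : ℝ} {Q Q' : Set X}, a ≤ a' → Q ⊆ Q' → 𝒦 a Q ≤ 𝒦 a' Q')
    {A B : ComplexPair X} (hA : A.total = 𝒦 ε P) (hA' : A.sub = 𝒦 ε (P \ Metric.ball p R))
    (hB : B.total = 𝒦 (ε' + ε) P) (hB' : B.sub = 𝒦 (ε' + ε) (P \ Metric.ball p r)) :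
    ∃ h : A ≤ B, ∀ n : ℕ,
      Nonempty (LinearMap.range (ComplexPair.mapH n h) ≃ₗ[ℤ] (localPair K x).H n) := by
  obtain ⟨hPf, hPd⟩ := hP
  -- The sample is an ε₀-sample for some ε₀ < ε; the difference is needed later as room for small
  -- simplices.
  obtain ⟨ε₀, hε₀0, hPd, hε₀⟩ := ENNReal.lt_iff_exists_real_btwn.1 hPd
  have hε₀ε : ε₀ < ε := (ENNReal.ofReal_lt_ofReal_iff_of_nonneg hε₀0).1 hε₀
  have hε0 : 0 < ε := hε₀0.trans_lt hε₀ε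
  have hKP : ∀ k ∈ K, ∃ v ∈ P, dist k v ≤ ε₀ := fun k hk ↦ by
    obtain ⟨v, hv, h⟩ := Metric.exists_edist_lt_of_hausdorffEDist_lt (s := (K : Set X)) hk hPd
    rw [edist_dist] at h
    exact ⟨v, hv, (ENNReal.ofReal_lt_ofReal_iff_of_nonneg dist_nonneg).1 h |>.le⟩
  have ht' : 0 ≤ t ∧ dist x p ≤ t * ε ∧ ∀ v ∈ P, ∃ k ∈ K, dist v k ≤ t * ε := by
    by_cases hPK : P ⊆ K
    · have ht0 : t = 0 := by rw [ht, noiseConst, if_pos hPK]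
      subst ht0
      refine ⟨le_rfl, ?_, fun v hv ↦ ⟨v, hPK hv, by simp⟩⟩
      rcases hxp with h | h
      -- Here p itself lies in `K`, so minimality of the distance forces x = p.
      · simpa [dist_comm] using h.2 p (hPK hp)
      · exact absurd hPK h.1
    · have ht1 : t = 1 := by rw [ht, noiseConst, if_neg hPK]
      subst ht1
      refine ⟨zero_le_one, ?_, fun v hv ↦ ?_⟩
      · rcases hxp with h | h
        · exact absurd h.1 hPK
        · linarith [h.2]
      · rw [Metric.hausdorffEDist_comm] at hPd
        obtain ⟨k, hk, h⟩ := Metric.exists_edist_lt_of_hausdorffEDist_lt hv hPd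
        rw [edist_dist] at h
        have := (ENNReal.ofReal_lt_ofReal_iff_of_nonneg dist_nonneg).1 h
        exact ⟨k, hk, by linarith⟩
  obtain ⟨ht0, hxp', hPK⟩ := ht'
  obtain ⟨q, hqP, hq⟩ := exists_nearestPoint hPf ⟨p, hp⟩
  obtain ⟨-, hgx, hεx', hβ', -⟩ := hε
  rw [← hε'] at hεx' hβ'
  rw [← hβ] at hβ'
  simp only [gFun, fFun] at hβ hγ hR hr
  obtain ⟨g, hg⟩ : ∃ g, g = gFun t c 0 ε := ⟨_, rfl⟩
  rw [← hg] at hgx hε'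
  simp only [gFun] at hg
  have htε : 0 ≤ t * ε := mul_nonneg ht0 hε0.le
  have hcε : ε ≤ c * ε := le_mul_of_one_le_left hε0.le hc
  have hgε' : g ≤ ε' := by
    -- The section of A_x(g) at α = α^l(g) = ε' is nonempty, and its triples satisfy g ≤ α.
    obtain ⟨z, hz⟩ := hK.nonempty g hgx (αl g) ⟨le_rfl, hK.l_le_u g hgx⟩
    exact hε' ▸ hz.le_alpha
  have hg0 : 0 ≤ g := hgx.1
  have hε'0 : 0 ≤ ε' := hg0.trans hgε'
  have hcε' : ε' ≤ c * ε' := le_mul_of_one_le_left hε'0 hc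
  have hβε' : ε' ≤ β := by linarith
  obtain ⟨δ, hδ0, hδ, hδR⟩ := exists_triangle_subset_slab htri
  obtain ⟨R₁, hR₁⟩ : ∃ R₁, R₁ + (c + t) * ε = R := ⟨R - (c + t) * ε, by ring⟩
  obtain ⟨r₁, hr₁⟩ : ∃ r₁, r₁ = r + ε' + (1 + t) * ε := ⟨_, rfl⟩
  -- Here γ is used up exactly: R' - R₁ = g_1(0,ε) + g_c(0,ε) = f_c(0,ε) and r₁ - r' = g_c(ε',ε) +
  -- g_1(ε',ε) = f_c(ε',ε).
  have hrr₁ : r₁ + δ < R₁ := by linarith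
  have hr'r₁ : r' ≤ r₁ := by linarith
  have hR₁R' : R₁ ≤ R' := by linarith
  have hslab : ∀ a b : ℝ, r' ≤ b → a ≤ R' → b + δ < a → (a, b) ∈ slab K x T αl ε' β :=
    fun a b hb ha hab ↦ hδ ⟨htri.1.trans_le (EReal.coe_le_coe_iff.2 hb),
      (EReal.coe_le_coe_iff.2 ha).trans_lt htri.2.1, by exact_mod_cast hab⟩
  have hadm₀ : IsAdmissible K x T 0 R' r' 0 :=
    mem_slab (hslab R' r' le_rfl le_rfl (by linarith)) ⟨le_rfl, hε'0⟩
      ⟨hK.l_zero.le, hε'0.trans hβε'⟩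
  -- The choice ε' = α^l(g) makes ε' the least α that the slab covers at parameter g.
  have hadm₁ : IsAdmissible K x T g R₁ r₁ ε' :=
    mem_slab (hslab R₁ r₁ hr'r₁ hR₁R' hrr₁) ⟨hg0, hgε'⟩ ⟨hε'.ge, hβε'⟩
  have hadm₂ : IsAdmissible K x T ε' R₁ r' β :=
    mem_slab (hslab R₁ r' le_rfl hR₁R' (by linarith)) ⟨hε'0, le_rfl⟩ ⟨hβ'.1, le_rfl⟩
  have hr'0 : 0 < r' := hadm₀.alpha_lt
  have hR₁0 : 0 < R₁ := by linarith
  have hAB : A ≤ B := by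
    refine ⟨?_, ?_⟩
    · rw [hA, hB]
      exact hmono (by linarith) Subset.rfl
    · rw [hA', hB']
      exact hmono (by linarith) (sdiff_subset_sdiff_right (Metric.ball_subset_ball (by linarith)))
  refine ⟨hAB, fun n ↦ ?_⟩
  have hconv' : ∀ a : ℝ, a ≤ c * (ε' + ε) → ∀ v ∈ P, StronglyConvex (Metric.closedBall v a) :=
    fun a ha v hv ↦ stronglyConvex_closedBall (((EReal.coe_le_coe_iff.2 ha).trans_lt hconv).trans_le
      (iInf₂_le v hv))
  have h₀ : nbhdPair K x 0 R' ≤ nbhdPair K x g R₁ := nbhdPair_le hg0 hR₁R'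
  have h₁ : nbhdPair K x g R₁ ≤ nbhdPair K x ε' r₁ := nbhdPair_le hgε' (by linarith)
  have h₂ : nbhdPair K x ε' r₁ ≤ nbhdPair K x β r' := nbhdPair_le hβε' hr'r₁
  have h₃ : nbhdPair K x 0 R' ≤ nbhdPair K x 0 R₁ := nbhdPair_le le_rfl hR₁R'
  have hbij : Function.Bijective (SetPair.mapH n h₃) := hadm₀.iso_radius R₁ hR₁0 hR₁R' n
  -- Admissibility speaks of F(0,R₁); replacing it by F(0,R') does not change the image, since
  -- F(0,R') → F(0,R₁) is onto.
  have hj : LinearMap.range (SetPair.mapH n h₁ ∘ₗ SetPair.mapH n h₀) =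
      LinearMap.range (SetPair.mapH n h₁) := by
    rw [← SetPair.mapH_comp h₃ (nbhdPair_le hg0 le_rfl) h₀, ← LinearMap.comp_assoc,
      LinearMap.range_comp_of_range_eq_top _ (LinearMap.range_eq_top.2 hbij.2)]
    exact (hadm₁.iso_image n).2
  have hinj : Function.Injective
      (SetPair.mapH n h₂ ∘ₗ SetPair.mapH n h₁ ∘ₗ SetPair.mapH n h₀) := by
    have h := (hadm₂.iso_image n).1
    -- The inclusion map F(0,R') → F(β,r') is factored anew, through F(0,R₁) and F(ε',R₁), where
    -- admissibility at parameter ε' applies.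
    have e : SetPair.mapH n h₂ ∘ₗ SetPair.mapH n h₁ ∘ₗ SetPair.mapH n h₀ =
        (SetPair.mapH n (nbhdPair_le hadm₂.le_alpha hadm₂.le_R) ∘ₗ
          SetPair.mapH n (nbhdPair_le hadm₂.zero_le le_rfl)) ∘ₗ SetPair.mapH n h₃ := by
      have h₄ : nbhdPair K x 0 R' ≤ nbhdPair K x β r' := nbhdPair_le (hε'0.trans hβε') (by linarith)
      rw [SetPair.mapH_comp h₀ h₁ (h₀.1.trans h₁.1 |> fun a ↦ ⟨a, h₀.2.trans h₁.2⟩),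
        SetPair.mapH_comp _ _ h₄, LinearMap.comp_assoc,
        SetPair.mapH_comp h₃ _ (nbhdPair_le hε'0 hR₁R'), SetPair.mapH_comp _ _ h₄]
    rw [e]
    exact h.comp hbij.1
  have hε'ε : 0 ≤ ε' + ε := by linarith
  obtain ⟨e⟩ := nonempty_range_equiv_nbhdPair hε₀ε hx hc ht0 hqP hq hKP hPK hxp'
    (hconv' _ (by linarith)) (hconv' _ le_rfl) (by linarith) hgε' (by linarith) (by linarith) hR₁
    (by linarith) hr₁ h₀ h₁ h₂ (by linarith) hAB
    (hA ▸ (h𝒦 hε0.le _).1) (hA' ▸ (h𝒦 hε0.le _).1) (hA ▸ (h𝒦 hε0.le _).2)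
    (hA' ▸ (h𝒦 hε0.le _).2) (hB ▸ (h𝒦 hε'ε _).1) (hB' ▸ (h𝒦 hε'ε _).1)
    (hB ▸ (h𝒦 hε'ε _).2) (hB' ▸ (h𝒦 hε'ε _).2) n hj hinj
  exact ⟨(e.trans (AddEquiv.ofBijective _
    (hadm₀.iso_local R' (by linarith) le_rfl n))).toIntLinearEquiv⟩

end Admissible

end LocalHomology
end

/-! ### The theorem, for Čech and for Vietoris–Rips complexes -/

open LocalHomology in
theorem mainTheorem4 {X : Type u} [MetricSpace X] [CompleteSpace X] [LocallyCompactSpace X]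
    (hmid : ∀ y z : X, ∃ m : X, dist y z = 2 * dist y m ∧ dist y z = 2 * dist z m)
    (hX : LocallyStronglyConvex X)
    (K : TopologicalSpace.Compacts X) (x : X) (hx : x ∈ K)
    (T : Set ℝ) (εx : ℝ) (αl αu : ℝ → ℝ) (hK : IsWeaklySeemly K x T εx αl αu)
    (P : Set X) (ε : ℝ) (hP : IsSample (K : Set X) P ε)
    (p : X) (hp : p ∈ P)
    (hxp : (P ⊆ K ∧ ∀ z ∈ K, dist p x ≤ dist p z) ∨ (¬ P ⊆ K ∧ dist x p < ε))
    (t s : ℝ) (ht : t = noiseConst (K : Set X) P) (hs : s = ripsConst X) :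
    (∀ c ε' β γ R' r' R r : ℝ, c = 1 →
      ε ∈ goodSet K x T αl εx αu (fFun t c) (gFun t c) →
      ε' = αl (gFun t c 0 ε) →
      β = gFun t c ε' ε →
      γ = fFun t c 0 ε + fFun t c ε' ε →
      ((c * (ε' + ε) : ℝ) : EReal) < setConvRadius P →
      (R', r') ∈ triangle K x T αl ε' β (deltaBar K x T αl ε' β + (γ : EReal)) →
      R = R' - gFun t 1 0 ε →
      r = r' + gFun t c ε' ε →
      ∃ h : cechPair P p ε R ≤ cechPair P p (ε' + ε) r,
        ∀ n : ℕ, Nonempty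
          (LinearMap.range (ComplexPair.mapH n h) ≃ₗ[ℤ] (localPair K x).H n)) ∧
    (∀ c ε' β γ R' r' R r : ℝ, c = s →
      ε ∈ goodSet K x T αl εx αu (fFun t c) (gFun t c) →
      ε' = αl (gFun t c 0 ε) →
      β = gFun t c ε' ε →
      γ = fFun t c 0 ε + fFun t c ε' ε →
      ((c * (ε' + ε) : ℝ) : EReal) < setConvRadius P →
      (R', r') ∈ triangle K x T αl ε' β (deltaBar K x T αl ε' β + (γ : EReal)) →
      R = R' - gFun t 1 0 ε →
      r = r' + gFun t c ε' ε →
      ∃ h : ripsPair P p ε R ≤ ripsPair P p (ε' + ε) r,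
        ∀ n : ℕ, Nonempty
          (LinearMap.range (ComplexPair.mapH n h) ≃ₗ[ℤ] (localPair K x).H n)) := by
  refine ⟨?_, ?_⟩
  · intro c ε' β γ R' r' R r hc hε hε' hβ hγ hconv htri hR hr
    subst hc
    exact nonempty_range_equiv_localPair hK hx hP hp hxp ht le_rfl hε hε' hβ hγ hconv htri hR hr
      cech (fun _ _ ↦ ⟨le_rfl, cech_mono (one_mul _).ge Subset.rfl⟩) cech_mono rfl rfl rfl rfl
  · intro c ε' β γ R' r' R r hc hε hε' hβ hγ hconv htri hR hr
    subst hc hs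
    exact nonempty_range_equiv_localPair hK hx hP hp hxp ht one_le_ripsConst hε hε' hβ hγ hconv htri
      hR hr rips (fun ha Q ↦ ⟨cech_le_rips _ Q, rips_le_cech ha Q⟩) rips_mono rfl rfl rfl rfl
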